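/- Let $k$ be an algebraically closed field. Let $\mathrm{Aut}(\mathbb{A}^2_k)$ be the group of polynomial automorphisms $f=(f_1,f_2)$ of the affine plane, with the Zariski topology: a subset is closed if and only if its preimage under every morphism $A\to \mathrm{Aut}(\mathbb{A}^2_k)$ is closed, where $A$ runs over the algebraic varieties over $k$ and a morphism is a family of automorphisms given by an element of $\mathrm{Aut}(\mathbb{A}^2_{k[A]})$. For a commutative ring $R$, let $\mathrm{SAut}(\mathbb{A}^2_R)\subset \mathrm{Aut}(\mathbb{A}^2_R)$ be the subgroup of automorphisms with Jacobian determinant $1$; give $\mathrm{SAut}(\mathbb{A}^2_k)$ the induced topology. Conjugacy classes are taken in the group $\mathrm{SAut}(\mathbb{A}^2_k)$. An automorphism is called diagonalisable if it is conjugate in $\mathrm{Aut}(\mathbb{A}^2_k)$ to a diagonal linear map $(a_1x_1,a_2x_2)$, and algebraic if the sequence $(\deg(f^m))_{m\in\mathbb{N}}$ is bounded, where $\deg(f)=\max(\deg f_1,\deg f_2)$. Let $f\in \mathrm{SAut}(\mathbb{A}^2_k)$. Then the following hold. (1) If $f$ is diagonalisable, its conjugacy class is closed in $\mathrm{SAut}(\mathbb{A}^2_k)$.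 (2) If $f$ is algebraic but not diagonalisable, its conjugacy class is not closed in $\mathrm{SAut}(\mathbb{A}^2_k)$. More precisely, there exists an element $F\in \mathrm{SAut}(\mathbb{A}^2_{k[t]})$ such that for each $t\in k\setminus\{0\}$ the value $F(t)\in \mathrm{SAut}(\mathbb{A}^2_k)$ is conjugate to $f$ in $\mathrm{SAut}(\mathbb{A}^2_k)$, and $F(0)\in \mathrm{SAut}(\mathbb{A}^2_k)$ is diagonalisable. (3) If $f$ is not algebraic, its conjugacy class is closed in $\mathrm{SAut}(\mathbb{A}^2_k)$. -/

import Mathlib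

open CategoryTheory AlgebraicGeometry

universe u v w

namespace AffineAut

/-- `End(𝔸ⁿ_R)`: an algebraic endomorphism `f = (f₁, …, fₙ)` of affine `n`-space over `R`, given by
its components `fᵢ ∈ R[x₁, …, xₙ]`. -/
@[ext]
structure PolyEnd (n : ℕ) (R : Type v) [CommRing R] where
  /-- The components `f₁, …, fₙ`. -/
  coord : Fin n → MvPolynomial (Fin n) R

namespace PolyEnd

variable {n : ℕ} {R : Type v} [CommRing R] {S : Type w} [CommRing S]

/-- The product is the composition of maps: `f * g` is `x ↦ f (g x)`; its `i`-th component is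
`fᵢ(g₁, …, gₙ)`. -/
noncomputable instance : Monoid (PolyEnd n R) where
  one := ⟨fun i => MvPolynomial.X i⟩
  mul f g := ⟨fun i => MvPolynomial.bind₁ g.coord (f.coord i)⟩
  mul_assoc f g h := PolyEnd.ext (funext fun i => MvPolynomial.bind₁_bind₁ g.coord h.coord (f.coord i))
  one_mul f := PolyEnd.ext (funext fun i => MvPolynomial.bind₁_X_right f.coord i)
  mul_one f := PolyEnd.ext (funext fun i =>
    congrArg (fun φ : MvPolynomial (Fin n) R →ₐ[R] MvPolynomial (Fin n) R => φ (f.coord i))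
      MvPolynomial.bind₁_X_left)

theorem one_coord (i : Fin n) : (1 : PolyEnd n R).coord i = MvPolynomial.X i := rfl

theorem mul_coord (f g : PolyEnd n R) (i : Fin n) :
    (f * g).coord i = MvPolynomial.bind₁ g.coord (f.coord i) := rfl

/-- The degree of `f`: the maximal (total) degree of its components. -/
noncomputable def degree (f : PolyEnd n R) : ℕ :=
  Finset.univ.sup fun i => (f.coord i).totalDegree

/-- The Jacobian matrix `(∂fᵢ/∂xⱼ)`. -/
noncomputable def jacMatrix (f : PolyEnd n R) : Matrix (Fin n) (Fin n) (MvPolynomial (Fin n) R) :=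
  Matrix.of fun i j => MvPolynomial.pderiv j (f.coord i)

/-- The Jacobian determinant `Jac(f) = det (∂fᵢ/∂xⱼ)`. -/
noncomputable def jac (f : PolyEnd n R) : MvPolynomial (Fin n) R :=
  f.jacMatrix.det

theorem pderiv_bind (g : Fin n → MvPolynomial (Fin n) R) (p : MvPolynomial (Fin n) R) (i : Fin n) :
    MvPolynomial.pderiv i (MvPolynomial.bind₁ g p) =
      ∑ j, MvPolynomial.bind₁ g (MvPolynomial.pderiv j p) * MvPolynomial.pderiv i (g j) := by
  induction p using MvPolynomial.induction_on with
  | C a => simp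
  | add p q hp hq => simp [hp, hq, add_mul, Finset.sum_add_distrib]
  | mul_X p k hp =>
    simp only [map_mul, MvPolynomial.bind₁_X_right, Derivation.leibniz, smul_eq_mul, hp,
      MvPolynomial.pderiv_X, map_add, add_mul, Finset.sum_add_distrib, Finset.mul_sum]
    congr 1
    · rw [Finset.sum_eq_single k]
      · simp
      · intro b _ hb
        simp [hb.symm]
      · simp
    · exact Finset.sum_congr rfl fun j _ => by ring

theorem jac_mul (f g : PolyEnd n R) :
    (f * g).jac = MvPolynomial.bind₁ g.coord f.jac * g.jac := by
  have h : (f * g).jacMatrix = (MvPolynomial.bind₁ g.coord).mapMatrix f.jacMatrix * g.jacMatrix := by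
    ext1 i j
    simp [jacMatrix, Matrix.mul_apply, mul_coord, pderiv_bind]
  rw [jac, h, Matrix.det_mul, ← AlgHom.map_det]
  rfl

theorem jac_one : (1 : PolyEnd n R).jac = 1 := by
  have h : (1 : PolyEnd n R).jacMatrix = 1 := by
    ext1 i j
    simp [jacMatrix, one_coord, MvPolynomial.pderiv_X, Matrix.one_apply, Pi.single_apply]
  rw [jac, h, Matrix.det_one]

/-- Base change along a ring homomorphism `φ`: apply `φ` to all coefficients. -/
noncomputable def map (φ : R →+* S) : PolyEnd n R →* PolyEnd n S where
  toFun f := ⟨fun i => MvPolynomial.map φ (f.coord i)⟩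
  map_one' := PolyEnd.ext (funext fun i => MvPolynomial.map_X φ i)
  map_mul' f g := PolyEnd.ext (funext fun i => MvPolynomial.map_bind₁ φ g.coord (f.coord i))

theorem map_coord (φ : R →+* S) (f : PolyEnd n R) (i : Fin n) :
    (map φ f).coord i = MvPolynomial.map φ (f.coord i) := rfl

theorem jac_map (φ : R →+* S) (f : PolyEnd n R) :
    (map φ f).jac = MvPolynomial.map φ f.jac := by
  have h : (map φ f).jacMatrix = (MvPolynomial.map φ).mapMatrix f.jacMatrix := by
    ext1 i j
    simp [jacMatrix, map_coord, MvPolynomial.pderiv_map]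
  rw [jac, h, ← RingHom.map_det]
  rfl

end PolyEnd

/-- `Aut(𝔸ⁿ_R)`: the group of those elements of `End(𝔸ⁿ_R)` that admit an inverse there. -/
abbrev PolyAut (n : ℕ) (R : Type v) [CommRing R] : Type v := (PolyEnd n R)ˣ

/-- `SAut(𝔸ⁿ_R)`: the subgroup of `Aut(𝔸ⁿ_R)` of automorphisms with Jacobian `1`. -/
noncomputable def SAut (n : ℕ) (R : Type v) [CommRing R] : Subgroup (PolyAut n R) where
  carrier := {f | (f : PolyEnd n R).jac = 1}
  one_mem' := PolyEnd.jac_one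
  mul_mem' {f g} hf hg := by
    have hf' : (f : PolyEnd n R).jac = 1 := hf
    have hg' : (g : PolyEnd n R).jac = 1 := hg
    simp [PolyEnd.jac_mul, hf', hg']
  inv_mem' {f} hf := by
    have hf' : (f : PolyEnd n R).jac = 1 := hf
    have h := PolyEnd.jac_mul (f : PolyEnd n R) ((f⁻¹ : PolyAut n R) : PolyEnd n R)
    rw [Units.mul_inv, PolyEnd.jac_one, hf', map_one, one_mul] at h
    exact h.symm

theorem mem_SAut {n : ℕ} {R : Type v} [CommRing R] (f : PolyAut n R) :
    f ∈ SAut n R ↔ (f : PolyEnd n R).jac = 1 := Iff.rfl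

/-- Base change `Aut(𝔸ⁿ_R) → Aut(𝔸ⁿ_S)` along `φ : R → S`. -/
noncomputable def PolyAut.map {n : ℕ} {R : Type v} [CommRing R] {S : Type w} [CommRing S]
    (φ : R →+* S) : PolyAut n R →* PolyAut n S :=
  Units.map (PolyEnd.map φ)

/-- Base change `SAut(𝔸ⁿ_R) → SAut(𝔸ⁿ_S)` along `φ : R → S`. -/
noncomputable def SAut.map {n : ℕ} {R : Type v} [CommRing R] {S : Type w} [CommRing S]
    (φ : R →+* S) : SAut n R →* SAut n S :=
  ((PolyAut.map φ).comp (SAut n R).subtype).codRestrict (SAut n S) fun f => by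
    have hf : ((f : PolyAut n R) : PolyEnd n R).jac = 1 := f.2
    exact (PolyEnd.jac_map φ _).trans ((congrArg (MvPolynomial.map φ) hf).trans (map_one _))

/-- The value `F(t)` of a family `F ∈ SAut(𝔸ⁿ_{R[t]})` at a point `t ∈ R`. -/
noncomputable def SAut.value {n : ℕ} {R : Type v} [CommRing R] (F : SAut n (Polynomial R)) (t : R) :
    SAut n R :=
  SAut.map (Polynomial.evalRingHom t) F

/-- `f` is diagonalisable: it is conjugate, in `Aut(𝔸ⁿ)`, to a diagonal map
`(a₁x₁, …, aₙxₙ)` (the `aᵢ` are then units). -/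
def IsDiagonalisable {n : ℕ} {R : Type v} [CommRing R] (f : PolyAut n R) : Prop :=
  ∃ (g : PolyAut n R) (a : Fin n → R), ∀ i,
    ((g * f * g⁻¹ : PolyAut n R) : PolyEnd n R).coord i = MvPolynomial.C (a i) * MvPolynomial.X i

/-- `f` is algebraic: the degree sequence `(deg fᵐ)` of its iterates is bounded. -/
def IsAlgebraicAut {n : ℕ} {R : Type v} [CommRing R] (f : PolyAut n R) : Prop :=
  BddAbove (Set.range fun m : ℕ => ((f ^ m : PolyAut n R) : PolyEnd n R).degree)

/-- An algebraic variety over `k` (not necessarily irreducible): a reduced separated scheme of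
finite type over `k`. -/
structure AlgVariety (k : Type u) [Field k] where
  /-- The underlying scheme. -/
  X : Scheme.{u}
  /-- The structure morphism. -/
  str : X ⟶ Spec (CommRingCat.of k)
  reduced : IsReduced X
  separated : IsSeparated str
  locallyOfFiniteType : LocallyOfFiniteType str
  quasiCompact : QuasiCompact str

namespace AlgVariety

variable {k : Type u} [Field k]

/-- The `k`-points of `A`. For `k` algebraically closed these are the closed points of `A`. -/
structure Point (A : AlgVariety k) : Type u where
  /-- The underlying morphism, a section of the structure morphism. -/
  hom : Spec (CommRingCat.of k) ⟶ A.X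
  hom_str : hom ≫ A.str = 𝟙 _

/-- The point of the underlying topological space of `A` that belongs to a `k`-point. -/
noncomputable def Point.pt {A : AlgVariety k} (p : A.Point) : A.X :=
  p.hom (IsLocalRing.closedPoint k)

/-- The Zariski topology on `A(k)`. -/
noncomputable instance (A : AlgVariety k) : TopologicalSpace A.Point :=
  TopologicalSpace.induced Point.pt inferInstance

/-- The evaluation `k[A] → k` of global regular functions on `A` at a `k`-point. -/
noncomputable def Point.eval {A : AlgVariety k} (p : A.Point) : Γ(A.X, ⊤) →+* k :=
  (p.hom.appTop ≫ (Scheme.ΓSpecIso (CommRingCat.of k)).hom).hom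

end AlgVariety

/-- The Zariski topology on `Aut(𝔸ⁿ_k)`: the finest topology for which all morphisms
`A → Aut(𝔸ⁿ_k)`, `p ↦ F(p)`, are continuous, where `A` runs over the algebraic varieties over `k`
and a morphism is given by an element `F` of `Aut(𝔸ⁿ_{k[A]})`. -/
noncomputable instance zariskiTopology (n : ℕ) (k : Type u) [Field k] :
    TopologicalSpace (PolyAut n k) :=
  ⨆ (A : AlgVariety k) (F : PolyAut n Γ(A.X, ⊤)),
    TopologicalSpace.coinduced (fun p : A.Point => PolyAut.map p.eval F) inferInstance

/-- A set is closed iff its preimage under every morphism from a variety is closed. -/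
theorem isClosed_polyAut_iff {n : ℕ} {k : Type u} [Field k] (C : Set (PolyAut n k)) :
    IsClosed C ↔ ∀ (A : AlgVariety k) (F : PolyAut n Γ(A.X, ⊤)),
      IsClosed {p : A.Point | PolyAut.map p.eval F ∈ C} := by
  simp only [isClosed_iSup_iff, isClosed_coinduced]
  rfl

end AffineAut

/-!
Special automorphisms of the plane over an algebraically closed field `k` are studied through the
degree, regarded as a valuation on `k[x, y]`, and through arbitrary valuations, at whose points a
polynomial map can be followed to infinity.

*Structure.* If `z` and `w` have negative degree and nonzero Wronskian, the degree of `h(z, w)`, for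
a nonzero polynomial `h`, is bounded below in terms of the degree of the Wronskian and the order of
`h(0, W)` in `W`. This bound, applied after a monomial substitution to the components of an
automorphism, gives the theorem of van der Kulk `exists_degree_reduction`: the degree of a
non-affine automorphism is lowered by an elementary map. Hence every element of `SAut` is conjugate
to a triangular map `(αx + p(y), α⁻¹y + c)` or to a product `rotProd` of maps `s b`, where `s = (y,
-x)` and the `b` are triangular and not affine (`exists_normal_form`); the latter are called Hénon
maps here. A Hénon map at least squares the size of a large point whose second coordinate dominates,
and its inverse does so where the first one dominates. So Hénon maps are exactly the case of a
non-algebraic `f`. The leading form of a component of an automorphism is a power of a linear form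
(`exists_linear_leadingForm`), so that components grow as fast as their degree allows at most
points.

*Closed classes.* By `isClosed_of_forall_family` it suffices to show that the value at a point of a
family over an affine variety is conjugate to `H` if this holds at points arbitrarily close to it,
where `H` is the Hénon map or the diagonal map in question. The conjugations `g` with `F = g H g⁻¹`
can be chosen with degree bounded in terms of that of `F` (`exists_conj_degree_le_rotProd`,
`exists_conj_degree_le_diag`), so together they form an automorphism over a product of copies of
`k`. A valuation ring `O` dominating the local ring of the base at the point then carries a family
over `O` that is conjugate to `H` over the quotient field of `O`
(`exists_valuationSubring_of_limit`), and the task is to show the same over the residue field.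

For a Hénon map `H`, expansion forces `g⁻¹` to be integral over `O`: at a generic point where `g⁻¹`
had a pole, `H` or `H⁻¹` would increase the pole, although `F` has no poles. As the Jacobian is `1`,
its reduction is again an automorphism (`exists_residue_conj_rotProd`). Conjugacy over the residue
field descends to `k` by the Nullstellensatz.

For a diagonal map `H = (ax, a⁻¹y)` the automorphism `g` need not have a limit. But the limit `F₀`
is again algebraic, hence triangular up to conjugacy, and polynomials are sums of eigenvectors for
the action of `F₀`, as they are for that of `H`; such a triangular map is conjugate to `(αx, α⁻¹y)`.
If `α = 1`, reduction of an eigenvector shows `a = 1`. If `α ≠ 1`, the fixed point of `F₀` is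
nondegenerate, so that it persists nearby: the scheme of nondegenerate fixed points is étale over
the base. Comparing traces of Jacobian matrices, `α + α⁻¹ = a + a⁻¹`.

*Classes that are not closed.* A triangular map without translation part is degenerated to its
diagonal part by conjugation with diagonal maps. Otherwise it is conjugate to `(x + p(y), y + 1)`.
In characteristic zero `p` can be removed, and `(x, y + t)` does; in characteristic `p` one uses the
family `shear`, built from the maps `(x - tᵃq(w)ᵖ, y + t + tᴱq(w))` with `w = yᵖ + tᴺx`.
-/

namespace AffineAut

/-! ### Evaluation, triangular automorphisms and the rotation -/

section Basic

open MvPolynomial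

namespace PolyEnd

section Act

variable {n : ℕ} {R : Type*} [CommRing R] {L : Type*} [CommRing L] [Algebra R L]

/-- The value of a polynomial endomorphism at a point with coordinates in an `R`-algebra `L`. For
`L = R[x₁, …, xₙ]` this is composition of endomorphisms. -/
noncomputable def act (f : PolyEnd n R) (Q : Fin n → L) : Fin n → L := fun i => aeval Q (f.coord i)

theorem act_apply (f : PolyEnd n R) (Q : Fin n → L) (i : Fin n) :
    f.act Q i = aeval Q (f.coord i) := rfl

theorem act_mul (f g : PolyEnd n R) (Q : Fin n → L) : (f * g).act Q = f.act (g.act Q) := by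
  funext i
  rw [act_apply, act_apply, mul_coord, aeval_bind₁]
  rfl

theorem act_one (Q : Fin n → L) : (1 : PolyEnd n R).act Q = Q := by
  funext i
  rw [act_apply, one_coord, aeval_X]

theorem mul_coord_aeval (f g : PolyEnd n R) (i : Fin n) :
    (f * g).coord i = aeval g.coord (f.coord i) := rfl

theorem ext_two {f g : PolyEnd 2 R} (h0 : f.coord 0 = g.coord 0) (h1 : f.coord 1 = g.coord 1) :
    f = g := by
  ext1
  funext i
  fin_cases i
  · exact h0
  · exact h1

theorem jac_two (f : PolyEnd 2 R) :
    f.jac = pderiv 0 (f.coord 0) * pderiv 1 (f.coord 1)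
      - pderiv 1 (f.coord 0) * pderiv 0 (f.coord 1) := by
  simp [jac, jacMatrix, Matrix.det_fin_two]

theorem totalDegree_le_degree (f : PolyEnd n R) (i : Fin n) :
    (f.coord i).totalDegree ≤ f.degree :=
  Finset.le_sup (f := fun i => (f.coord i).totalDegree) (Finset.mem_univ i)

theorem degree_le_iff (f : PolyEnd n R) (d : ℕ) :
    f.degree ≤ d ↔ ∀ i, (f.coord i).totalDegree ≤ d := by
  simp [degree]

end Act

end PolyEnd

section Degree

variable {σ τ : Type*} {R : Type*} [CommRing R]

theorem totalDegree_aeval_le (p : MvPolynomial σ R) (g : σ → MvPolynomial τ R) (d : ℕ)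
    (hg : ∀ i, (g i).totalDegree ≤ d) : (aeval g p).totalDegree ≤ p.totalDegree * d := by
  rw [aeval_def, eval₂_eq]
  refine totalDegree_finsetSum_le fun m hm => ?_
  refine (totalDegree_mul _ _).trans ?_
  rw [algebraMap_eq, totalDegree_C, zero_add]
  refine (totalDegree_finsetProd _ _).trans ?_
  calc ∑ i ∈ m.support, (g i ^ m i).totalDegree ≤ ∑ i ∈ m.support, m i * d :=
        Finset.sum_le_sum fun i _ =>
          (totalDegree_pow _ _).trans (Nat.mul_le_mul_left _ (hg i))
    _ = (∑ i ∈ m.support, m i) * d := (Finset.sum_mul _ _ _).symm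
    _ ≤ p.totalDegree * d := Nat.mul_le_mul_right _ (le_totalDegree hm)

theorem PolyEnd.degree_mul_le {n : ℕ} (f g : PolyEnd n R) :
    (f * g).degree ≤ f.degree * g.degree := by
  rw [PolyEnd.degree_le_iff]
  intro i
  exact (totalDegree_aeval_le _ _ _ g.totalDegree_le_degree).trans
    (Nat.mul_le_mul_right _ (f.totalDegree_le_degree i))

theorem totalDegree_X_le (i : σ) : (X i : MvPolynomial σ R).totalDegree ≤ 1 := by
  rcases subsingleton_or_nontrivial R with h | h
  · rw [Subsingleton.elim (X i : MvPolynomial σ R) 0, totalDegree_zero]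
    exact zero_le_one
  · rw [totalDegree_X]

theorem totalDegree_aeval_X_le (i : σ) (p : Polynomial R) :
    (Polynomial.aeval (X i : MvPolynomial σ R) p).totalDegree ≤ p.natDegree := by
  rw [Polynomial.aeval_eq_sum_range]
  refine totalDegree_finsetSum_le fun j hj => ?_
  refine (totalDegree_smul_le _ _).trans ?_
  refine (totalDegree_pow _ _).trans ?_
  refine (Nat.mul_le_mul_left j (totalDegree_X_le i)).trans ?_
  rw [mul_one]
  exact Nat.lt_succ_iff.mp (Finset.mem_range.mp hj)

end Degree

section Tri

variable {R : Type*} [CommRing R]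

theorem aeval_polynomial_aeval {L : Type*} [CommRing L] [Algebra R L] (Q : Fin 2 → L) (i : Fin 2)
    (p : Polynomial R) :
    aeval Q (Polynomial.aeval (X i : MvPolynomial (Fin 2) R) p) = Polynomial.aeval (Q i) p := by
  rw [← Polynomial.aeval_algHom_apply, aeval_X]

theorem bind₁_polynomial_aeval (Q : Fin 2 → MvPolynomial (Fin 2) R) (i : Fin 2)
    (p : Polynomial R) :
    bind₁ Q (Polynomial.aeval (X i : MvPolynomial (Fin 2) R) p) = Polynomial.aeval (Q i) p :=
  aeval_polynomial_aeval Q i p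

/-- The triangular endomorphism `(αx + p(y), α⁻¹y + c)`. -/
noncomputable def triEnd (α : Rˣ) (p : Polynomial R) (c : R) : PolyEnd 2 R :=
  ⟨![C (α : R) * X 0 + Polynomial.aeval (X 1) p, C ((α⁻¹ : Rˣ) : R) * X 1 + C c]⟩

theorem triEnd_coord_zero (α : Rˣ) (p : Polynomial R) (c : R) :
    (triEnd α p c).coord 0 = C (α : R) * X 0 + Polynomial.aeval (X 1) p := rfl

theorem triEnd_coord_one (α : Rˣ) (p : Polynomial R) (c : R) :
    (triEnd α p c).coord 1 = C ((α⁻¹ : Rˣ) : R) * X 1 + C c := rfl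

theorem triEnd_mul (α β : Rˣ) (p q : Polynomial R) (c d : R) :
    triEnd α p c * triEnd β q d =
      triEnd (α * β) (Polynomial.C (α : R) * q
        + p.comp (Polynomial.C ((β⁻¹ : Rˣ) : R) * Polynomial.X + Polynomial.C d))
        (((α⁻¹ : Rˣ) : R) * d + c) := by
  apply PolyEnd.ext_two
  · rw [PolyEnd.mul_coord, triEnd_coord_zero, triEnd_coord_zero, map_add, map_mul, bind₁_C_right,
      bind₁_X_right, bind₁_polynomial_aeval, triEnd_coord_zero, triEnd_coord_one, map_add,
      Polynomial.aeval_comp]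
    simp [mul_add, Polynomial.aeval_C, algebraMap_eq]
    ring
  · rw [PolyEnd.mul_coord, triEnd_coord_one, triEnd_coord_one, map_add, map_mul, bind₁_C_right,
      bind₁_X_right, bind₁_C_right, triEnd_coord_one]
    simp [mul_add]
    ring

theorem triEnd_one : triEnd (1 : Rˣ) 0 0 = 1 := by
  apply PolyEnd.ext_two
  · simp [triEnd_coord_zero, PolyEnd.one_coord]
  · simp [triEnd_coord_one, PolyEnd.one_coord]

/-- The second component of the inverse of `triEnd α p c`. -/
noncomputable def triInvPoly (α : Rˣ) (p : Polynomial R) (c : R) : Polynomial R :=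
  -(Polynomial.C ((α⁻¹ : Rˣ) : R) *
    p.comp (Polynomial.C (α : R) * Polynomial.X - Polynomial.C ((α : R) * c)))

theorem triEnd_mul_inv (α : Rˣ) (p : Polynomial R) (c : R) :
    triEnd α p c * triEnd α⁻¹ (triInvPoly α p c) (-(α * c)) = 1 := by
  rw [triEnd_mul, ← triEnd_one]
  congr 1
  · simp
  · simp only [triInvPoly, inv_inv, mul_neg, ← mul_assoc, ← Polynomial.C_mul, Units.mul_inv,
      Polynomial.C_1, one_mul, Polynomial.C_neg, ← sub_eq_add_neg, neg_add_cancel]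
  · simp

theorem triEnd_inv_mul (α : Rˣ) (p : Polynomial R) (c : R) :
    triEnd α⁻¹ (triInvPoly α p c) (-(α * c)) * triEnd α p c = 1 := by
  rw [triEnd_mul, ← triEnd_one]
  congr 1
  · simp
  · simp only [triInvPoly, Polynomial.neg_comp, Polynomial.mul_comp, Polynomial.C_comp,
      Polynomial.comp_assoc, Polynomial.sub_comp, Polynomial.X_comp, mul_add, ← mul_assoc,
      ← Polynomial.C_mul, Units.mul_inv, Polynomial.C_1, one_mul, add_sub_cancel_right,
      Polynomial.comp_X, add_neg_cancel]
  · simp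

/-- The triangular automorphism `(αx + p(y), α⁻¹y + c)`, of Jacobian `1`. -/
noncomputable def tri (α : Rˣ) (p : Polynomial R) (c : R) : SAut 2 R :=
  ⟨⟨triEnd α p c, triEnd α⁻¹ (triInvPoly α p c) (-(α * c)), triEnd_mul_inv α p c,
    triEnd_inv_mul α p c⟩, by
    rw [mem_SAut, PolyEnd.jac_two]
    simp [triEnd_coord_zero, triEnd_coord_one, Derivation.leibniz, pderiv_X, Derivation.map_aeval,
      ← C_mul]⟩

theorem tri_val (α : Rˣ) (p : Polynomial R) (c : R) :
    ((tri α p c : PolyAut 2 R) : PolyEnd 2 R) = triEnd α p c := rfl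

/-- Equality in `SAut` can be tested on the underlying endomorphisms. -/
theorem SAut.ext_end {n : ℕ} {f g : SAut n R}
    (h : ((f : PolyAut n R) : PolyEnd n R) = ((g : PolyAut n R) : PolyEnd n R)) : f = g :=
  Subtype.ext (Units.ext h)

theorem tri_mul (α β : Rˣ) (p q : Polynomial R) (c d : R) :
    tri α p c * tri β q d =
      tri (α * β) (Polynomial.C (α : R) * q
        + p.comp (Polynomial.C ((β⁻¹ : Rˣ) : R) * Polynomial.X + Polynomial.C d))
        (((α⁻¹ : Rˣ) : R) * d + c) :=
  SAut.ext_end (triEnd_mul α β p q c d)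

theorem tri_one : tri (1 : Rˣ) 0 0 = 1 := SAut.ext_end triEnd_one

theorem tri_inv (α : Rˣ) (p : Polynomial R) (c : R) :
    (tri α p c)⁻¹ = tri α⁻¹ (triInvPoly α p c) (-(α * c)) :=
  inv_eq_of_mul_eq_one_right (SAut.ext_end (triEnd_mul_inv α p c))

variable (R) in
/-- The rotation `(y, -x)`. -/
noncomputable def rot : SAut 2 R :=
  ⟨⟨⟨![X 1, -X 0]⟩, ⟨![-X 1, X 0]⟩,
    PolyEnd.ext_two (by simp [PolyEnd.mul_coord, PolyEnd.one_coord])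
      (by simp [PolyEnd.mul_coord, PolyEnd.one_coord]),
    PolyEnd.ext_two (by simp [PolyEnd.mul_coord, PolyEnd.one_coord])
      (by simp [PolyEnd.mul_coord, PolyEnd.one_coord])⟩, by
    rw [mem_SAut, PolyEnd.jac_two]
    simp [pderiv_X]⟩

theorem rot_coord_zero : ((rot R : PolyAut 2 R) : PolyEnd 2 R).coord 0 = X 1 := rfl

theorem rot_coord_one : ((rot R : PolyAut 2 R) : PolyEnd 2 R).coord 1 = -X 0 := rfl

theorem rot_inv_coord_zero :
    (((rot R)⁻¹ : SAut 2 R) : PolyAut 2 R).val.coord 0 = -X 1 := rfl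

theorem rot_inv_coord_one :
    (((rot R)⁻¹ : SAut 2 R) : PolyAut 2 R).val.coord 1 = X 0 := rfl

variable {L : Type*} [CommRing L] [Algebra R L] (Q : Fin 2 → L)

theorem act_tri_zero (α : Rˣ) (p : Polynomial R) (c : R) :
    ((tri α p c : PolyAut 2 R) : PolyEnd 2 R).act Q 0 =
      algebraMap R L α * Q 0 + Polynomial.aeval (Q 1) p := by
  rw [PolyEnd.act_apply, tri_val, triEnd_coord_zero, map_add, aeval_polynomial_aeval]
  simp

theorem act_tri_one (α : Rˣ) (p : Polynomial R) (c : R) :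
    ((tri α p c : PolyAut 2 R) : PolyEnd 2 R).act Q 1 =
      algebraMap R L ((α⁻¹ : Rˣ) : R) * Q 1 + algebraMap R L c := by
  rw [PolyEnd.act_apply, tri_val, triEnd_coord_one]
  simp

theorem act_rot_zero : ((rot R : PolyAut 2 R) : PolyEnd 2 R).act Q 0 = Q 1 := by
  rw [PolyEnd.act_apply, rot_coord_zero, aeval_X]

theorem act_rot_one : ((rot R : PolyAut 2 R) : PolyEnd 2 R).act Q 1 = -Q 0 := by
  rw [PolyEnd.act_apply, rot_coord_one, map_neg, aeval_X]

theorem act_rot_inv_zero :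
    (((rot R)⁻¹ : SAut 2 R) : PolyAut 2 R).val.act Q 0 = -Q 1 := by
  rw [PolyEnd.act_apply, rot_inv_coord_zero, map_neg, aeval_X]

theorem act_rot_inv_one :
    (((rot R)⁻¹ : SAut 2 R) : PolyAut 2 R).val.act Q 1 = Q 0 := by
  rw [PolyEnd.act_apply, rot_inv_coord_one, aeval_X]

end Tri

end Basic

/-! ### A lower bound for the size of a polynomial in two local parameters -/

section KeyLemma

open Polynomial WithZero

variable {k K : Type*} [Field k] [Field K] [Algebra k K]

/-- The Jacobian `∂(z, w)` with respect to two derivations. -/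
noncomputable def wronsk (D₀ D₁ : Derivation k K K) (z w : K) : K := D₀ z * D₁ w - D₁ z * D₀ w

variable (D₀ D₁ : Derivation k K K)

theorem wronsk_div_left {z : K} (hz : z ≠ 0) (w : K) :
    wronsk D₀ D₁ z (w / z) = wronsk D₀ D₁ z w / z := by
  simp only [wronsk, Derivation.leibniz_div, smul_eq_mul]
  field_simp
  ring

theorem wronsk_div_right (z : K) {w : K} (hw : w ≠ 0) :
    wronsk D₀ D₁ (z / w) w = wronsk D₀ D₁ z w / w := by
  simp only [wronsk, Derivation.leibniz_div, smul_eq_mul]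
  field_simp
  ring

theorem wronsk_sub_const (z w : K) (c : k) :
    wronsk D₀ D₁ z (w - algebraMap k K c) = wronsk D₀ D₁ z w := by
  simp [wronsk]

variable {v : Valuation K ℤᵐ⁰}

theorem wronsk_le (hD₀ : ∀ z, v (D₀ z) ≤ v z * exp (-1)) (hD₁ : ∀ z, v (D₁ z) ≤ v z * exp (-1))
    (z w : K) : v (wronsk D₀ D₁ z w) ≤ v z * v w * exp (-2) := by
  have key : ∀ a b : K, v a ≤ v z * exp (-1) → v b ≤ v w * exp (-1) →
      v (a * b) ≤ v z * v w * exp (-2) := by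
    intro a b ha hb
    rw [map_mul]
    refine (mul_le_mul' ha hb).trans (le_of_eq ?_)
    rw [show (-2 : ℤ) = -1 + -1 by norm_num, exp_add]
    exact mul_mul_mul_comm _ _ _ _
  exact v.map_sub_le (key _ _ (hD₀ z) (hD₁ w)) (key _ _ (hD₁ z) (hD₀ w))

/-- The restriction `h(0, W)` of `h(Z, W)` to the axis `Z = 0`. -/
noncomputable def specZero : k[X][X] →+* k[X] := mapRingHom (evalRingHom 0)

theorem specZero_coeff (h : k[X][X]) (j : ℕ) : (specZero h).coeff j = (h.coeff j).coeff 0 := by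
  simp [specZero, coeff_map, coeff_zero_eq_eval_zero]

/-- Strict transform in the chart `w = z w'` of a blow-up: `h(Z, ZW) = Z ^ μ h'(Z, W)`. -/
theorem exists_strict_transform (h : k[X][X]) {j : ℕ} (hj : (specZero h).coeff j ≠ 0) :
    ∃ (μ : ℕ) (h' : k[X][X]), μ ≤ j ∧ specZero h' ≠ 0 ∧ (specZero h').natDegree ≤ μ ∧
      h.comp (C X * X) = C X ^ μ * h' := by
  have hcoeff : ∀ i, (h.comp (C X * X)).coeff i = h.coeff i * X ^ i := fun i => by
    rw [comp_C_mul_X_coeff]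
  rw [specZero_coeff] at hj
  have hne : h.comp (C X * X) ≠ 0 := by
    intro h0
    have := hcoeff j
    rw [h0, coeff_zero, eq_comm, mul_eq_zero] at this
    rcases this with h1 | h1
    · rw [h1] at hj
      exact hj (coeff_zero 0)
    · exact pow_ne_zero _ X_ne_zero h1
  have hirr : Irreducible (C X : k[X][X]) := (prime_C_iff.mpr prime_X).irreducible
  obtain ⟨μ, h', hh', he⟩ := WfDvdMonoid.max_power_factor hne hirr
  have hcoeff' : ∀ i, h.coeff i * X ^ i = X ^ μ * h'.coeff i := fun i => by
    rw [← hcoeff, he, ← C_pow, coeff_C_mul]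
  refine ⟨μ, h', ?_, ?_, ?_, he⟩
  · by_contra! hlt
    have h1 : h.coeff j = X ^ (μ - j) * h'.coeff j := by
      apply mul_right_cancel₀ (pow_ne_zero j (X_ne_zero (R := k)))
      rw [hcoeff', mul_right_comm, ← pow_add, Nat.sub_add_cancel hlt.le]
    apply hj
    rw [h1, mul_coeff_zero, coeff_X_pow, if_neg (by omega), zero_mul]
  · intro h0
    apply hh'
    rw [C_dvd_iff_dvd_coeff]
    intro i
    rw [X_dvd_iff, ← specZero_coeff, h0, coeff_zero]
  · rw [natDegree_le_iff_coeff_eq_zero]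
    intro i hi
    have h1 : h'.coeff i = h.coeff i * X ^ (i - μ) := by
      apply mul_left_cancel₀ (pow_ne_zero μ (X_ne_zero (R := k)))
      rw [← hcoeff', mul_left_comm, ← pow_add, Nat.add_sub_cancel' hi.le]
    rw [specZero_coeff, h1, mul_coeff_zero, coeff_X_pow, if_neg (by omega), mul_zero]

theorem val_aeval_lt_one (hv : ∀ c : k, c ≠ 0 → v (algebraMap k K c) = 1) {z : K} (hz : v z < 1)
    (p : k[X]) (hp : p.coeff 0 = 0) : v (aeval z p) < 1 := by
  obtain ⟨q, rfl⟩ := X_dvd_iff.mpr hp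
  rw [map_mul, aeval_X, map_mul]
  refine mul_lt_one_of_lt_of_le hz ?_
  rw [aeval_eq_sum_range]
  refine v.map_sum_le fun i _ => ?_
  rw [Algebra.smul_def, map_mul, map_pow]
  refine mul_le_one' ?_ (pow_le_one' hz.le _)
  by_cases h : q.coeff i = 0
  · simp [h]
  · exact (hv _ h).le

theorem val_aeval_eq_one [IsAlgClosed k] (hv : ∀ c : k, c ≠ 0 → v (algebraMap k K c) = 1) {w : K}
    (hw : ∀ c : k, v (w - algebraMap k K c) = 1) (p : k[X]) (hp : p ≠ 0) : v (aeval w p) = 1 := by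
  rw [(IsAlgClosed.splits p).eq_prod_roots, map_mul, aeval_C, map_mul,
    hv _ (leadingCoeff_ne_zero.mpr hp), one_mul, map_multiset_prod, map_multiset_prod,
    Multiset.map_map, Multiset.map_map]
  refine Multiset.prod_eq_one fun x hx => ?_
  obtain ⟨c, _, rfl⟩ := Multiset.mem_map.mp hx
  simpa using hw c

/-- If `w` has a residue that is transcendental over `k`, then a polynomial in `z, w` that does not
vanish identically on `Z = 0` has size `1`. -/
theorem val_aevalAeval_eq_one [IsAlgClosed k] (hv : ∀ c : k, c ≠ 0 → v (algebraMap k K c) = 1)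
    {z w : K} (hz : v z < 1) (hw : ∀ c : k, v (w - algebraMap k K c) = 1) (h : k[X][X])
    (hh : specZero h ≠ 0) : v (aevalAeval z w h) = 1 := by
  have hw1 : v w ≤ 1 := by simpa using (hw 0).le
  have h1 : v (aeval w (specZero h)) = 1 := val_aeval_eq_one hv hw _ hh
  rw [← h1]
  refine v.map_eq_of_sub_lt ?_
  rw [h1]
  have e1 : aevalAeval z w h = ∑ i ∈ Finset.range (h.natDegree + 1),
      aeval z (h.coeff i) * w ^ i := by
    conv_lhs => rw [h.as_sum_range_C_mul_X_pow]
    simp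
  have e2 : aeval w (specZero h) =
      ∑ i ∈ Finset.range (h.natDegree + 1), algebraMap k K ((h.coeff i).coeff 0) * w ^ i := by
    rw [aeval_eq_sum_range' (n := h.natDegree + 1)
      (show (specZero h).natDegree < h.natDegree + 1 from
        Nat.lt_succ_of_le (natDegree_map_le (f := evalRingHom (0 : k)) (p := h)))]
    refine Finset.sum_congr rfl fun i _ => ?_
    rw [specZero_coeff, Algebra.smul_def]
  rw [e1, e2, ← Finset.sum_sub_distrib]
  refine v.map_sum_lt one_ne_zero fun i _ => ?_
  rw [← sub_mul, map_mul, map_pow]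
  refine mul_lt_one_of_lt_of_le ?_ (pow_le_one' hw1 _)
  have := val_aeval_lt_one hv hz (h.coeff i - C ((h.coeff i).coeff 0)) (by simp)
  simpa using this

/-- Pull-back of `h(Z, W)` under `(Z, W) ↦ (ZW, W)`. -/
noncomputable def mulLeftHom : k[X][X] →ₐ[k] k[X][X] := aevalAeval (C X * X) X

theorem specZero_mulLeftHom (h : k[X][X]) : specZero (mulLeftHom h) = specZero h := by
  have : (specZero.comp (mulLeftHom (k := k)).toRingHom) = specZero := by
    ext <;> simp [mulLeftHom, specZero]
  exact congrArg (fun φ : k[X][X] →+* k[X] => φ h) this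

theorem aevalAeval_mulLeftHom (z w : K) (h : k[X][X]) :
    aevalAeval z w (mulLeftHom h) = aevalAeval (z * w) w h := by
  have : ((aevalAeval z w).comp (mulLeftHom (k := k))) = aevalAeval (z * w) w := by
    ext <;> simp [mulLeftHom, mul_comm w z]
  exact congrArg (fun φ : k[X][X] →ₐ[k] K => φ h) this

theorem aevalAeval_comp (z w : K) (q h : k[X][X]) :
    aevalAeval z w (h.comp q) = aevalAeval z (aevalAeval z w q) h := by
  induction h using Polynomial.induction_on' with
  | add a b ha hb => rw [add_comp, map_add, map_add, ha, hb]
  | monomial n a => rw [monomial_comp, map_mul, map_pow, ← C_mul_X_pow_eq_monomial, map_mul,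
      map_pow, aevalAeval_C, aevalAeval_C, aevalAeval_Y]

theorem le_exp_neg_one {x : ℤᵐ⁰} (hx : x < 1) : x ≤ exp (-1) := by
  by_cases h : x = 0
  · simp [h]
  · rw [← exp_log h, ← exp_zero, exp_lt_exp] at hx
    rw [← exp_log h, exp_le_exp]
    omega

/-- For local parameters `z, w` of size less than `1` and a polynomial `h` with
`ord_W h(0, W) ≤ j`, the size of `h(z, w)` is at least the `j`-th power of
`|∂(z, w)| e² / |z|`. The proof blows up the centre of the valuation: each blow-up enlarges
`|∂(z, w)|`, which stays at most `e⁻²`, so that after finitely many of them the residue of the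
second coordinate is transcendental over `k`. -/
theorem le_val_aevalAeval [IsAlgClosed k] (hv : ∀ c : k, c ≠ 0 → v (algebraMap k K c) = 1)
    (hD₀ : ∀ z, v (D₀ z) ≤ v z * exp (-1)) (hD₁ : ∀ z, v (D₁ z) ≤ v z * exp (-1)) {z w : K}
    (hz : v z < 1) (hw : v w < 1) (hJ : wronsk D₀ D₁ z w ≠ 0) (h : k[X][X]) {j : ℕ}
    (hj : (specZero h).coeff j ≠ 0) :
    (v (wronsk D₀ D₁ z w) * exp 2 / v z) ^ j ≤ v (aevalAeval z w h) := by
  obtain ⟨n, hn⟩ : ∃ n : ℕ, exp (-(n : ℤ)) ≤ v (wronsk D₀ D₁ z w) := by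
    refine ⟨(-log (v (wronsk D₀ D₁ z w))).toNat, ?_⟩
    rw [← le_log_iff_exp_le ((v.ne_zero_iff).mpr hJ)]
    omega
  induction n generalizing z w h j with
  | zero =>
    exfalso
    have h1 := hn.trans (wronsk_le D₀ D₁ hD₀ hD₁ z w)
    have h2 : v z * v w * exp (-2) < 1 := by
      refine mul_lt_one_of_lt_of_le (mul_lt_one_of_lt_of_le hz hw.le) ?_
      rw [← exp_zero, exp_le_exp]
      norm_num
    simp only [Nat.cast_zero, neg_zero, exp_zero] at h1
    exact absurd h1 (not_le.mpr h2)
  | succ n ih =>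
    have hz0 : z ≠ 0 := by
      rintro rfl
      simp [wronsk] at hJ
    have hw0 : w ≠ 0 := by
      rintro rfl
      simp [wronsk] at hJ
    have hvz : v z ≠ 0 := v.ne_zero_iff.mpr hz0
    have hvw : v w ≠ 0 := v.ne_zero_iff.mpr hw0
    have grow : ∀ x : K, x ≠ 0 → v x < 1 →
        exp (-(n : ℤ)) ≤ v (wronsk D₀ D₁ z w) / v x := by
      intro x hx hx1
      rw [le_div_iff₀ (zero_lt_iff.mpr (v.ne_zero_iff.mpr hx))]
      refine le_trans ?_ hn
      refine (mul_le_mul_right (le_exp_neg_one hx1) _).trans (le_of_eq ?_)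
      rw [← exp_add]
      congr 1
      push_cast
      ring
    set β := v (wronsk D₀ D₁ z w) * exp 2 / v z with hβ
    have hβw : β ≤ v w := by
      rw [hβ, div_le_iff₀ (zero_lt_iff.mpr hvz)]
      refine (mul_le_mul_left (wronsk_le D₀ D₁ hD₀ hD₁ z w) _).trans (le_of_eq ?_)
      rw [mul_assoc, ← exp_add]
      simp [mul_comm]
    by_cases hwz : v w ≤ v z
    · obtain ⟨μ, h', hμ, h'0, hdeg, he⟩ := exists_strict_transform h hj
      have hval : v (aevalAeval z w h) = v z ^ μ * v (aevalAeval z (w / z) h') := by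
        have e : aevalAeval z w h = aevalAeval z (w / z) (h.comp (C X * X)) := by
          rw [aevalAeval_comp, map_mul, aevalAeval_X, aevalAeval_Y, mul_div_cancel₀ _ hz0]
        rw [e, he, map_mul, map_pow, aevalAeval_X, map_mul, map_pow]
      have hμβ : β ^ j ≤ β ^ μ := pow_le_pow_right_of_le_one' (hβw.trans hw.le) hμ
      refine hμβ.trans ?_
      rw [hval]
      have hβz : β = v z * (β / v z) := by rw [mul_div_cancel₀ _ hvz]
      have hβ1 : β / v z ≤ 1 := div_le_one_of_le₀ (hβw.trans hwz) zero_le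
      rw [hβz, mul_pow]
      refine mul_le_mul_right ?_ _
      have hwz1 : v (w / z) ≤ 1 := by
        rw [map_div₀]
        exact div_le_one_of_le₀ hwz zero_le
      by_cases hc : ∃ c : k, v (w / z - algebraMap k K c) < 1
      · obtain ⟨c, hc⟩ := hc
        have hJ' : wronsk D₀ D₁ z (w / z - algebraMap k K c) = wronsk D₀ D₁ z w / z := by
          rw [wronsk_sub_const, wronsk_div_left D₀ D₁ hz0]
        have h''0 : specZero (h'.comp (X + C (C c))) ≠ 0 := by
          have : specZero (h'.comp (X + C (C c))) = (specZero h').comp (X + C c) := by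
            simp [specZero, Polynomial.map_comp]
          rw [this]
          exact (comp_X_add_C_ne_zero_iff).mpr h'0
        have hdeg' : (specZero (h'.comp (X + C (C c)))).natDegree ≤ μ := by
          have : specZero (h'.comp (X + C (C c))) = (specZero h').comp (X + C c) := by
            simp [specZero, Polynomial.map_comp]
          rw [this, natDegree_comp, natDegree_X_add_C, mul_one]
          exact hdeg
        have e : aevalAeval z (w / z) h' =
            aevalAeval z (w / z - algebraMap k K c) (h'.comp (X + C (C c))) := by
          rw [aevalAeval_comp, map_add, aevalAeval_Y, aevalAeval_C, aeval_C, sub_add_cancel]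
        have := ih hz hc (by rw [hJ']; exact div_ne_zero hJ hz0) (h'.comp (X + C (C c)))
          (j := (specZero (h'.comp (X + C (C c)))).natDegree)
          (leadingCoeff_ne_zero.mpr h''0) (by rw [hJ', map_div₀]; exact grow z hz0 hz)
        rw [e]
        refine le_trans ?_ this
        have eβ : v (wronsk D₀ D₁ z (w / z - algebraMap k K c)) * exp 2 / v z = β / v z := by
          rw [hJ', map_div₀, hβ]
          congr 1
          rw [div_mul_eq_mul_div]
        rw [eβ]
        exact pow_le_pow_right_of_le_one' hβ1 hdeg'
      · have hc' : ∀ c : k, v (w / z - algebraMap k K c) = 1 := by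
          intro c
          refine le_antisymm (v.map_sub_le hwz1 ?_) (not_lt.mp fun h => hc ⟨c, h⟩)
          by_cases h : c = 0
          · simp [h]
          · exact (hv c h).le
        rw [val_aevalAeval_eq_one hv hz hc' h' h'0]
        exact pow_le_one' hβ1 _
    · rw [not_le] at hwz
      have hzw1 : v (z / w) < 1 := by
        rw [map_div₀]
        exact (div_lt_one₀ (zero_lt_iff.mpr hvw)).mpr hwz
      have := ih hzw1 hw (by rw [wronsk_div_right D₀ D₁ z hw0]; exact div_ne_zero hJ hw0)
        (mulLeftHom h) (j := j) (by rw [specZero_mulLeftHom]; exact hj)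
        (by rw [wronsk_div_right D₀ D₁ z hw0, map_div₀]; exact grow w hw0 hw)
      rw [aevalAeval_mulLeftHom, div_mul_cancel₀ _ hw0, wronsk_div_right D₀ D₁ z hw0, map_div₀,
        map_div₀] at this
      refine le_trans (le_of_eq ?_) this
      congr 1
      rw [hβ]
      field_simp

end KeyLemma

/-! ### The degree as a valuation -/

section DegVal

open MvPolynomial WithZero

variable {σ : Type*} {k : Type*} [Field k]

open Classical in
/-- The degree valuation `p ↦ exp (deg p)` on `k[x_i]`, which sends `0` to `0`. -/
noncomputable def degVal : Valuation (MvPolynomial σ k) ℤᵐ⁰ where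
  toFun p := if p = 0 then 0 else exp (p.totalDegree : ℤ)
  map_zero' := if_pos rfl
  map_one' := by simp
  map_mul' p q := by
    by_cases hp : p = 0
    · simp [hp]
    by_cases hq : q = 0
    · simp [hq]
    rw [if_neg hp, if_neg hq, if_neg (mul_ne_zero hp hq), totalDegree_mul_of_isDomain hp hq,
      Nat.cast_add, exp_add]
  map_add_le_max' p q := by
    by_cases hp : p = 0
    · simp [hp]
    by_cases hq : q = 0
    · simp [hq]
    by_cases hpq : p + q = 0
    · simp [hpq]
    rw [if_neg hp, if_neg hq, if_neg hpq, le_max_iff, exp_le_exp, exp_le_exp, Nat.cast_le,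
      Nat.cast_le, ← le_max_iff]
    exact totalDegree_add p q

theorem degVal_of_ne_zero {p : MvPolynomial σ k} (hp : p ≠ 0) :
    degVal p = exp (p.totalDegree : ℤ) := if_neg hp

theorem degVal_eq_zero_iff {p : MvPolynomial σ k} : degVal p = 0 ↔ p = 0 := by
  refine ⟨fun h => ?_, fun h => by rw [h, map_zero]⟩
  by_contra hp
  rw [degVal_of_ne_zero hp] at h
  exact exp_ne_zero h

theorem degVal_le (p : MvPolynomial σ k) : degVal p ≤ exp (p.totalDegree : ℤ) := by
  by_cases hp : p = 0
  · simp [hp]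
  · rw [degVal_of_ne_zero hp]

theorem degVal_C {c : k} (hc : c ≠ 0) : degVal (C c : MvPolynomial σ k) = 1 := by
  rw [degVal_of_ne_zero (by simpa using hc)]
  simp

theorem degVal_algebraMap {c : k} (hc : c ≠ 0) :
    degVal (algebraMap k (MvPolynomial σ k) c) = 1 := degVal_C hc

theorem degVal_X (i : σ) : degVal (X i : MvPolynomial σ k) = exp 1 := by
  rw [degVal_of_ne_zero (X_ne_zero i), totalDegree_X]
  simp

theorem degVal_pderiv_le (i : σ) (p : MvPolynomial σ k) :
    degVal (pderiv i p) ≤ degVal p * exp (-1) := by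
  by_cases h : pderiv i p = 0
  · simp [h]
  have hp : p ≠ 0 := by
    rintro rfl
    simp at h
  rw [degVal_of_ne_zero h, degVal_of_ne_zero hp, ← exp_add, exp_le_exp]
  have key : (pderiv i p).totalDegree + 1 ≤ p.totalDegree := by
    obtain ⟨m, hm, hdeg⟩ : ∃ m ∈ (pderiv i p).support, (pderiv i p).totalDegree = m.degree := by
      obtain ⟨m, hm, he⟩ := Finset.exists_mem_eq_sup (pderiv i p).support
        (support_nonempty.mpr h) (fun m => m.degree)
      refine ⟨m, hm, ?_⟩
      rw [← he]
      rfl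
    rw [mem_support_iff, coeff_pderiv] at hm
    have hm' : m + Finsupp.single i 1 ∈ p.support := by
      rw [mem_support_iff]
      intro h0
      apply hm
      rw [h0]
      simp
    have := le_totalDegree hm'
    rw [hdeg]
    refine le_trans (le_of_eq ?_) this
    have e : (m + Finsupp.single i 1).degree = m.degree + 1 := by
      rw [map_add, Finsupp.degree_single]
    exact e.symm
  omega

end DegVal

section FracDeriv

variable {k R K : Type*} [Field k] [CommRing R] [IsDomain R] [Algebra k R] [Field K] [Algebra R K]
  [IsFractionRing R K] [Algebra k K] [IsScalarTower k R K]

variable (K) in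
/-- A derivation of a domain as an algebra homomorphism into dual numbers over its fraction
field. -/
noncomputable def dualLift (D : Derivation k R R) : R →ₐ[k] TrivSqZeroExt K K where
  toFun r := TrivSqZeroExt.inl (algebraMap R K r) + TrivSqZeroExt.inr (algebraMap R K (D r))
  map_one' := by simp
  map_zero' := by simp
  map_mul' a b := by ext <;> simp [Algebra.smul_def (R := R) (A := K), mul_comm]
  map_add' a b := by ext <;> simp [Algebra.smul_def (R := R) (A := K)]
  commutes' c := by
    ext
    · simp [TrivSqZeroExt.algebraMap_eq_inl', ← IsScalarTower.algebraMap_apply]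
    · simp [TrivSqZeroExt.algebraMap_eq_inl']

theorem isUnit_dualLift (D : Derivation k R R) (y : nonZeroDivisors R) :
    IsUnit (dualLift K D y) := by
  rw [TrivSqZeroExt.isUnit_iff_isUnit_fst, isUnit_iff_ne_zero]
  simp [dualLift]

variable (K) in
/-- The extension to `K = Frac R` of the dual-number homomorphism of a derivation. -/
noncomputable def fracDualLift (D : Derivation k R R) : K →ₐ[k] TrivSqZeroExt K K :=
  IsLocalization.liftAlgHom (M := nonZeroDivisors R) (f := dualLift K D) (isUnit_dualLift D)

theorem fracDualLift_algebraMap (D : Derivation k R R) (r : R) :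
    fracDualLift K D (algebraMap R K r) = dualLift K D r := by
  simp [fracDualLift]

theorem fst_fracDualLift (D : Derivation k R R) (z : K) : (fracDualLift K D z).fst = z := by
  have : (TrivSqZeroExt.fstHom k K K).comp (fracDualLift K D) = AlgHom.id k K := by
    apply IsLocalization.algHom_ext (nonZeroDivisors R)
    ext r
    change (fracDualLift K D (algebraMap R K r)).fst = algebraMap R K r
    simp [fracDualLift_algebraMap, dualLift]
  exact congrArg (fun φ : K →ₐ[k] K => φ z) this

variable (K) in
/-- The extension of a derivation of a domain to its fraction field `K`. -/
noncomputable def fracDeriv (D : Derivation k R R) : Derivation k K K :=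
  Derivation.mk' ((TrivSqZeroExt.sndHom K K).restrictScalars k ∘ₗ (fracDualLift K D).toLinearMap)
    fun a b => by
      simp [fst_fracDualLift, mul_comm]

theorem fracDeriv_algebraMap (D : Derivation k R R) (r : R) :
    fracDeriv K D (algebraMap R K r) = algebraMap R K (D r) := by
  simp [fracDeriv, fracDualLift_algebraMap, dualLift, Algebra.smul_def (R := R) (A := K)]

end FracDeriv

section FracVal

open MvPolynomial WithZero

variable {k : Type*} [Field k] {σ : Type*}

variable (k σ) in
/-- The degree valuation on the field of rational functions. -/
noncomputable def fracDegVal : Valuation (FractionRing (MvPolynomial σ k)) ℤᵐ⁰ :=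
  (degVal (σ := σ) (k := k)).extendToLocalization (S := nonZeroDivisors (MvPolynomial σ k))
    (fun _ hp h => nonZeroDivisors.ne_zero hp (degVal_eq_zero_iff.mp h)) _

theorem fracDegVal_algebraMap (p : MvPolynomial σ k) :
    fracDegVal k σ (algebraMap (MvPolynomial σ k) _ p) = degVal p :=
  Valuation.extendToLocalization_apply_map_apply _ _ _ _

theorem fracDegVal_const {c : k} (hc : c ≠ 0) : fracDegVal k σ (algebraMap k (FractionRing
    (MvPolynomial σ k)) c) = 1 := by
  rw [IsScalarTower.algebraMap_apply k (MvPolynomial σ k), fracDegVal_algebraMap,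
    degVal_algebraMap hc]

theorem fracDegVal_fracDeriv_le (i : σ) (z : FractionRing (MvPolynomial σ k)) :
    fracDegVal k σ (fracDeriv (FractionRing (MvPolynomial σ k)) (pderiv (R := k) i) z) ≤
        fracDegVal k σ z * exp (-1) := by
  obtain ⟨a, b, hb, rfl⟩ := IsFractionRing.div_surjective (A := MvPolynomial σ k) z
  have hb0 : fracDegVal k σ (algebraMap (MvPolynomial σ k) _ b) ≠ 0 := by
    rw [fracDegVal_algebraMap, Ne, degVal_eq_zero_iff]
    exact nonZeroDivisors.ne_zero hb
  rw [Derivation.leibniz_div, fracDeriv_algebraMap, fracDeriv_algebraMap, smul_eq_mul, smul_eq_mul,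
    smul_eq_mul, ← map_mul, ← map_mul, ← map_sub, map_mul, map_pow, map_inv₀, map_div₀]
  have : fracDegVal k σ (algebraMap (MvPolynomial σ k) _ (b * pderiv i a - a * pderiv i b)) ≤
      fracDegVal k σ (algebraMap (MvPolynomial σ k) _ a) * fracDegVal k σ (algebraMap (MvPolynomial
          σ k) _ b) * exp (-1) := by
    rw [fracDegVal_algebraMap, fracDegVal_algebraMap, fracDegVal_algebraMap]
    refine Valuation.map_sub_le _ ?_ ?_
    · rw [map_mul, mul_comm (degVal a), mul_assoc]
      exact mul_le_mul_right (degVal_pderiv_le i a) _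
    · rw [map_mul, mul_assoc]
      exact mul_le_mul_right (degVal_pderiv_le i b) _
  refine (mul_le_mul_right this _).trans (le_of_eq ?_)
  field_simp

end FracVal

/-! ### Degrees of the components of an automorphism -/

section Toric

open Polynomial

variable {k : Type*} [Field k]

theorem exists_coeff_comp_ne_zero (n d : ℕ) (q : k[X]) (hq : q ≠ 0) (hd : q.natDegree ≤ d) {c : k}
    (hc : c ≠ 0) : ∃ j ≤ d, ((X ^ n * q).comp (X + C c)).coeff j ≠ 0 := by
  classical
  have hne : (X ^ n * q : k[X]) ≠ 0 := mul_ne_zero (pow_ne_zero _ X_ne_zero) hq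
  refine ⟨((X ^ n * q).comp (X + C c)).natTrailingDegree, ?_, ?_⟩
  · rw [← rootMultiplicity_eq_natTrailingDegree, rootMultiplicity_mul hne]
    have h1 : rootMultiplicity c (X ^ n : k[X]) = 0 := by
      apply rootMultiplicity_eq_zero
      simp [hc]
    rw [h1, zero_add, ← count_roots]
    exact ((Multiset.count_le_card _ _).trans q.card_roots').trans hd
  · exact trailingCoeff_nonzero_iff_nonzero.mpr (comp_X_add_C_ne_zero_iff.mpr hne)

/-- The unimodular monomial change of variables `X = Z⁻ᵃ T⁻ᵝ`, `Y = Z⁻ᵇ T⁻ᵅ` turns `h(X, Y)` into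
`Z⁻ᵂ T⁻ᴺ H(Z, T)`, where `W` is the weighted degree of `h` for the weights `(a, b)`. The
multiplicity of every nonzero root of `H(0, T)` is at most `W / ab`, the number of steps on the
line `a i + b j = W`. -/
theorem exists_toric_transform {a b α β : ℕ} (ha : 0 < a) (hb : 0 < b) (hαβ : α * a = β * b + 1)
    (h : MvPolynomial (Fin 2) k) (hh : h ≠ 0) :
    ∃ (W N : ℕ) (H : k[X][X]), (∀ m ∈ h.support, a * m 0 + b * m 1 ≤ W) ∧
      (∃ m ∈ h.support, a * m 0 + b * m 1 = W) ∧ specZero H ≠ 0 ∧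
      (∀ c : k, c ≠ 0 → ∃ j, a * b * j ≤ W ∧ ((specZero H).comp (X + C c)).coeff j ≠ 0) ∧
      ∀ {K : Type _} [Field K] [Algebra k K] (s t : K) (P : Fin 2 → K),
        P 0 * (s ^ a * t ^ β) = 1 → P 1 * (s ^ b * t ^ α) = 1 →
        aevalAeval s t H = s ^ W * t ^ N * MvPolynomial.aeval P h := by
  classical
  have hsupp : h.support.Nonempty := MvPolynomial.support_nonempty.mpr hh
  obtain ⟨mW, hmW, hWmax⟩ := Finset.exists_max_image h.support (fun m => a * m 0 + b * m 1) hsupp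
  obtain ⟨mN, hmN, hNmax⟩ := Finset.exists_max_image h.support (fun m => β * m 0 + α * m 1) hsupp
  set W := a * mW 0 + b * mW 1 with hW
  set N := β * mN 0 + α * mN 1 with hN
  set line := h.support.filter (fun m => a * m 0 + b * m 1 = W) with hline
  have hlne : line.Nonempty := ⟨mW, Finset.mem_filter.mpr ⟨hmW, rfl⟩⟩
  obtain ⟨m', hm', hmax⟩ := Finset.exists_max_image line (fun m => m 1) hlne
  have hm's : m' ∈ h.support := (Finset.mem_filter.mp hm').1
  have hm'W : a * m' 0 + b * m' 1 = W := (Finset.mem_filter.mp hm').2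
  set ε : (Fin 2 →₀ ℕ) → ℕ := fun m => N - (β * m 0 + α * m 1) with hε
  have hεeq : ∀ m ∈ line, a * ε m + β * W + m 1 = a * N := by
    intro m hm
    have h1 : β * m 0 + α * m 1 ≤ N := hNmax m (Finset.mem_filter.mp hm).1
    have h2 := (Finset.mem_filter.mp hm).2
    have h3 : ε m + (β * m 0 + α * m 1) = N := Nat.sub_add_cancel h1
    rw [← h3, ← h2]
    have : α * a * m 1 = (β * b + 1) * m 1 := by rw [hαβ]
    linarith
  have hεle : ∀ m ∈ line, ε m' ≤ ε m := by
    intro m hm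
    have h1 := hεeq m hm
    have h2 := hεeq m' hm'
    have h3 := hmax m hm
    refine Nat.le_of_mul_le_mul_left (?_ : a * ε m' ≤ a * ε m) ha
    omega
  have hεinj : ∀ m ∈ line, ε m = ε m' → m = m' := by
    intro m hm he
    have h1 := hεeq m hm
    have h2 := hεeq m' hm'
    have h3 : m 1 = m' 1 := by rw [he] at h1; omega
    have h4 := (Finset.mem_filter.mp hm).2
    have h5 : m 0 = m' 0 := by
      rw [h3, ← hm'W] at h4
      exact Nat.eq_of_mul_eq_mul_left ha (by omega)
    ext i
    fin_cases i
    · exact h5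
    · exact h3
  set H : k[X][X] := ∑ m ∈ h.support,
    C (C (h.coeff m) * X ^ (W - (a * m 0 + b * m 1))) * X ^ ε m with hH
  set q : k[X] := ∑ m ∈ line, C (h.coeff m) * X ^ (ε m - ε m') with hq
  have hspec : specZero H = X ^ ε m' * q := by
    rw [hH, map_sum, hq, Finset.mul_sum, hline, Finset.sum_filter]
    refine Finset.sum_congr rfl fun m hm => ?_
    split_ifs with hmW'
    · have := hεle m (Finset.mem_filter.mpr ⟨hm, hmW'⟩)
      rw [mul_left_comm, ← pow_add, Nat.add_sub_cancel' this, hmW', Nat.sub_self]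
      simp [specZero]
    · have : W - (a * m 0 + b * m 1) ≠ 0 := by
        have := hWmax m hm
        omega
      simp [specZero, this]
  have hq0 : q ≠ 0 := by
    intro h0
    have : q.coeff 0 = h.coeff m' := by
      rw [hq, finsetSum_coeff, Finset.sum_eq_single_of_mem m' hm']
      · simp
      · intro m hm hne
        rw [coeff_C_mul, coeff_X_pow, if_neg, mul_zero]
        intro h1
        exact hne (hεinj m hm (by have := hεle m hm; omega))
    rw [h0, coeff_zero] at this
    exact MvPolynomial.mem_support_iff.mp hm's this.symm
  have hqdeg : q.natDegree ≤ W / (a * b) := by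
    rw [hq]
    refine natDegree_sum_le_of_forall_le _ _ fun m hm => ?_
    refine (natDegree_C_mul_X_pow_le _ _).trans ?_
    rw [Nat.le_div_iff_mul_le (Nat.mul_pos ha hb)]
    have h1 := hεeq m hm
    have h2 := hεeq m' hm'
    have h3 := hεle m hm
    have h4 : a * (ε m - ε m') ≤ m' 1 := by
      rw [Nat.mul_sub]
      omega
    calc (ε m - ε m') * (a * b) = b * (a * (ε m - ε m')) := by ring
      _ ≤ b * m' 1 := Nat.mul_le_mul_left _ h4
      _ ≤ W := by omega
  refine ⟨W, N, H, hWmax, ⟨mW, hmW, rfl⟩, ?_, ?_, ?_⟩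
  · rw [hspec]
    exact mul_ne_zero (pow_ne_zero _ X_ne_zero) hq0
  · intro c hc
    obtain ⟨j, hj, hj'⟩ := exists_coeff_comp_ne_zero (ε m') _ q hq0 hqdeg hc
    refine ⟨j, ?_, by rw [hspec]; exact hj'⟩
    rw [mul_comm]
    exact (Nat.le_div_iff_mul_le (Nat.mul_pos ha hb)).mp hj
  · intro K _ _ s t P h0 h1
    rw [hH, map_sum, MvPolynomial.aeval_def, MvPolynomial.eval₂_eq', Finset.mul_sum]
    refine Finset.sum_congr rfl fun m hm => ?_
    rw [map_mul, map_pow, aevalAeval_Y, aevalAeval_C, map_mul, aeval_C, map_pow, aeval_X,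
      Fin.prod_univ_two]
    have e1 : s ^ W = s ^ (W - (a * m 0 + b * m 1)) * s ^ (a * m 0 + b * m 1) := by
      rw [← pow_add, Nat.sub_add_cancel (hWmax m hm)]
    have e2 : t ^ N = t ^ ε m * t ^ (β * m 0 + α * m 1) := by
      rw [← pow_add, Nat.sub_add_cancel (hNmax m hm)]
    have e3 : s ^ (a * m 0 + b * m 1) * t ^ (β * m 0 + α * m 1) * (P 0 ^ m 0 * P 1 ^ m 1) = 1 := by
      calc _ = (P 0 * (s ^ a * t ^ β)) ^ m 0 * (P 1 * (s ^ b * t ^ α)) ^ m 1 := by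
            rw [pow_add, pow_add, pow_mul, pow_mul, pow_mul, pow_mul]; ring
        _ = 1 := by rw [h0, h1, one_pow, one_pow, one_mul]
    rw [e1, e2]
    calc _ = algebraMap k K (h.coeff m) * s ^ (W - (a * m 0 + b * m 1)) * t ^ ε m * 1 := by ring
      _ = _ := by rw [← e3]; ring

end Toric

section LogDeriv

variable {k K : Type*} [Field k] [Field K] [Algebra k K]

theorem deriv_pow_div (D : Derivation k K K) {z : K} (hz : z ≠ 0) (n : ℕ) :
    D (z ^ n) / z ^ n = n * (D z / z) := by
  induction n with
  | zero => simp
  | succ n ih =>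
    rw [pow_succ, Derivation.leibniz, smul_eq_mul, smul_eq_mul]
    have : D (z ^ n) = n * (D z / z) * z ^ n := by
      rw [← ih, div_mul_cancel₀ _ (pow_ne_zero _ hz)]
    rw [this]
    field_simp
    push_cast
    ring

theorem deriv_div_div (D : Derivation k K K) {z w : K} (hz : z ≠ 0) (hw : w ≠ 0) :
    D (z / w) / (z / w) = D z / z - D w / w := by
  rw [Derivation.leibniz_div, smul_eq_mul, smul_eq_mul, smul_eq_mul]
  field_simp

/-- The Jacobian of a unimodular pair of monomials. -/
theorem wronsk_monomials (D₀ D₁ : Derivation k K K) {x y : K} (hx : x ≠ 0) (hy : y ≠ 0)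
    {a b α β : ℕ} (hαβ : α * a = β * b + 1) :
    wronsk D₀ D₁ (y ^ β / x ^ α) (x ^ b / y ^ a) =
      y ^ β / x ^ α * (x ^ b / y ^ a) / (x * y) * wronsk D₀ D₁ x y := by
  have hs : y ^ β / x ^ α ≠ 0 := div_ne_zero (pow_ne_zero _ hy) (pow_ne_zero _ hx)
  have ht : x ^ b / y ^ a ≠ 0 := div_ne_zero (pow_ne_zero _ hx) (pow_ne_zero _ hy)
  have hαβ' : (α : K) * a = β * b + 1 := by exact_mod_cast congrArg (Nat.cast : ℕ → K) hαβ
  have gen : ∀ z w : K, z ≠ 0 → w ≠ 0 →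
      wronsk D₀ D₁ z w = z * w * (D₀ z / z * (D₁ w / w) - D₁ z / z * (D₀ w / w)) := by
    intro z w hz hw
    rw [wronsk]
    field_simp
  rw [gen _ _ hs ht, gen _ _ hx hy, deriv_div_div D₀ (pow_ne_zero _ hy) (pow_ne_zero _ hx),
    deriv_div_div D₁ (pow_ne_zero _ hy) (pow_ne_zero _ hx),
    deriv_div_div D₀ (pow_ne_zero _ hx) (pow_ne_zero _ hy),
    deriv_div_div D₁ (pow_ne_zero _ hx) (pow_ne_zero _ hy),
    deriv_pow_div D₀ hx, deriv_pow_div D₀ hy, deriv_pow_div D₁ hx, deriv_pow_div D₁ hy,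
    deriv_pow_div D₀ hx, deriv_pow_div D₀ hy, deriv_pow_div D₁ hx, deriv_pow_div D₁ hy]
  have hxy : x * y ≠ 0 := mul_ne_zero hx hy
  generalize y ^ β / x ^ α * (x ^ b / y ^ a) = M
  rw [← mul_assoc, div_mul_cancel₀ _ hxy]
  congr 1
  linear_combination (D₀ x / x * (D₁ y / y) - D₁ x / x * (D₀ y / y)) * hαβ'

end LogDeriv

section VanDerKulk

open MvPolynomial WithZero

variable {k : Type*} [Field k]

theorem PolyEnd.jac_ne_zero (g : PolyAut 2 k) : (g : PolyEnd 2 k).jac ≠ 0 := by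
  intro h
  have := PolyEnd.jac_mul ((g⁻¹ : PolyAut 2 k) : PolyEnd 2 k) (g : PolyEnd 2 k)
  rw [Units.inv_mul, PolyEnd.jac_one, h, mul_zero] at this
  exact one_ne_zero this

theorem degVal_ge_one {σ : Type*} {p : MvPolynomial σ k} (hp : p ≠ 0) : 1 ≤ degVal p := by
  rw [degVal_of_ne_zero hp, ← exp_zero, exp_le_exp]
  positivity

theorem degVal_jac (g : PolyAut 2 k) : degVal (g : PolyEnd 2 k).jac = 1 := by
  have h := PolyEnd.jac_mul ((g⁻¹ : PolyAut 2 k) : PolyEnd 2 k) (g : PolyEnd 2 k)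
  rw [Units.inv_mul, PolyEnd.jac_one] at h
  have h' := congrArg degVal h
  rw [map_one, map_mul] at h'
  refine le_antisymm ?_ (degVal_ge_one (PolyEnd.jac_ne_zero g))
  rw [h']
  refine le_mul_of_one_le_left zero_le (degVal_ge_one ?_)
  intro h0
  rw [h0, zero_mul] at h
  exact one_ne_zero h

theorem inv_act_coord {n : ℕ} {R : Type*} [CommRing R] (g : PolyAut n R) (i : Fin n) :
    aeval (g : PolyEnd n R).coord (((g⁻¹ : PolyAut n R) : PolyEnd n R).coord i) = X i := by
  rw [← PolyEnd.mul_coord_aeval, Units.inv_mul, PolyEnd.one_coord]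

theorem totalDegree_coord_pos (g : PolyAut 2 k) (i : Fin 2) :
    0 < ((g : PolyEnd 2 k).coord i).totalDegree := by
  rw [Nat.pos_iff_ne_zero]
  intro h
  apply PolyEnd.jac_ne_zero g
  rw [totalDegree_eq_zero_iff_eq_C] at h
  rw [PolyEnd.jac_two]
  fin_cases i
  · simp only [Fin.zero_eta] at h
    rw [h]
    simp
  · simp only [Fin.mk_one] at h
    rw [h]
    simp

theorem coord_ne_zero (g : PolyAut 2 k) (i : Fin 2) : (g : PolyEnd 2 k).coord i ≠ 0 := by
  intro h
  have := totalDegree_coord_pos g i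
  rw [h, totalDegree_zero] at this
  exact lt_irrefl _ this

theorem exists_bezout_nat {a b : ℕ} (ha : 0 < a) (hb : 0 < b) (hab : Nat.Coprime a b) :
    ∃ α β : ℕ, α * a = β * b + 1 := by
  rcases Nat.lt_or_ge 1 b with h | h
  · obtain ⟨m, hm⟩ := Nat.exists_mul_mod_eq_one_of_coprime hab h
    refine ⟨m, a * m / b, ?_⟩
    rw [mul_comm m a, mul_comm (a * m / b) b, ← hm.2]
    exact (Nat.div_add_mod _ _).symm
  · obtain rfl : b = 1 := by omega
    exact ⟨1, a - 1, by omega⟩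

theorem toric_inversion {K : Type*} [Field K] {x y : K} (hx : x ≠ 0) (hy : y ≠ 0) {a b α β : ℕ}
    (hαβ : α * a = β * b + 1) :
    x * ((y ^ β / x ^ α) ^ a * (x ^ b / y ^ a) ^ β) = 1 ∧
      y * ((y ^ β / x ^ α) ^ b * (x ^ b / y ^ a) ^ α) = 1 := by
  constructor
  · have hα : x ^ (α * a) = x ^ (β * b) * x := by rw [hαβ, pow_succ]
    rw [div_pow, div_pow, ← pow_mul, ← pow_mul, ← pow_mul, ← pow_mul, hα, mul_comm b β,
      mul_comm a β]
    field_simp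
  · have hβ : y ^ (α * a) = y ^ (β * b) * y := by rw [hαβ, pow_succ]
    rw [div_pow, div_pow, ← pow_mul, ← pow_mul, ← pow_mul, ← pow_mul, mul_comm a α, hβ,
      mul_comm b α]
    field_simp

/-- If the leading forms of the components `x, y` of an automorphism satisfy no relation
`xᵇ ~ c yᵃ`, then the degree of `h(x, y)` is the weighted degree of `h`; in general it is bounded
from below. -/
theorem degVal_aeval_coord [IsAlgClosed k] (g : PolyAut 2 k) {a b e : ℕ} (ha : 0 < a) (hb : 0 < b)
    (he : 0 < e) (hab : Nat.Coprime a b)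
    (h0 : ((g : PolyEnd 2 k).coord 0).totalDegree = a * e)
    (h1 : ((g : PolyEnd 2 k).coord 1).totalDegree = b * e) (h : MvPolynomial (Fin 2) k)
    (hh : h ≠ 0) :
    ∃ W : ℕ, (∀ m ∈ h.support, a * m 0 + b * m 1 ≤ W) ∧
      ((∀ c : k, c ≠ 0 → ¬ degVal ((g : PolyEnd 2 k).coord 0 ^ b
          - C c * (g : PolyEnd 2 k).coord 1 ^ a) < exp ((a * b * e : ℕ) : ℤ)) →
        degVal (aeval (g : PolyEnd 2 k).coord h) = exp ((e * W : ℕ) : ℤ)) ∧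
      ((∃ c : k, c ≠ 0 ∧ degVal ((g : PolyEnd 2 k).coord 0 ^ b
          - C c * (g : PolyEnd 2 k).coord 1 ^ a) < exp ((a * b * e : ℕ) : ℤ)) →
        ∃ j : ℕ, a * b * j ≤ W ∧ exp ((e * W : ℕ) + j * (2 - e * (a + b)) : ℤ) ≤
          degVal (aeval (g : PolyEnd 2 k).coord h)) := by
  obtain ⟨α, β, hαβ⟩ := exists_bezout_nat ha hb hab
  obtain ⟨W, N, H, hW, -, hH0, hHc, hHev⟩ := exists_toric_transform ha hb hαβ h hh
  refine ⟨W, hW, ?_⟩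
  set x : MvPolynomial (Fin 2) k := (g : PolyEnd 2 k).coord 0 with hx
  set y : MvPolynomial (Fin 2) k := (g : PolyEnd 2 k).coord 1 with hy
  have hx0 : x ≠ 0 := coord_ne_zero g 0
  have hy0 : y ≠ 0 := coord_ne_zero g 1
  let v : Valuation (FractionRing (MvPolynomial (Fin 2) k)) ℤᵐ⁰ := fracDegVal k (Fin 2)
  set xx : FractionRing (MvPolynomial (Fin 2) k) :=
      algebraMap (MvPolynomial (Fin 2) k) (FractionRing (MvPolynomial (Fin 2) k)) x with hxx
  set yy : FractionRing (MvPolynomial (Fin 2) k) :=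
      algebraMap (MvPolynomial (Fin 2) k) (FractionRing (MvPolynomial (Fin 2) k)) y with hyy
  have hinj : Function.Injective (algebraMap (MvPolynomial (Fin 2) k) (FractionRing (MvPolynomial
      (Fin 2) k))) := IsFractionRing.injective _ _
  have hxx0 : xx ≠ 0 := (map_ne_zero_iff _ hinj).mpr hx0
  have hyy0 : yy ≠ 0 := (map_ne_zero_iff _ hinj).mpr hy0
  have hvx : v xx = exp ((a * e : ℕ) : ℤ) := by
    rw [hxx, fracDegVal_algebraMap, degVal_of_ne_zero hx0, h0]
  have hvy : v yy = exp ((b * e : ℕ) : ℤ) := by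
    rw [hyy, fracDegVal_algebraMap, degVal_of_ne_zero hy0, h1]
  have hv : ∀ c : k, c ≠ 0 → v (algebraMap k (FractionRing (MvPolynomial (Fin 2) k)) c) = 1 :=
      fun c hc => fracDegVal_const hc
  set s : FractionRing (MvPolynomial (Fin 2) k) := yy ^ β / xx ^ α with hs
  set t : FractionRing (MvPolynomial (Fin 2) k) := xx ^ b / yy ^ a with ht
  have hs0 : s ≠ 0 := div_ne_zero (pow_ne_zero _ hyy0) (pow_ne_zero _ hxx0)
  have ht0 : t ≠ 0 := div_ne_zero (pow_ne_zero _ hxx0) (pow_ne_zero _ hyy0)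
  have hvs : v s = exp (-(e : ℤ)) := by
    rw [hs, map_div₀, map_pow, map_pow, hvx, hvy, ← exp_nsmul, ← exp_nsmul, ← exp_sub]
    congr 1
    have : (α : ℤ) * a = β * b + 1 := by exact_mod_cast hαβ
    simp only [nsmul_eq_mul, Nat.cast_mul]
    linear_combination -(e : ℤ) * this
  have hvt : v t = 1 := by
    rw [ht, map_div₀, map_pow, map_pow, hvx, hvy, ← exp_nsmul, ← exp_nsmul, ← exp_sub,
      exp_eq_one]
    simp only [nsmul_eq_mul, Nat.cast_mul]
    ring
  have hs1 : v s < 1 := by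
    rw [hvs, ← exp_zero, exp_lt_exp]
    omega
  have hev := hHev s t ![xx, yy] (toric_inversion hxx0 hyy0 hαβ).1 (toric_inversion hxx0 hyy0 hαβ).2
  have hpt : (aeval ![xx, yy] h : FractionRing (MvPolynomial (Fin 2) k)) =
      algebraMap (MvPolynomial (Fin 2) k) (FractionRing (MvPolynomial (Fin 2) k)) (aeval (g :
          PolyEnd 2 k).coord h) := by
    have e : (![xx, yy] : Fin 2 → FractionRing (MvPolynomial (Fin 2) k)) =
        fun i => (IsScalarTower.toAlgHom k (MvPolynomial (Fin 2) k) (FractionRing (MvPolynomial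
            (Fin 2) k))) ((g : PolyEnd 2 k).coord i) := by
      funext i
      fin_cases i <;> rfl
    rw [e]
    exact (MvPolynomial.comp_aeval_apply (g : PolyEnd 2 k).coord
      (IsScalarTower.toAlgHom k (MvPolynomial (Fin 2) k) (FractionRing (MvPolynomial (Fin 2) k)))
          h).symm
  have hval : v (Polynomial.aevalAeval s t H) * exp ((e * W : ℕ) : ℤ) =
      degVal (aeval (g : PolyEnd 2 k).coord h) := by
    rw [hev, hpt, map_mul, map_mul, map_pow, map_pow, hvt, one_pow, mul_one, hvs, ← exp_nsmul,
      fracDegVal_algebraMap, mul_comm, ← mul_assoc, ← exp_add]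
    convert one_mul _
    rw [exp_eq_one]
    simp
    ring
  have htc : ∀ c : k, v (t - algebraMap k (FractionRing (MvPolynomial (Fin 2) k)) c) < 1 ↔
      degVal (x ^ b - C c * y ^ a) < exp ((a * b * e : ℕ) : ℤ) := by
    intro c
    have e1 : t - algebraMap k (FractionRing (MvPolynomial (Fin 2) k)) c =
        algebraMap (MvPolynomial (Fin 2) k) (FractionRing (MvPolynomial (Fin 2) k)) (x ^ b - C c *
            y ^ a) / yy ^ a := by
      rw [ht, map_sub, map_mul, map_pow, map_pow, sub_div, ← hxx, ← hyy,
        mul_div_cancel_right₀ _ (pow_ne_zero _ hyy0)]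
      rfl
    have e2 : v (yy ^ a) = exp ((a * b * e : ℕ) : ℤ) := by
      rw [map_pow, hvy, ← exp_nsmul]
      congr 1
      simp only [nsmul_eq_mul, Nat.cast_mul]
      ring
    rw [e1, map_div₀, e2, div_lt_one₀ (zero_lt_iff.mpr exp_ne_zero), fracDegVal_algebraMap]
  constructor
  · intro hc
    rw [← hval, val_aevalAeval_eq_one hv hs1 _ H hH0, one_mul]
    intro c
    by_cases hc0 : c = 0
    · rw [hc0, map_zero, sub_zero, hvt]
    · refine le_antisymm (v.map_sub_le hvt.le (hv c hc0).le) (not_lt.mp fun hlt => ?_)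
      exact hc c hc0 ((htc c).mp hlt)
  · rintro ⟨c, hc0, hc⟩
    obtain ⟨j, hj, hj'⟩ := hHc c hc0
    refine ⟨j, hj, ?_⟩
    set D₀ : Derivation k (FractionRing (MvPolynomial (Fin 2) k)) (FractionRing (MvPolynomial (Fin
        2) k)) :=
      fracDeriv (FractionRing (MvPolynomial (Fin 2) k)) (pderiv (R := k) (σ := Fin 2) 0) with hD₀
    set D₁ : Derivation k (FractionRing (MvPolynomial (Fin 2) k)) (FractionRing (MvPolynomial (Fin
        2) k)) :=
      fracDeriv (FractionRing (MvPolynomial (Fin 2) k)) (pderiv (R := k) (σ := Fin 2) 1) with hD₁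
    have hJxy : v (wronsk D₀ D₁ xx yy) = 1 := by
      have : wronsk D₀ D₁ xx yy = algebraMap (MvPolynomial (Fin 2) k) (FractionRing (MvPolynomial
          (Fin 2) k)) (g : PolyEnd 2 k).jac := by
        rw [wronsk, PolyEnd.jac_two, hxx, hyy, hD₀, hD₁, fracDeriv_algebraMap, fracDeriv_algebraMap,
          fracDeriv_algebraMap, fracDeriv_algebraMap, map_sub, map_mul, map_mul]
      rw [this, fracDegVal_algebraMap, degVal_jac]
    have hJ : v (wronsk D₀ D₁ s (t - algebraMap k (FractionRing (MvPolynomial (Fin 2) k)) c)) =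
        v s * exp (-(e * (a + b) : ℤ)) := by
      rw [wronsk_sub_const, hs, ht, wronsk_monomials D₀ D₁ hxx0 hyy0 hαβ, ← hs, ← ht, map_mul,
        hJxy, mul_one, map_div₀, map_mul, hvt, mul_one, map_mul, hvx, hvy, ← exp_add,
        div_eq_mul_inv, ← exp_neg]
      congr 2
      push_cast
      ring
    have hJ0 : wronsk D₀ D₁ s (t - algebraMap k (FractionRing (MvPolynomial (Fin 2) k)) c) ≠ 0 := by
      rw [← v.ne_zero_iff, hJ]
      exact mul_ne_zero (v.ne_zero_iff.mpr hs0) exp_ne_zero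
    have e : Polynomial.aevalAeval s t H = Polynomial.aevalAeval s (t - algebraMap k (FractionRing
        (MvPolynomial (Fin 2) k)) c)
        (H.comp (Polynomial.X + Polynomial.C (Polynomial.C c))) := by
      rw [aevalAeval_comp, map_add, Polynomial.aevalAeval_Y, Polynomial.aevalAeval_C,
        Polynomial.aeval_C, sub_add_cancel]
    have key := le_val_aevalAeval D₀ D₁ hv (fracDegVal_fracDeriv_le (0 : Fin 2))
        (fracDegVal_fracDeriv_le (1 : Fin 2))
      hs1 ((htc c).mpr hc) hJ0 (H.comp (Polynomial.X + Polynomial.C (Polynomial.C c))) (j := j)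
      (by
        have : specZero (H.comp (Polynomial.X + Polynomial.C (Polynomial.C c))) =
            (specZero H).comp (Polynomial.X + Polynomial.C c) := by
          simp [specZero, Polynomial.map_comp]
        rw [this]
        exact hj')
    rw [← e] at key
    rw [← hval, add_comm, exp_add]
    refine mul_le_mul_left (le_trans (le_of_eq ?_) key) _
    change _ = (v (wronsk D₀ D₁ s (t - algebraMap k (FractionRing (MvPolynomial (Fin 2) k)) c)) *
        exp 2 / v s) ^ j
    rw [hJ, mul_assoc, mul_div_cancel_left₀ _ (v.ne_zero_iff.mpr hs0), ← exp_add, ← exp_nsmul]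
    congr 1
    simp only [nsmul_eq_mul]
    ring

end VanDerKulk

section VanDerKulk

open MvPolynomial WithZero

variable {k : Type*} [Field k]

/-- A polynomial with no monomial involving `xᵢ` is killed by `∂/∂xᵢ`. -/
theorem pderiv_eq_zero_of_support {h : MvPolynomial (Fin 2) k} (i : Fin 2)
    (hs : ∀ m ∈ h.support, m i = 0) : pderiv i h = 0 := by
  refine pderiv_eq_zero_of_notMem_vars fun hi => ?_
  rw [mem_vars_iff_mem_support] at hi
  obtain ⟨m, hm, hmi⟩ := hi
  exact Finsupp.mem_support_iff.mp hmi (hs m hm)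

theorem totalDegree_le_sub_of_degVal_lt {p : MvPolynomial (Fin 2) k} {d : ℕ} (hd : 0 < d)
    (h : degVal p < exp (d : ℤ)) : p.totalDegree < d := by
  by_cases hp : p = 0
  · simpa [hp] using hd
  · rw [degVal_of_ne_zero hp, exp_lt_exp] at h
    exact_mod_cast h

/-- The reduction step behind the structure of `Aut(𝔸²)`: the leading form of one component of a
non-affine automorphism is a multiple of a power of the leading form of the other one. -/
theorem exists_degree_reduction [IsAlgClosed k] (g : PolyAut 2 k)
    (hg : 1 < ((g : PolyEnd 2 k).coord 0).totalDegree ∨ 1 <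
        ((g : PolyEnd 2 k).coord 1).totalDegree) :
    ∃ (c : k) (s : ℕ), c ≠ 0 ∧ 0 < s ∧
      ((((g : PolyEnd 2 k).coord 0).totalDegree = s * ((g : PolyEnd 2 k).coord 1).totalDegree ∧
        ((g : PolyEnd 2 k).coord 0 - C c * (g : PolyEnd 2 k).coord 1 ^ s).totalDegree <
          ((g : PolyEnd 2 k).coord 0).totalDegree) ∨
      (((g : PolyEnd 2 k).coord 1).totalDegree = s * ((g : PolyEnd 2 k).coord 0).totalDegree ∧
        ((g : PolyEnd 2 k).coord 1 - C c * (g : PolyEnd 2 k).coord 0 ^ s).totalDegree <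
          ((g : PolyEnd 2 k).coord 1).totalDegree)) := by
  have p0 := totalDegree_coord_pos g 0
  have p1 := totalDegree_coord_pos g 1
  set x := (g : PolyEnd 2 k).coord 0 with hx
  set y := (g : PolyEnd 2 k).coord 1 with hy
  obtain ⟨e, a, b, he, hab, h0, h1⟩ := Nat.exists_coprime' (m := x.totalDegree) (n := y.totalDegree)
    (Nat.gcd_pos_of_pos_left _ p0)
  have ha : 0 < a := Nat.pos_of_ne_zero fun h => by simp [h] at h0; omega
  have hb : 0 < b := Nat.pos_of_ne_zero fun h => by simp [h] at h1; omega
  have hne : ∀ i, ((g⁻¹ : PolyAut 2 k) : PolyEnd 2 k).coord i ≠ 0 := coord_ne_zero g⁻¹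
  have main := fun i => degVal_aeval_coord g ha hb he hab h0 h1 _ (hne i)
  simp only [inv_act_coord, degVal_X] at main
  by_cases hc : ∃ c : k, c ≠ 0 ∧ degVal (x ^ b - C c * y ^ a) < exp ((a * b * e : ℕ) : ℤ)
  · obtain ⟨c, hc0, hc⟩ := hc
    by_cases ha1 : a = 1
    · subst ha1
      refine ⟨c⁻¹, b, inv_ne_zero hc0, hb, Or.inr ⟨by rw [h0, h1]; ring, ?_⟩⟩
      refine totalDegree_le_sub_of_degVal_lt p1 ?_
      have : x ^ b - C c * y ^ 1 = C (-c) * (y - C c⁻¹ * x ^ b) := by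
        have hcc : (C c * C c⁻¹ : MvPolynomial (Fin 2) k) = 1 := by
          rw [← C_mul, mul_inv_cancel₀ hc0, C_1]
        rw [C_neg]
        linear_combination -(x ^ b) * hcc
      rw [this, map_mul, degVal_C (neg_ne_zero.mpr hc0), one_mul] at hc
      rw [h1]
      simpa using hc
    by_cases hb1 : b = 1
    · subst hb1
      refine ⟨c, a, hc0, ha, Or.inl ⟨by rw [h0, h1]; ring, ?_⟩⟩
      refine totalDegree_le_sub_of_degVal_lt p0 ?_
      rw [h0]
      simpa using hc
    exfalso
    have habs : a + b ≤ a * b := by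
      nlinarith [Nat.lt_of_le_of_ne ha (Ne.symm ha1), Nat.lt_of_le_of_ne hb (Ne.symm hb1)]
    obtain ⟨W, hW, -, h2⟩ := main 0
    obtain ⟨j, hj, hle⟩ := h2 ⟨c, hc0, hc⟩
    rw [exp_le_exp] at hle
    rcases Nat.eq_zero_or_pos j with rfl | hjpos
    · have hW1 : W ≤ 1 := by
        have : (e * W : ℤ) ≤ 1 := by simpa using hle
        have : e * W ≤ 1 := by exact_mod_cast this
        nlinarith
      have hpos := totalDegree_coord_pos g⁻¹ 0
      have : (((g⁻¹ : PolyAut 2 k) : PolyEnd 2 k).coord 0).totalDegree ≤ 0 := by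
        refine Finset.sup_le fun m hm => ?_
        have := hW m hm
        have a2 : 2 ≤ a := by omega
        have b2 : 2 ≤ b := by omega
        have m0 : m 0 = 0 := by nlinarith
        have m1 : m 1 = 0 := by nlinarith
        have : m = 0 := by ext i; fin_cases i <;> assumption
        simp [this]
      omega
    · have hj' : (a * b * j : ℤ) ≤ W := by exact_mod_cast hj
      have he' : (1 : ℤ) ≤ e := by exact_mod_cast he
      have hjp : (1 : ℤ) ≤ j := by exact_mod_cast hjpos
      have habs' : (a + b : ℤ) ≤ a * b := by exact_mod_cast habs
      push_cast at hle
      have t1 : (e : ℤ) * (a * b * j) ≤ e * W := mul_le_mul_of_nonneg_left hj' (by omega)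
      have t2 : (0 : ℤ) ≤ (e * j) * (a * b - (a + b)) := mul_nonneg (by positivity) (by omega)
      nlinarith
  · exfalso
    push Not at hc
    have key : ∀ i : Fin 2, ∀ m ∈ (((g⁻¹ : PolyAut 2 k) : PolyEnd 2 k).coord i).support,
        e = 1 ∧ a * m 0 + b * m 1 ≤ 1 := by
      intro i m hm
      obtain ⟨W, hW, h1, -⟩ := main i
      have := h1 fun c hc0 => not_lt.mpr (hc c hc0)
      rw [exp_inj] at this
      have h2 : e * W = 1 := by exact_mod_cast this.symm
      have h3 := Nat.eq_one_of_mul_eq_one_right h2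
      have h4 := Nat.eq_one_of_mul_eq_one_left h2
      exact ⟨by assumption, by have := hW m hm; omega⟩
    obtain ⟨m, hm⟩ := (support_nonempty.mpr (hne 0))
    have he1 := (key 0 m hm).1
    have hjac := PolyEnd.jac_ne_zero g⁻¹
    rw [PolyEnd.jac_two] at hjac
    rw [he1, mul_one] at h0 h1
    rw [h0, h1] at hg
    rcases hg with hg | hg
    · have (i : Fin 2) : pderiv 0 (((g⁻¹ : PolyAut 2 k) : PolyEnd 2 k).coord i) = 0 :=
        pderiv_eq_zero_of_support 0 fun m hm => by have := (key i m hm).2; nlinarith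
      simp [this] at hjac
    · have (i : Fin 2) : pderiv 1 (((g⁻¹ : PolyAut 2 k) : PolyEnd 2 k).coord i) = 0 :=
        pderiv_eq_zero_of_support 1 fun m hm => by have := (key i m hm).2; nlinarith
      simp [this] at hjac

end VanDerKulk

/-! ### Leading forms of the components of an automorphism -/

section LeadingForms

open MvPolynomial WithZero

variable {k : Type*} [Field k]

theorem eq_affine_of_totalDegree_le_one {R : Type*} [CommRing R] {c : MvPolynomial (Fin 2) R}
    (h : c.totalDegree ≤ 1) :
    c = C (coeff (Finsupp.single 0 1) c) * X 0 + C (coeff (Finsupp.single 1 1) c) * X 1 +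
      C (coeff 0 c) := by
  classical
  ext m
  simp only [coeff_add, coeff_C_mul, coeff_X, coeff_C]
  by_cases hm : m 0 + m 1 ≤ 1
  · have h3 : m = 0 ∨ m = Finsupp.single 0 1 ∨ m = Finsupp.single 1 1 := by
      have : (m 0 = 0 ∧ m 1 = 0) ∨ (m 0 = 1 ∧ m 1 = 0) ∨ (m 0 = 0 ∧ m 1 = 1) := by omega
      rcases this with h | h | h
      · left; ext i; fin_cases i <;> simp [h]
      · right; left; ext i; fin_cases i <;> simp [h]
      · right; right; ext i; fin_cases i <;> simp [h]
    have e1 : (Finsupp.single (0 : Fin 2) 1 : Fin 2 →₀ ℕ) ≠ Finsupp.single 1 1 := fun e => by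
      simpa using DFunLike.congr_fun e 0
    rcases h3 with rfl | rfl | rfl
    · simp
    · simp [e1.symm, (Finsupp.single_ne_zero.mpr one_ne_zero).symm]
    · simp [e1, (Finsupp.single_ne_zero.mpr one_ne_zero).symm]
  · have h0 : coeff m c = 0 := by
      refine coeff_eq_zero_of_totalDegree_lt (lt_of_le_of_lt h ?_)
      have : m.degree = m 0 + m 1 := by simp [Finsupp.degree_eq_sum]
      rw [← Finsupp.degree_apply, this]
      omega
    have a0 : ¬ Finsupp.single 0 1 = m := fun e => by subst e; simp at hm
    have a1 : ¬ Finsupp.single 1 1 = m := fun e => by subst e; simp at hm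
    have a2 : ¬ 0 = m := fun e => by subst e; simp at hm
    simp [h0, a0, a1, a2]

/-- The elementary automorphism `(x, y - p(x))`. -/
noncomputable def lowerTri {R : Type*} [CommRing R] (p : Polynomial R) : SAut 2 R :=
  rot R * tri 1 p 0 * (rot R)⁻¹

section

variable {R L : Type*} [CommRing R] [CommRing L] [Algebra R L] (p : Polynomial R) (Q : Fin 2 → L)

theorem act_lowerTri_zero : ((lowerTri p : PolyAut 2 R) : PolyEnd 2 R).act Q 0 = Q 0 := by
  simp only [lowerTri, Subgroup.coe_mul, Units.val_mul, PolyEnd.act_mul]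
  simp only [act_rot_zero, act_tri_one, act_rot_inv_one]
  simp

theorem act_lowerTri_one : ((lowerTri p : PolyAut 2 R) : PolyEnd 2 R).act Q 1 =
    Q 1 - Polynomial.aeval (Q 0) p := by
  simp only [lowerTri, Subgroup.coe_mul, Units.val_mul, PolyEnd.act_mul]
  simp only [act_rot_one, act_tri_zero, act_rot_inv_one, act_rot_inv_zero]
  simp [add_comm, sub_eq_add_neg]

end

theorem mul_coord_act {n : ℕ} {R : Type*} [CommRing R] (f g : PolyAut n R) (i : Fin n) :
    ((f * g : PolyAut n R) : PolyEnd n R).coord i =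
      (f : PolyEnd n R).act (g : PolyEnd n R).coord i := rfl

theorem upper_mul_coord (g : PolyAut 2 k) (c : k) (s : ℕ) :
    (((tri 1 (-(Polynomial.C c * Polynomial.X ^ s)) 0 : SAut 2 k) * g : PolyAut 2 k) :
      PolyEnd 2 k).coord 0 = (g : PolyEnd 2 k).coord 0 - C c * (g : PolyEnd 2 k).coord 1 ^ s ∧
    (((tri 1 (-(Polynomial.C c * Polynomial.X ^ s)) 0 : SAut 2 k) * g : PolyAut 2 k) :
      PolyEnd 2 k).coord 1 = (g : PolyEnd 2 k).coord 1 := by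
  rw [mul_coord_act, mul_coord_act, act_tri_zero, act_tri_one]
  constructor
  · simp [algebraMap_eq, sub_eq_add_neg]
  · simp

theorem lower_mul_coord (g : PolyAut 2 k) (c : k) (s : ℕ) :
    (((lowerTri (Polynomial.C c * Polynomial.X ^ s) : SAut 2 k) * g : PolyAut 2 k) :
      PolyEnd 2 k).coord 0 = (g : PolyEnd 2 k).coord 0 ∧
    (((lowerTri (Polynomial.C c * Polynomial.X ^ s) : SAut 2 k) * g : PolyAut 2 k) :
      PolyEnd 2 k).coord 1 = (g : PolyEnd 2 k).coord 1 - C c * (g : PolyEnd 2 k).coord 0 ^ s := by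
  rw [mul_coord_act, mul_coord_act, act_lowerTri_zero, act_lowerTri_one]
  simp [algebraMap_eq]

/-- Induction along the degree reduction. -/
theorem PolyAut.degree_induction [IsAlgClosed k] {P : PolyAut 2 k → Prop}
    (affine : ∀ g : PolyAut 2 k, ((g : PolyEnd 2 k).coord 0).totalDegree = 1 →
      ((g : PolyEnd 2 k).coord 1).totalDegree = 1 → P g)
    (upper : ∀ (g : PolyAut 2 k) (c : k) (s : ℕ), c ≠ 0 → 0 < s →
      ((g : PolyEnd 2 k).coord 0).totalDegree = s * ((g : PolyEnd 2 k).coord 1).totalDegree →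
      ((g : PolyEnd 2 k).coord 0 - C c * (g : PolyEnd 2 k).coord 1 ^ s).totalDegree <
          ((g : PolyEnd 2 k).coord 0).totalDegree →
      P ((tri 1 (-(Polynomial.C c * Polynomial.X ^ s)) 0 : SAut 2 k) * g) → P g)
    (lower : ∀ (g : PolyAut 2 k) (c : k) (s : ℕ), c ≠ 0 → 0 < s →
      ((g : PolyEnd 2 k).coord 1).totalDegree = s * ((g : PolyEnd 2 k).coord 0).totalDegree →
      ((g : PolyEnd 2 k).coord 1 - C c * (g : PolyEnd 2 k).coord 0 ^ s).totalDegree <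
          ((g : PolyEnd 2 k).coord 1).totalDegree →
      P ((lowerTri (Polynomial.C c * Polynomial.X ^ s) : SAut 2 k) * g) → P g)
    (g : PolyAut 2 k) : P g := by
  induction hN : ((g : PolyEnd 2 k).coord 0).totalDegree + ((g : PolyEnd 2 k).coord 1).totalDegree
    using Nat.strong_induction_on generalizing g with
  | _ N ih =>
    subst hN
    have p0 := totalDegree_coord_pos g 0
    have p1 := totalDegree_coord_pos g 1
    by_cases hg : 1 < ((g : PolyEnd 2 k).coord 0).totalDegree ∨
        1 < ((g : PolyEnd 2 k).coord 1).totalDegree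
    · obtain ⟨c, s, hc, hs, h | h⟩ := exists_degree_reduction g hg
      · refine upper g c s hc hs h.1 h.2 (ih _ ?_ _ rfl)
        rw [(upper_mul_coord g c s).1, (upper_mul_coord g c s).2]
        exact Nat.add_lt_add_right h.2 _
      · refine lower g c s hc hs h.1 h.2 (ih _ ?_ _ rfl)
        rw [(lower_mul_coord g c s).1, (lower_mul_coord g c s).2]
        exact Nat.add_lt_add_left h.2 _
    · exact affine g (by omega) (by omega)

theorem Valuation.map_pow_sub_pow_lt {A Γ : Type*} [CommRing A] [LinearOrderedCommGroupWithZero Γ]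
    (v : Valuation A Γ) {a b : A} {M : Γ} (ha : v a ≤ M) (hb : v b ≤ M)
    (hab : v (a - b) < M) {n : ℕ} (hn : 0 < n) : v (a ^ n - b ^ n) < M ^ n := by
  have hM : 0 < M := lt_of_le_of_lt zero_le hab
  rw [← (Commute.all a b).geom_sum₂_mul, map_mul]
  have h1 : v (∑ i ∈ Finset.range n, a ^ i * b ^ (n - 1 - i)) ≤ M ^ (n - 1) := by
    refine v.map_sum_le fun i hi => ?_
    rw [map_mul, map_pow, map_pow]
    calc v a ^ i * v b ^ (n - 1 - i) ≤ M ^ i * M ^ (n - 1 - i) := by gcongr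
      _ = M ^ (n - 1) := by
        rw [← pow_add]; congr 1; have := Finset.mem_range.mp hi; omega
  calc _ ≤ M ^ (n - 1) * v (a - b) := by gcongr
    _ < M ^ (n - 1) * M := by gcongr; exact pow_pos hM _
    _ = M ^ n := by rw [← pow_succ]; congr 1; omega

theorem degVal_lt_of_totalDegree_lt {p : MvPolynomial (Fin 2) k} {d : ℕ}
    (h : p.totalDegree < d) : degVal p < exp (d : ℤ) :=
  lt_of_le_of_lt (degVal_le p) (by rw [exp_lt_exp]; exact_mod_cast h)

/-- `c` has the leading form `r (l₀x + l₁y)ᵈ`, where `d = deg c`. -/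
def HasLinearLeadingForm (c : MvPolynomial (Fin 2) k) (r l₀ l₁ : k) : Prop :=
  (c - C r * (C l₀ * X 0 + C l₁ * X 1) ^ c.totalDegree).totalDegree < c.totalDegree

theorem exists_leadingForm_of_sub_pow {x y : MvPolynomial (Fin 2) k} {c : k} (hc : c ≠ 0) {s : ℕ}
    (hs : 0 < s) (hd : x.totalDegree = s * y.totalDegree) (hy : 0 < y.totalDegree)
    (hlt : (x - C c * y ^ s).totalDegree < x.totalDegree)
    (ih : ∃ r l₀ l₁ : k, r ≠ 0 ∧ (l₀ ≠ 0 ∨ l₁ ≠ 0) ∧ HasLinearLeadingForm y r l₀ l₁) :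
    ∃ r l₀ l₁ : k, r ≠ 0 ∧ (l₀ ≠ 0 ∨ l₁ ≠ 0) ∧ HasLinearLeadingForm x r l₀ l₁ := by
  obtain ⟨r, l₀, l₁, hr, hl, h⟩ := ih
  refine ⟨c * r ^ s, l₀, l₁, mul_ne_zero hc (pow_ne_zero _ hr), hl, ?_⟩
  unfold HasLinearLeadingForm at h ⊢
  have hx : 0 < x.totalDegree := hd ▸ Nat.mul_pos hs hy
  set m : MvPolynomial (Fin 2) k := C r * (C l₀ * X 0 + C l₁ * X 1) ^ y.totalDegree with hm
  refine totalDegree_le_sub_of_degVal_lt hx ?_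
  have e : x - C (c * r ^ s) * (C l₀ * X 0 + C l₁ * X 1) ^ x.totalDegree =
      (x - C c * y ^ s) + C c * (y ^ s - m ^ s) := by
    rw [hm, mul_pow, ← pow_mul, hd, mul_comm s, C_mul, C_pow]
    ring
  have hyv := degVal_le y
  have h1 := degVal_lt_of_totalDegree_lt h
  have hmv : degVal m ≤ exp (y.totalDegree : ℤ) := by
    have : m = y - (y - m) := by ring
    rw [this]
    exact Valuation.map_sub_le _ hyv h1.le
  have h2 := Valuation.map_pow_sub_pow_lt degVal hyv hmv h1 hs
  rw [e]
  refine Valuation.map_add_lt _ (degVal_lt_of_totalDegree_lt hlt) ?_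
  rw [map_mul, degVal_C hc, one_mul]
  convert h2 using 1
  rw [← exp_nsmul, hd]
  simp

theorem exists_leadingForm_of_totalDegree_eq_one {c : MvPolynomial (Fin 2) k}
    (h : c.totalDegree = 1) :
    ∃ r l₀ l₁ : k, r ≠ 0 ∧ (l₀ ≠ 0 ∨ l₁ ≠ 0) ∧ HasLinearLeadingForm c r l₀ l₁ := by
  have e := eq_affine_of_totalDegree_le_one h.le
  refine ⟨1, coeff (Finsupp.single 0 1) c, coeff (Finsupp.single 1 1) c, one_ne_zero, ?_, ?_⟩
  · by_contra hcon
    push Not at hcon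
    rw [hcon.1, hcon.2] at e
    rw [e] at h
    simp at h
  · unfold HasLinearLeadingForm
    rw [h]
    have : c - C 1 * (C (coeff (Finsupp.single 0 1) c) * X 0 +
        C (coeff (Finsupp.single 1 1) c) * X 1) ^ 1 = C (coeff 0 c) := by
      rw [C_1]
      linear_combination e
    rw [this, totalDegree_C]
    exact one_pos

/-- The leading form of a component of a plane automorphism is a power of a linear form. -/
theorem exists_linear_leadingForm [IsAlgClosed k] (g : PolyAut 2 k) (i : Fin 2) :
    ∃ r l₀ l₁ : k, r ≠ 0 ∧ (l₀ ≠ 0 ∨ l₁ ≠ 0) ∧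
      HasLinearLeadingForm ((g : PolyEnd 2 k).coord i) r l₀ l₁ := by
  induction g using PolyAut.degree_induction generalizing i with
  | affine g h0 h1 =>
    fin_cases i
    · exact exists_leadingForm_of_totalDegree_eq_one h0
    · exact exists_leadingForm_of_totalDegree_eq_one h1
  | upper g c s hc hs hd hlt ih =>
    have ih1 := ih 1
    rw [(upper_mul_coord g c s).2] at ih1
    fin_cases i
    · exact exists_leadingForm_of_sub_pow hc hs hd (totalDegree_coord_pos g 1) hlt ih1
    · exact ih1
  | lower g c s hc hs hd hlt ih =>
    have ih0 := ih 0
    rw [(lower_mul_coord g c s).1] at ih0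
    fin_cases i
    · exact ih0
    · exact exists_leadingForm_of_sub_pow hc hs hd (totalDegree_coord_pos g 0) hlt ih0

section

variable {L Γ : Type*} [CommRing L] [Algebra k L] [LinearOrderedCommGroupWithZero Γ]
  {v : Valuation L Γ}

theorem Valuation.map_aeval_le (hv : ∀ c : k, v (algebraMap k L c) ≤ 1) {Q : Fin 2 → L} {M : Γ}
    (hM : 1 ≤ M) (hQ : ∀ i, v (Q i) ≤ M) (p : MvPolynomial (Fin 2) k) :
    v (aeval Q p) ≤ M ^ p.totalDegree := by
  rw [aeval_def, eval₂_eq']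
  refine v.map_sum_le fun m hm => ?_
  rw [map_mul, map_prod]
  have h1 : ∏ i, v (Q i ^ m i) ≤ M ^ p.totalDegree := by
    calc ∏ i, v (Q i ^ m i) ≤ ∏ i, M ^ m i := by
          refine Finset.prod_le_prod (fun _ _ => zero_le) fun i _ => ?_
          rw [map_pow]
          exact pow_le_pow_left₀ zero_le (hQ i) _
      _ = M ^ (∑ i, m i) := Finset.prod_pow_eq_pow_sum _ _ _
      _ ≤ M ^ p.totalDegree := by
        refine pow_le_pow_right₀ hM ?_
        rw [← Finsupp.degree_eq_sum]
        exact le_totalDegree hm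
  exact (mul_le_mul' (hv _) h1).trans (one_mul _).le

/-- A component of an automorphism grows as fast as its degree allows at a point where the linear
form underlying its leading form is large. -/
theorem HasLinearLeadingForm.map_aeval_eq (hv : ∀ c : k, c ≠ 0 → v (algebraMap k L c) = 1)
    {c : MvPolynomial (Fin 2) k} {r l₀ l₁ : k} (hr : r ≠ 0) (h : HasLinearLeadingForm c r l₀ l₁)
    {Q : Fin 2 → L} {M : Γ} (hM : 1 < M) (hQ : ∀ i, v (Q i) ≤ M)
    (hl : v (algebraMap k L l₀ * Q 0 + algebraMap k L l₁ * Q 1) = M) :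
    v (aeval Q c) = M ^ c.totalDegree := by
  have hv' : ∀ c : k, v (algebraMap k L c) ≤ 1 := fun c => by
    by_cases hc : c = 0
    · simp [hc]
    · exact (hv c hc).le
  have e : aeval Q c = aeval Q (C r * (C l₀ * X 0 + C l₁ * X 1) ^ c.totalDegree) +
      aeval Q (c - C r * (C l₀ * X 0 + C l₁ * X 1) ^ c.totalDegree) := by
    rw [← map_add]; congr 1; ring
  have h1 : v (aeval Q (C r * (C l₀ * X 0 + C l₁ * X 1) ^ c.totalDegree)) = M ^ c.totalDegree := by
    simp [hv r hr, hl]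
  rw [e, ← h1]
  refine Valuation.map_add_eq_of_lt_left _ ?_
  rw [h1]
  exact lt_of_le_of_lt (Valuation.map_aeval_le hv' hM.le hQ _) (pow_lt_pow_right₀ hM h)

end

end LeadingForms

/-! ### Conjugacy normal forms -/

section NormalForm

open MvPolynomial

theorem SAut.ext_act {n : ℕ} {R : Type*} [CommRing R] {f g : SAut n R}
    (h : ∀ i, ((f : PolyAut n R) : PolyEnd n R).act (fun j => (X j : MvPolynomial (Fin n) R)) i =
      ((g : PolyAut n R) : PolyEnd n R).act (fun j => (X j : MvPolynomial (Fin n) R)) i) :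
    f = g := by
  refine SAut.ext_end (PolyEnd.ext (funext fun i => ?_))
  have := h i
  rwa [PolyEnd.act_apply, PolyEnd.act_apply, aeval_X_left_apply, aeval_X_left_apply] at this

theorem SAut.ext_act_two {R : Type*} [CommRing R] {f g : SAut 2 R}
    (h0 : ((f : PolyAut 2 R) : PolyEnd 2 R).act (fun j => (X j : MvPolynomial (Fin 2) R)) 0 =
      ((g : PolyAut 2 R) : PolyEnd 2 R).act (fun j => (X j : MvPolynomial (Fin 2) R)) 0)
    (h1 : ((f : PolyAut 2 R) : PolyEnd 2 R).act (fun j => (X j : MvPolynomial (Fin 2) R)) 1 =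
      ((g : PolyAut 2 R) : PolyEnd 2 R).act (fun j => (X j : MvPolynomial (Fin 2) R)) 1) :
    f = g := by
  refine SAut.ext_act fun i => ?_
  fin_cases i
  · exact h0
  · exact h1

theorem SAut.act_mul {n : ℕ} {R : Type*} [CommRing R] {L : Type*} [CommRing L] [Algebra R L]
    (f g : SAut n R) (Q : Fin n → L) : ((f * g : SAut n R) : PolyAut n R).val.act Q =
      (f : PolyAut n R).val.act ((g : PolyAut n R).val.act Q) :=
  PolyEnd.act_mul _ _ Q

variable {k : Type*} [Field k]

theorem rot_mul_rot : rot k * rot k = tri (-1) 0 0 := by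
  refine SAut.ext_act_two ?_ ?_
  · simp only [SAut.act_mul, act_rot_zero, act_rot_one, act_tri_zero]
    simp
  · simp only [SAut.act_mul, act_rot_zero, act_rot_one, act_tri_one]
    simp

theorem rot_inv : (rot k)⁻¹ = rot k * tri (-1) 0 0 := by
  rw [← rot_mul_rot, inv_eq_iff_mul_eq_one, ← mul_assoc, ← mul_assoc, rot_mul_rot,
    mul_assoc, rot_mul_rot, tri_mul]
  refine SAut.ext_act_two ?_ ?_
  · simp only [act_tri_zero]
    simp [PolyEnd.act_one]
  · simp only [act_tri_one]
    simp [PolyEnd.act_one]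

/-- The triangular automorphisms `(αx + p(y), α⁻¹y + c)`. -/
def IsTri (b : SAut 2 k) : Prop := ∃ α p c, b = tri α p c

theorem isTri_tri (α : kˣ) (p : Polynomial k) (c : k) : IsTri (tri α p c) := ⟨α, p, c, rfl⟩

theorem IsTri.mul {b b' : SAut 2 k} (h : IsTri b) (h' : IsTri b') : IsTri (b * b') := by
  obtain ⟨α, p, c, rfl⟩ := h
  obtain ⟨β, q, d, rfl⟩ := h'
  rw [tri_mul]
  exact isTri_tri _ _ _

theorem isTri_one : IsTri (1 : SAut 2 k) := ⟨1, 0, 0, tri_one.symm⟩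

/-- The product `(s b₁) ⋯ (s bₙ)`, where `s = (y, -x)`. -/
noncomputable def rotProd (l : List (SAut 2 k)) : SAut 2 k := (l.map fun b => rot k * b).prod

theorem rotProd_cons (b : SAut 2 k) (l : List (SAut 2 k)) :
    rotProd (b :: l) = rot k * b * rotProd l := by
  simp [rotProd]

theorem rotProd_append (l l' : List (SAut 2 k)) : rotProd (l ++ l') = rotProd l * rotProd l' := by
  simp [rotProd]

theorem rotProd_nil : rotProd ([] : List (SAut 2 k)) = 1 := rfl

/-- `f` is a word `b₀ s b₁ ⋯ s bₙ` with triangular `bᵢ`. -/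
def IsTriWord (n : ℕ) (f : SAut 2 k) : Prop :=
  ∃ (b : SAut 2 k) (l : List (SAut 2 k)), IsTri b ∧ (∀ x ∈ l, IsTri x) ∧ l.length = n ∧
    f = b * rotProd l

theorem IsTriWord.tri_mul {n : ℕ} {f b : SAut 2 k} (hf : IsTriWord n f) (hb : IsTri b) :
    IsTriWord n (b * f) := by
  obtain ⟨b', l, hb', hl, hn, rfl⟩ := hf
  exact ⟨b * b', l, hb.mul hb', hl, hn, (mul_assoc _ _ _).symm⟩

theorem IsTriWord.rot_mul {n : ℕ} {f : SAut 2 k} (hf : IsTriWord n f) :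
    IsTriWord (n + 1) (rot k * f) := by
  obtain ⟨b, l, hb, hl, hn, rfl⟩ := hf
  refine ⟨1, b :: l, isTri_one, ?_, by simp [hn], ?_⟩
  · intro x hx
    rcases List.mem_cons.mp hx with rfl | hx
    · exact hb
    · exact hl x hx
  · rw [rotProd_cons, one_mul, mul_assoc]

/-- An affine map whose second component does not involve `x` is triangular. -/
theorem isTri_of_affine {f : SAut 2 k} {a b c d e : k}
    (h0 : ((f : PolyAut 2 k) : PolyEnd 2 k).coord 0 = C a * X 0 + C b * X 1 + C c)
    (h1 : ((f : PolyAut 2 k) : PolyEnd 2 k).coord 1 = C d * X 1 + C e) : IsTri f := by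
  have hjac : ((f : PolyAut 2 k) : PolyEnd 2 k).jac = 1 := f.2
  rw [PolyEnd.jac_two, h0, h1] at hjac
  simp [pderiv_X] at hjac
  rw [← C_mul, ← C_1] at hjac
  have had := C_injective _ _ hjac
  refine ⟨⟨a, d, had, by rw [mul_comm, had]⟩, Polynomial.C b * Polynomial.X + Polynomial.C c, e, ?_⟩
  refine SAut.ext_act_two ?_ ?_
  · rw [act_tri_zero, PolyEnd.act_apply, h0]
    simp [algebraMap_eq, add_assoc]
  · rw [act_tri_one, PolyEnd.act_apply, h1]
    simp [algebraMap_eq]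

/-- `SAut(𝔸²)` is generated by triangular automorphisms and `s`. -/
theorem exists_isTriWord [IsAlgClosed k] (f : SAut 2 k) : ∃ n, IsTriWord n f := by
  suffices ∀ g : PolyAut 2 k, ∀ f : SAut 2 k, (f : PolyAut 2 k) = g → ∃ n, IsTriWord n f from
    this f f rfl
  have cancel : ∀ (b f : SAut 2 k), IsTri b⁻¹ → (∃ n, IsTriWord n (b * f)) → ∃ n,
      IsTriWord n f := by
    rintro b f hb ⟨n, hn⟩
    refine ⟨n, ?_⟩
    simpa using hn.tri_mul hb
  have cancelRot : ∀ f : SAut 2 k, (∃ n, IsTriWord n (rot k * f)) → ∃ n, IsTriWord n f := by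
    rintro f ⟨n, hn⟩
    refine ⟨n + 1, ?_⟩
    have := (hn.tri_mul (isTri_tri (-1) 0 0)).rot_mul
    rwa [← mul_assoc, ← rot_inv, inv_mul_cancel_left] at this
  have hinv : ∀ α p c, IsTri (tri α p c : SAut 2 k)⁻¹ := fun α p c => by
    rw [tri_inv]
    exact isTri_tri _ _ _
  intro g
  induction g using PolyAut.degree_induction with
  | affine g h0 h1 =>
    rintro f rfl
    have e0 := eq_affine_of_totalDegree_le_one h0.le
    have e1 := eq_affine_of_totalDegree_le_one h1.le
    set a := coeff (Finsupp.single 0 1) (((f : PolyAut 2 k) : PolyEnd 2 k).coord 0)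
    set b := coeff (Finsupp.single 1 1) (((f : PolyAut 2 k) : PolyEnd 2 k).coord 0)
    set c := coeff 0 (((f : PolyAut 2 k) : PolyEnd 2 k).coord 0)
    set d := coeff (Finsupp.single 0 1) (((f : PolyAut 2 k) : PolyEnd 2 k).coord 1)
    set e := coeff (Finsupp.single 1 1) (((f : PolyAut 2 k) : PolyEnd 2 k).coord 1)
    set e' := coeff 0 (((f : PolyAut 2 k) : PolyEnd 2 k).coord 1)
    by_cases hd : d = 0
    · rw [hd, C_0, zero_mul, zero_add] at e1
      exact ⟨0, f, [], isTri_of_affine e0 e1, by simp, rfl, by simp [rotProd_nil]⟩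
    · refine cancel (tri 1 (Polynomial.C (-(a / d)) * Polynomial.X) 0) f (hinv _ _ _)
        (cancelRot _ ⟨0, _, [], isTri_of_affine (a := d) (b := e) (c := e') (d := a / d * e - b)
          (e := a / d * e' - c) ?_ ?_, by simp, rfl, by rw [rotProd_nil, mul_one]⟩)
      · have : (((rot k * (tri 1 (Polynomial.C (-(a / d)) * Polynomial.X) 0 * f) : SAut 2 k) :
            PolyAut 2 k) : PolyEnd 2 k).coord 0 = ((f : PolyAut 2 k) : PolyEnd 2 k).coord 1 := by
          change (PolyEnd.act _ (PolyEnd.act _ _)) 0 = _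
          rw [act_rot_zero, act_tri_one]
          simp
        rw [this, e1]
      · have : (((rot k * (tri 1 (Polynomial.C (-(a / d)) * Polynomial.X) 0 * f) : SAut 2 k) :
            PolyAut 2 k) : PolyEnd 2 k).coord 1 =
            C (a / d) * ((f : PolyAut 2 k) : PolyEnd 2 k).coord 1 -
              ((f : PolyAut 2 k) : PolyEnd 2 k).coord 0 := by
          change (PolyEnd.act _ (PolyEnd.act _ _)) 1 = _
          rw [act_rot_one, act_tri_zero]
          simp [algebraMap_eq, sub_eq_add_neg]
        rw [this, e0, e1]
        have had : (C (a / d) * C d : MvPolynomial (Fin 2) k) = C a := by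
          rw [← C_mul, div_mul_cancel₀ _ hd]
        simp only [C_sub, C_mul]
        linear_combination X 0 * had
  | upper g c s hc hs hd hlt ih =>
    rintro f rfl
    exact cancel _ f (hinv _ _ _) (ih (_ * f) rfl)
  | lower g c s hc hs hd hlt ih =>
    rintro f rfl
    obtain ⟨n, hn⟩ := ih (_ * f) rfl
    refine cancel (tri (-1) 0 0) _ (hinv _ _ _) (cancelRot _ ?_)
    refine cancel (tri 1 (Polynomial.C c * Polynomial.X ^ s) 0) _ (hinv _ _ _) (cancelRot _ ⟨n, ?_⟩)
    convert hn using 1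
    simp only [lowerTri, rot_inv, mul_assoc]

/-- The conjugate `s b s` of an affine triangular map is triangular or a product `b' s b''`. -/
theorem rot_mul_affine_mul_rot (α : kˣ) (β γ c : k) :
    IsTri (rot k * tri α (Polynomial.C β * Polynomial.X + Polynomial.C γ) c * rot k) ∨
    ∃ b' b'', IsTri b' ∧ IsTri b'' ∧
      rot k * tri α (Polynomial.C β * Polynomial.X + Polynomial.C γ) c * rot k =
        b' * rot k * b'' := by
  have hα : (C (α : k) * C ((α⁻¹ : kˣ) : k) : MvPolynomial (Fin 2) k) = 1 := by
    rw [← C_mul, Units.mul_inv, C_1]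
  by_cases hβ : β = 0
  · left
    refine ⟨-α⁻¹, Polynomial.C c, -γ, SAut.ext_act_two ?_ ?_⟩
    · simp only [SAut.act_mul, act_rot_zero, act_rot_one, act_tri_zero, act_tri_one]
      simp [algebraMap_eq]
    · simp only [SAut.act_mul, act_rot_zero, act_rot_one, act_tri_zero, act_tri_one]
      simp [hβ, algebraMap_eq]
      ring
  · right
    lift β to kˣ using Ne.isUnit hβ
    have hβ' : (C (β : k) * C ((β⁻¹ : kˣ) : k) : MvPolynomial (Fin 2) k) = 1 := by
      rw [← C_mul, Units.mul_inv, C_1]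
    refine ⟨tri 1 (Polynomial.C (-((α⁻¹ * β⁻¹ : kˣ) : k)) * Polynomial.X +
        Polynomial.C (c - ((α⁻¹ * β⁻¹ : kˣ) : k) * γ)) 0,
      tri (-β) (Polynomial.C (α : k) * Polynomial.X + Polynomial.C γ) 0, isTri_tri _ _ _,
      isTri_tri _ _ _, SAut.ext_act_two ?_ ?_⟩
    · simp only [SAut.act_mul, act_rot_zero, act_rot_one, act_tri_zero, act_tri_one]
      simp only [Units.val_neg, inv_neg, map_neg, algebraMap_eq, map_add, map_mul, map_sub,
        Polynomial.aeval_C, Polynomial.aeval_X, map_zero, Units.val_one, map_one, Units.val_mul]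
      linear_combination (C ((α⁻¹ : kˣ) : k) * X 0 : MvPolynomial (Fin 2) k) * hβ' - (C ((β⁻¹ : kˣ)
          : k) * X 1 : MvPolynomial (Fin 2) k) * hα
    · simp only [SAut.act_mul, act_rot_zero, act_rot_one, act_tri_zero, act_tri_one]
      simp only [Units.val_neg, map_neg, algebraMap_eq, map_add, map_mul, inv_one,
        Polynomial.aeval_C, Polynomial.aeval_X, map_zero, Units.val_one, map_one]
      ring

/-- `s b` is linearly conjugate to a triangular map if `b` is affine. -/
theorem exists_isConj_rot_mul_affine [IsAlgClosed k] (α : kˣ) (β γ c : k) :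
    ∃ b, IsTri b ∧
      IsConj (rot k * tri α (Polynomial.C β * Polynomial.X + Polynomial.C γ) c) b := by
  obtain ⟨μ, hμ⟩ : ∃ μ : k, μ * μ + β * μ + 1 = 0 := by
    obtain ⟨μ, hμ⟩ := IsAlgClosed.exists_root
      (Polynomial.X ^ 2 + Polynomial.C β * Polynomial.X + Polynomial.C 1 : Polynomial k) (by
        have : (Polynomial.C 1 * Polynomial.X ^ 2 + Polynomial.C β * Polynomial.X + Polynomial.C 1 :
          Polynomial k).degree = 2 := Polynomial.degree_quadratic one_ne_zero
        rw [Polynomial.C_1, one_mul] at this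
        rw [Polynomial.C_1, this]
        decide)
    refine ⟨μ, ?_⟩
    simpa [Polynomial.IsRoot, sq] using hμ
  have hμ0 : μ ≠ 0 := by rintro rfl; simp at hμ
  lift μ to kˣ using Ne.isUnit hμ0
  refine ⟨tri μ⁻¹ (Polynomial.C ((α⁻¹ : kˣ) : k) * Polynomial.X + Polynomial.C c)
    (-γ - α * ((μ⁻¹ : kˣ) : k) * c), isTri_tri _ _ _, isConj_iff.mpr
    ⟨lowerTri (Polynomial.C (α * ((μ⁻¹ : kˣ) : k)) * Polynomial.X), ?_⟩⟩
  rw [mul_inv_eq_iff_eq_mul]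
  have hα : (C (α : k) * C ((α⁻¹ : kˣ) : k) : MvPolynomial (Fin 2) k) = 1 := by
    rw [← C_mul, Units.mul_inv, C_1]
  have hμ1 : (C (μ : k) * C ((μ⁻¹ : kˣ) : k) : MvPolynomial (Fin 2) k) = 1 := by
    rw [← C_mul, Units.mul_inv, C_1]
  have hμ2 : (C (μ : k) * C (μ : k) + C β * C (μ : k) + 1 : MvPolynomial (Fin 2) k) = 0 := by
    rw [← C_mul, ← C_mul, ← C_add, ← C_1, ← C_add, hμ, C_0]
  refine SAut.ext_act_two ?_ ?_
  · simp only [SAut.act_mul, act_rot_zero, act_tri_zero, act_tri_one,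
      act_lowerTri_zero, act_lowerTri_one]
    simp only [algebraMap_eq, map_add, map_mul,
        Polynomial.aeval_C, Polynomial.aeval_X]
    linear_combination (C ((μ⁻¹ : kˣ) : k) * X 0 : MvPolynomial (Fin 2) k) * hα
  · simp only [SAut.act_mul, act_rot_zero, act_rot_one, act_tri_zero, act_tri_one,
      act_lowerTri_one]
    simp only [map_neg, algebraMap_eq, map_add, map_mul, map_sub, inv_inv,
        Polynomial.aeval_C, Polynomial.aeval_X]
    linear_combination (C (α : k) * X 0 + (C (μ : k) + C β) * X 1 : MvPolynomial (Fin 2) k) * hμ1 -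
      (C ((μ⁻¹ : kˣ) : k) * X 1 : MvPolynomial (Fin 2) k) * hμ2 -
      (C ((μ⁻¹ : kˣ) : k) * X 1 : MvPolynomial (Fin 2) k) * hα

/-- A triangular automorphism that is not affine. -/
def IsNonaffineTri (b : SAut 2 k) : Prop := ∃ α p c, 2 ≤ p.natDegree ∧ b = tri α p c

theorem isConj_mul_comm {G : Type*} [Group G] (a b : G) : IsConj (a * b) (b * a) :=
  isConj_iff.mpr ⟨a⁻¹, by group⟩

/-- Normal form: an element of `SAut(𝔸²)` is conjugate to a triangular map or to a composition of
generalized Hénon maps. -/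
theorem exists_normal_form [IsAlgClosed k] (f : SAut 2 k) :
    (∃ b, IsTri b ∧ IsConj f b) ∨
      ∃ l : List (SAut 2 k), l ≠ [] ∧ (∀ b ∈ l, IsNonaffineTri b) ∧ IsConj f (rotProd l) := by
  classical
  have hex : ∃ n, ∃ f', IsConj f f' ∧ IsTriWord n f' := by
    obtain ⟨n, hn⟩ := exists_isTriWord f
    exact ⟨n, f, IsConj.refl f, hn⟩
  obtain ⟨f', hff', b, l, hb, hl, hn, rfl⟩ := Nat.find_spec hex
  have hmin : ∀ m < Nat.find hex, ∀ f', IsConj f f' → ¬ IsTriWord m f' := fun m hm f' h1 h2 =>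
    Nat.find_min hex hm ⟨f', h1, h2⟩
  rw [← hn] at hmin
  clear hn
  rcases List.eq_nil_or_concat' l with rfl | ⟨l', c, rfl⟩
  · left
    exact ⟨b, hb, by simpa [rotProd_nil] using hff'⟩
  have hc : IsTri c := hl c (by simp)
  have hconj : IsConj f (rotProd (c * b :: l')) := by
    refine hff'.trans ?_
    rw [rotProd_append, rotProd_cons, rotProd_cons, rotProd_nil, mul_one]
    have := isConj_mul_comm (b * rotProd l') (rot k * c)
    rw [mul_assoc, mul_assoc] at this
    simpa [mul_assoc] using this
  set l := c * b :: l' with hldef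
  have hlen : l.length = (l' ++ [c]).length := by simp [hldef]
  have hl' : ∀ x ∈ l, IsTri x := by
    intro x hx
    rcases List.mem_cons.mp hx with rfl | hx
    · exact hc.mul hb
    · exact hl x (by simp [hx])
  rw [← hlen] at hmin
  by_cases haff : ∀ b ∈ l, IsNonaffineTri b
  · exact Or.inr ⟨l, by simp [hldef], haff, hconj⟩
  left
  push Not at haff
  obtain ⟨x, hx, hxaff⟩ := haff
  obtain ⟨α, p, d, rfl⟩ := hl' x hx
  have hp : p.natDegree ≤ 1 := by
    by_contra h
    exact hxaff ⟨α, p, d, by omega, rfl⟩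
  obtain ⟨β, γ, rfl⟩ := Polynomial.exists_eq_X_add_C_of_natDegree_le_one hp
  set x := tri α (Polynomial.C β * Polynomial.X + Polynomial.C γ) d with hxdef
  obtain ⟨l₁, l₂, hsplit⟩ := List.append_of_mem hx
  have hconj' : IsConj f (rotProd (x :: (l₂ ++ l₁))) := by
    refine hconj.trans ?_
    rw [hsplit, rotProd_append, ← List.cons_append, rotProd_append]
    exact isConj_mul_comm _ _
  have hlen' : l.length = (l₂ ++ l₁).length + 1 := by
    rw [hsplit]; simp; omega
  have hm : ∀ y ∈ l₂ ++ l₁, IsTri y := by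
    intro y hy
    refine hl' y ?_
    rw [hsplit]
    simp at hy ⊢
    tauto
  generalize l₂ ++ l₁ = m at *
  rcases m with _ | ⟨y, m⟩
  · rw [rotProd_cons, rotProd_nil, mul_one] at hconj'
    obtain ⟨b', hb', hc'⟩ := exists_isConj_rot_mul_affine α β γ d
    exact ⟨b', hb', hconj'.trans hc'⟩
  · exfalso
    have e : rotProd (x :: y :: m) = (rot k * x * rot k) * y * rotProd m := by
      rw [rotProd_cons, rotProd_cons]
      simp only [mul_assoc]
    have hy : IsTri y := hm y (by simp)
    have hm' : ∀ z ∈ m, IsTri z := fun z hz => hm z (by simp [hz])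
    simp only [List.length_cons] at hlen'
    rw [e] at hconj'
    rcases rot_mul_affine_mul_rot α β γ d with h | ⟨b', b'', hb', hb'', h⟩
    · exact hmin m.length (by omega) _ hconj' ⟨_, m, h.mul hy, hm', rfl, rfl⟩
    · rw [← hxdef] at h
      rw [h] at hconj'
      refine hmin (m.length + 1) (by omega) _ hconj' ⟨b', b'' * y :: m, hb', ?_, by simp, ?_⟩
      · intro z hz
        rcases List.mem_cons.mp hz with rfl | hz
        · exact hb''.mul hy
        · exact hm' z hz
      · rw [rotProd_cons]
        simp only [mul_assoc]

end NormalForm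

/-! ### Expansion by Hénon maps and degrees of iterates -/

section Expansion

open MvPolynomial WithZero

variable {k : Type*} [Field k] {L Γ : Type*} [CommRing L] [Algebra k L]
  [LinearOrderedCommGroupWithZero Γ] {v : Valuation L Γ}

theorem Valuation.map_polynomial_aeval (hv : ∀ c : k, c ≠ 0 → v (algebraMap k L c) = 1) {y : L}
    (hy : 1 < v y) {p : Polynomial k} (hp : p ≠ 0) :
    v (Polynomial.aeval y p) = v y ^ p.natDegree := by
  have hy0 : 0 < v y := zero_lt_one.trans hy
  rw [Polynomial.aeval_eq_sum_range, Finset.sum_range_succ]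
  have hlead : v (p.coeff p.natDegree • y ^ p.natDegree) = v y ^ p.natDegree := by
    rw [Algebra.smul_def, map_mul, map_pow, hv _ (by simpa using hp), one_mul]
  rw [← hlead]
  refine Valuation.map_add_eq_of_lt_right _ ?_
  rw [hlead]
  refine v.map_sum_lt (pow_ne_zero _ hy0.ne') fun i hi => ?_
  rw [Algebra.smul_def, map_mul, map_pow]
  have h1 : v (algebraMap k L (p.coeff i)) ≤ 1 := by
    by_cases h : p.coeff i = 0
    · simp [h]
    · exact (hv _ h).le
  exact lt_of_le_of_lt (mul_le_of_le_one_left' h1)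
    (pow_lt_pow_right₀ hy (Finset.mem_range.mp hi))

/-- The block `s b`, with `b` not affine, expands the region where `y` is large. -/
theorem rot_mul_nonaffine_expands (hv : ∀ c : k, c ≠ 0 → v (algebraMap k L c) = 1)
    {b : SAut 2 k} (hb : IsNonaffineTri b) {Q : Fin 2 → L} (h1 : 1 < v (Q 1))
    (h0 : v (Q 0) ≤ v (Q 1)) :
    v (((rot k * b : SAut 2 k) : PolyAut 2 k).val.act Q 0) <
      v (((rot k * b : SAut 2 k) : PolyAut 2 k).val.act Q 1) ∧
    v (Q 1) ^ 2 ≤ v (((rot k * b : SAut 2 k) : PolyAut 2 k).val.act Q 1) := by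
  obtain ⟨α, p, c, hp, rfl⟩ := hb
  have hv' : ∀ c : k, v (algebraMap k L c) ≤ 1 := fun c => by
    by_cases hc : c = 0
    · simp [hc]
    · exact (hv c hc).le
  have hp0 : p ≠ 0 := by rintro rfl; simp at hp
  rw [SAut.act_mul, act_rot_zero, act_rot_one, act_tri_zero, act_tri_one, Valuation.map_neg]
  have hy : v (algebraMap k L ((α⁻¹ : kˣ) : k) * Q 1 + algebraMap k L c) = v (Q 1) := by
    have e : v (algebraMap k L ((α⁻¹ : kˣ) : k) * Q 1) = v (Q 1) := by
      rw [map_mul, hv _ (Units.ne_zero _), one_mul]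
    rw [← e]
    refine Valuation.map_add_eq_of_lt_left _ ?_
    rw [e]
    exact (hv' c).trans_lt h1
  have hpow : v (Q 1) ^ 2 ≤ v (Q 1) ^ p.natDegree := pow_le_pow_right₀ h1.le hp
  have hlt : v (Q 1) < v (Q 1) ^ 2 := by
    have := pow_lt_pow_right₀ h1 one_lt_two
    rwa [pow_one] at this
  have hx : v (algebraMap k L α * Q 0 + Polynomial.aeval (Q 1) p) = v (Q 1) ^ p.natDegree := by
    rw [← Valuation.map_polynomial_aeval hv h1 hp0]
    refine Valuation.map_add_eq_of_lt_right _ ?_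
    rw [Valuation.map_polynomial_aeval hv h1 hp0, map_mul, hv _ (Units.ne_zero _), one_mul]
    exact h0.trans_lt (hlt.trans_le hpow)
  rw [hx, hy]
  exact ⟨hlt.trans_le hpow, hpow⟩

/-- The inverse of the block `s b`, with `b` not affine, expands the region where `x` is large. -/
theorem rot_mul_nonaffine_inv_expands (hv : ∀ c : k, c ≠ 0 → v (algebraMap k L c) = 1)
    {b : SAut 2 k} (hb : IsNonaffineTri b) {Q : Fin 2 → L} (h1 : 1 < v (Q 0))
    (h0 : v (Q 1) ≤ v (Q 0)) :
    v ((((rot k * b)⁻¹ : SAut 2 k) : PolyAut 2 k).val.act Q 1) <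
      v ((((rot k * b)⁻¹ : SAut 2 k) : PolyAut 2 k).val.act Q 0) ∧
    v (Q 0) ^ 2 ≤ v ((((rot k * b)⁻¹ : SAut 2 k) : PolyAut 2 k).val.act Q 0) := by
  obtain ⟨α, p, c, hp, rfl⟩ := hb
  have hv' : ∀ c : k, v (algebraMap k L c) ≤ 1 := fun c => by
    by_cases hc : c = 0
    · simp [hc]
    · exact (hv c hc).le
  have hp0 : p ≠ 0 := by rintro rfl; simp at hp
  obtain ⟨P, hP⟩ : ∃ P, (((rot k * tri α p c)⁻¹ : SAut 2 k) : PolyAut 2 k).val.act Q = P := ⟨_, rfl⟩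
  have hQ : ((rot k * tri α p c : SAut 2 k) : PolyAut 2 k).val.act P = Q := by
    rw [← hP, ← SAut.act_mul, mul_inv_cancel]
    exact PolyEnd.act_one Q
  have hQ0 : Q 0 = algebraMap k L ((α⁻¹ : kˣ) : k) * P 1 + algebraMap k L c := by
    rw [← congrFun hQ 0, SAut.act_mul, act_rot_zero, act_tri_one]
  have hQ1 : Q 1 = -(algebraMap k L α * P 0 + Polynomial.aeval (P 1) p) := by
    rw [← congrFun hQ 1, SAut.act_mul, act_rot_one, act_tri_zero]
  rw [hP]
  have hw : v (P 1) = v (Q 0) := by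
    have e : v (P 1) = v (Q 0 - algebraMap k L c) := by
      rw [hQ0, add_sub_cancel_right, map_mul, hv _ (Units.ne_zero _), one_mul]
    rw [e]
    exact Valuation.map_sub_eq_of_lt_left _ ((hv' c).trans_lt h1)
  have hpow : v (Q 0) ^ 2 ≤ v (Q 0) ^ p.natDegree := pow_le_pow_right₀ h1.le hp
  have hlt : v (Q 0) < v (Q 0) ^ 2 := by
    have := pow_lt_pow_right₀ h1 one_lt_two
    rwa [pow_one] at this
  have hx : v (P 0) = v (Q 0) ^ p.natDegree := by
    have e : v (P 0) = v (Q 1 + Polynomial.aeval (P 1) p) := by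
      have : Q 1 + Polynomial.aeval (P 1) p = -(algebraMap k L α * P 0) := by rw [hQ1]; ring
      rw [this, Valuation.map_neg, map_mul, hv _ (Units.ne_zero _), one_mul]
    have h1' : 1 < v (P 1) := hw ▸ h1
    rw [e, ← hw, ← Valuation.map_polynomial_aeval hv h1' hp0]
    refine Valuation.map_add_eq_of_lt_right _ ?_
    rw [Valuation.map_polynomial_aeval hv h1' hp0, hw]
    exact h0.trans_lt (hlt.trans_le hpow)
  rw [hx, hw]
  exact ⟨hlt.trans_le hpow, hpow⟩

theorem rotProd_expands (hv : ∀ c : k, c ≠ 0 → v (algebraMap k L c) = 1)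
    {l : List (SAut 2 k)} (hne : l ≠ []) (hl : ∀ b ∈ l, IsNonaffineTri b) {Q : Fin 2 → L}
    (h1 : 1 < v (Q 1)) (h0 : v (Q 0) ≤ v (Q 1)) :
    v ((rotProd l : PolyAut 2 k).val.act Q 0) < v ((rotProd l : PolyAut 2 k).val.act Q 1) ∧
    v (Q 1) ^ 2 ≤ v ((rotProd l : PolyAut 2 k).val.act Q 1) := by
  induction l with
  | nil => exact absurd rfl hne
  | cons b l ih =>
    have hb := hl b (by simp)
    rcases eq_or_ne l [] with rfl | hne'
    · rw [rotProd_cons, rotProd_nil, mul_one]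
      exact rot_mul_nonaffine_expands hv hb h1 h0
    · obtain ⟨ih1, ih2⟩ := ih hne' fun b hb => hl b (by simp [hb])
      rw [rotProd_cons, SAut.act_mul]
      have h2 : 1 < v ((rotProd l : PolyAut 2 k).val.act Q 1) :=
        (one_lt_pow₀ h1 two_ne_zero).trans_le ih2
      obtain ⟨h3, h4⟩ := rot_mul_nonaffine_expands hv hb h2 ih1.le
      exact ⟨h3, ih2.trans ((le_self_pow₀ h2.le two_ne_zero).trans h4)⟩

theorem rotProd_inv_expands (hv : ∀ c : k, c ≠ 0 → v (algebraMap k L c) = 1)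
    {l : List (SAut 2 k)} (hne : l ≠ []) (hl : ∀ b ∈ l, IsNonaffineTri b) {Q : Fin 2 → L}
    (h1 : 1 < v (Q 0)) (h0 : v (Q 1) ≤ v (Q 0)) :
    v ((((rotProd l)⁻¹ : SAut 2 k) : PolyAut 2 k).val.act Q 1) <
      v ((((rotProd l)⁻¹ : SAut 2 k) : PolyAut 2 k).val.act Q 0) ∧
    v (Q 0) ^ 2 ≤ v ((((rotProd l)⁻¹ : SAut 2 k) : PolyAut 2 k).val.act Q 0) := by
  induction l generalizing Q with
  | nil => exact absurd rfl hne
  | cons b l ih =>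
    have hb := hl b (by simp)
    rcases eq_or_ne l [] with rfl | hne'
    · rw [rotProd_cons, rotProd_nil, mul_one]
      exact rot_mul_nonaffine_inv_expands hv hb h1 h0
    · rw [rotProd_cons, mul_inv_rev, SAut.act_mul]
      obtain ⟨h3, h4⟩ := rot_mul_nonaffine_inv_expands hv hb h1 h0
      have h2 := (one_lt_pow₀ h1 two_ne_zero).trans_le h4
      obtain ⟨ih1, ih2⟩ := ih hne' (fun b hb => hl b (by simp [hb])) h2 h3.le
      exact ⟨ih1, h4.trans ((le_self_pow₀ h2.le two_ne_zero).trans ih2)⟩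

end Expansion

section Algebraic

open MvPolynomial WithZero

variable {k : Type*} [Field k]

theorem exp_succ_le_rotProd_pow {l : List (SAut 2 k)} (hne : l ≠ [])
    (hl : ∀ b ∈ l, IsNonaffineTri b) (m : ℕ) :
    degVal ((((rotProd l ^ m : SAut 2 k) : PolyAut 2 k) : PolyEnd 2 k).coord 0) ≤
        degVal ((((rotProd l ^ m : SAut 2 k) : PolyAut 2 k) : PolyEnd 2 k).coord 1) ∧
      exp (m + 1 : ℤ) ≤
        degVal ((((rotProd l ^ m : SAut 2 k) : PolyAut 2 k) : PolyEnd 2 k).coord 1) := by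
  induction m with
  | zero =>
    rw [pow_zero]
    change degVal (X 0) ≤ degVal (X 1) ∧ _ ≤ degVal (X 1)
    simp [degVal_X]
  | succ m ih =>
    have h1 : 1 < degVal ((((rotProd l ^ m : SAut 2 k) : PolyAut 2 k) : PolyEnd 2 k).coord 1) := by
      refine lt_of_lt_of_le ?_ ih.2
      rw [← exp_zero, exp_lt_exp]
      omega
    obtain ⟨h2, h3⟩ := rotProd_expands (v := degVal) (fun c hc =>
        degVal_algebraMap hc) hne hl h1 ih.1
    rw [pow_succ']
    refine ⟨h2.le, le_trans ?_ h3⟩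
    calc exp ((m + 1 : ℕ) + 1 : ℤ) ≤ exp (m + 1 : ℤ) ^ 2 := by
          rw [← exp_nsmul, exp_le_exp]
          push_cast
          simp only [nsmul_eq_mul]
          push_cast
          linarith
      _ ≤ _ := by gcongr; exact ih.2

theorem not_isAlgebraicAut_rotProd {l : List (SAut 2 k)} (hne : l ≠ [])
    (hl : ∀ b ∈ l, IsNonaffineTri b) : ¬ IsAlgebraicAut (rotProd l : PolyAut 2 k) := by
  rintro ⟨d, hd⟩
  have h1 : ((((rotProd l : PolyAut 2 k) ^ d : PolyAut 2 k)) : PolyEnd 2 k).degree ≤ d := hd ⟨d,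
      rfl⟩
  have h2 := (exp_succ_le_rotProd_pow hne hl d).2.trans (degVal_le _)
  rw [exp_le_exp] at h2
  have h3 := PolyEnd.totalDegree_le_degree (((rotProd l : PolyAut 2 k) ^ d : PolyAut 2 k) : PolyEnd
      2 k) 1
  have h4 : (d + 1 : ℤ) ≤ d := h2.trans (by exact_mod_cast h3.trans h1)
  omega

theorem IsAlgebraicAut.of_isConj {n : ℕ} {R : Type*} [CommRing R] {f g : PolyAut n R}
    (hf : IsAlgebraicAut f) (h : IsConj f g) : IsAlgebraicAut g := by
  obtain ⟨c, rfl⟩ := isConj_iff.mp h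
  obtain ⟨d, hd⟩ := hf
  refine ⟨(c : PolyEnd n R).degree * d * ((c⁻¹ : PolyAut n R) : PolyEnd n R).degree, ?_⟩
  rintro _ ⟨m, rfl⟩
  simp only
  rw [conj_pow, Units.val_mul, Units.val_mul]
  refine (PolyEnd.degree_mul_le _ _).trans (Nat.mul_le_mul_right _ ?_)
  exact (PolyEnd.degree_mul_le _ _).trans (Nat.mul_le_mul_left _ (hd ⟨m, rfl⟩))

theorem degree_tri_le {R : Type*} [CommRing R] (α : Rˣ) (p : Polynomial R) (c : R) :
    ((tri α p c : PolyAut 2 R) : PolyEnd 2 R).degree ≤ max 1 p.natDegree := by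
  rw [PolyEnd.degree_le_iff, Fin.forall_fin_two, tri_val, triEnd_coord_zero, triEnd_coord_one]
  constructor
  · refine (totalDegree_add _ _).trans (max_le_max ?_ (totalDegree_aeval_X_le 1 p))
    refine (totalDegree_mul _ _).trans ?_
    rw [totalDegree_C, zero_add]
    exact totalDegree_X_le _
  · refine ((totalDegree_add _ _).trans (max_le ?_ ?_)).trans (le_max_left _ _)
    · refine (totalDegree_mul _ _).trans ?_
      rw [totalDegree_C, zero_add]
      exact totalDegree_X_le _
    · rw [totalDegree_C]
      exact zero_le_one

theorem IsTri.isAlgebraicAut {b : SAut 2 k} (hb : IsTri b) : IsAlgebraicAut (b : PolyAut 2 k) := by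
  obtain ⟨α, p, c, rfl⟩ := hb
  have key : ∀ m : ℕ, ∃ β q d, q.natDegree ≤ p.natDegree ∧ tri α p c ^ m = tri β q d := by
    intro m
    induction m with
    | zero => exact ⟨1, 0, 0, by simp, by rw [pow_zero, tri_one]⟩
    | succ m ih =>
      obtain ⟨β, q, d, hq, e⟩ := ih
      rw [pow_succ', e, tri_mul]
      refine ⟨_, _, _, ?_, rfl⟩
      refine (Polynomial.natDegree_add_le _ _).trans (max_le ?_ ?_)
      · exact (Polynomial.natDegree_C_mul_le _ _).trans hq
      · refine Polynomial.natDegree_comp_le.trans ?_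
        refine (Nat.mul_le_mul_left _ (Polynomial.natDegree_linear_le)).trans (mul_one _).le
  refine ⟨max 1 p.natDegree, ?_⟩
  rintro _ ⟨m, rfl⟩
  obtain ⟨β, q, d, hq, e⟩ := key m
  have e' : (tri α p c : PolyAut 2 k) ^ m = (tri β q d : PolyAut 2 k) := by
    rw [← e]; rfl
  simp only
  rw [e']
  exact (degree_tri_le β q d).trans (max_le_max le_rfl hq)

theorem IsConj.coe_SAut {n : ℕ} {R : Type*} [CommRing R] {f g : SAut n R} (h : IsConj f g) :
    IsConj (f : PolyAut n R) (g : PolyAut n R) :=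
  MonoidHom.map_isConj (SAut n R).subtype h

theorem exists_isTri_of_isAlgebraicAut [IsAlgClosed k] {f : SAut 2 k}
    (hf : IsAlgebraicAut (f : PolyAut 2 k)) : ∃ b, IsTri b ∧ IsConj f b := by
  rcases exists_normal_form f with h | ⟨l, hne, hl, hc⟩
  · exact h
  · exact absurd (hf.of_isConj (IsConj.coe_SAut hc)) (not_isAlgebraicAut_rotProd hne hl)

theorem exists_rotProd_of_not_isAlgebraicAut [IsAlgClosed k] {f : SAut 2 k}
    (hf : ¬ IsAlgebraicAut (f : PolyAut 2 k)) :
    ∃ l : List (SAut 2 k), l ≠ [] ∧ (∀ b ∈ l, IsNonaffineTri b) ∧ IsConj f (rotProd l) := by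
  rcases exists_normal_form f with ⟨b, hb, hc⟩ | h
  · exact absurd (hb.isAlgebraicAut.of_isConj (IsConj.coe_SAut hc).symm) hf
  · exact h

end Algebraic

/-! ### A criterion for closedness -/

section Closedness

open MvPolynomial

theorem PolyEnd.map_map {n : ℕ} {R S T : Type*} [CommRing R] [CommRing S] [CommRing T]
    (φ : R →+* S) (ψ : S →+* T) (f : PolyEnd n R) :
    PolyEnd.map ψ (PolyEnd.map φ f) = PolyEnd.map (ψ.comp φ) f :=
  PolyEnd.ext (funext fun i => by
    rw [PolyEnd.map_coord, PolyEnd.map_coord, PolyEnd.map_coord, MvPolynomial.map_map])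

theorem PolyAut.map_map {n : ℕ} {R S T : Type*} [CommRing R] [CommRing S] [CommRing T]
    (φ : R →+* S) (ψ : S →+* T) (f : PolyAut n R) :
    PolyAut.map ψ (PolyAut.map φ f) = PolyAut.map (ψ.comp φ) f :=
  Units.ext <| by
    have := PolyEnd.map_map φ ψ (f : PolyEnd n R)
    simpa only [PolyAut.map, Units.coe_map] using this

/-- Criterion for closedness: it suffices to consider families over affine varieties, and to show
that the set contains each value of a family at a point that is a limit of points where the value
lies in the set. -/
theorem isClosed_of_forall_family {n : ℕ} {k : Type u} [Field k] {S : Set (PolyAut n k)}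
    (h : ∀ (B : Type u) [CommRing B] [Algebra k B] [Algebra.FiniteType k B] (F : PolyAut n B)
      (ev₀ : B →ₐ[k] k), (∀ b, ev₀ b ≠ 0 →
        ∃ ev : B →ₐ[k] k, PolyAut.map ev.toRingHom F ∈ S ∧ ev b ≠ 0) →
      PolyAut.map ev₀.toRingHom F ∈ S) : IsClosed S := by
  rw [isClosed_polyAut_iff]
  intro A F
  refine isClosed_of_closure_subset fun p₀ hp₀ => ?_
  obtain ⟨U, hU, hpU, -⟩ := exists_isAffineOpen_mem_and_subset (U := ⊤) (x := p₀.pt) (by simp)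
  let B : CommRingCat.{u} := Γ(A.X, U)
  let j : Spec B ⟶ A.X := hU.fromSpec
  have hrange : Set.range j = U := hU.range_fromSpec
  let φ : CommRingCat.of k ⟶ B := Spec.preimage (j ≫ A.str)
  have hφ : Spec.map φ = j ≫ A.str := Spec.map_preimage _
  let _ : Algebra k B := φ.hom.toAlgebra
  have hft : Algebra.FiniteType k B := by
    have := A.locallyOfFiniteType
    have h2 : LocallyOfFiniteType (Spec.map φ) := by rw [hφ]; infer_instance
    exact HasRingHomProperty.Spec_iff.mp h2
  let ψ : Γ(A.X, ⊤) →+* B := (j.appTop ≫ (Scheme.ΓSpecIso B).hom).hom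
  -- points of `A` in the affine open set are evaluation homomorphisms
  have hev : ∀ p : A.Point, p.pt ∈ U → ∃ ev : B →ₐ[k] k,
      Spec.map (CommRingCat.ofHom ev.toRingHom) ≫ j = p.hom ∧
      ev.toRingHom.comp ψ = p.eval := by
    intro p hp
    have hr : Set.range p.hom ⊆ Set.range j := by
      rw [hrange]
      rintro _ ⟨x, rfl⟩
      rw [Subsingleton.elim x (IsLocalRing.closedPoint k)]
      exact hp
    let q := IsOpenImmersion.lift j p.hom hr
    have hq : q ≫ j = p.hom := IsOpenImmersion.lift_fac _ _ _
    let e : B ⟶ CommRingCat.of k := Spec.preimage q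
    have he : Spec.map e = q := Spec.map_preimage _
    have hcomm : φ ≫ e = 𝟙 _ := by
      apply Spec.map_injective
      rw [Spec.map_comp, hφ, he, reassoc_of% hq, p.hom_str, Spec.map_id]
    refine ⟨{ e.hom with commutes' := fun r => ?_ }, ?_, ?_⟩
    · exact congrArg (fun f => f.hom r) hcomm
    · change Spec.map e ≫ j = p.hom
      rw [he, hq]
    · change (((j.appTop ≫ (Scheme.ΓSpecIso B).hom)) ≫ e).hom = _
      rw [AlgVariety.Point.eval, ← hq, ← he, Category.assoc, ← Scheme.ΓSpecIso_naturality,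
        Scheme.Hom.comp_appTop, Category.assoc]
  obtain ⟨ev₀, hev₀, hev₀'⟩ := hev p₀ hpU
  have key := h B (PolyAut.map ψ F) ev₀ ?_
  · rw [PolyAut.map_map, hev₀'] at key
    exact key
  intro b hb
  let V : (Spec B).Opens := PrimeSpectrum.basicOpen b
  have hmem : ∀ (p : A.Point) (ev : B →ₐ[k] k),
      Spec.map (CommRingCat.ofHom ev.toRingHom) ≫ j = p.hom →
      (p.pt ∈ j ''ᵁ V ↔ ev b ≠ 0) := by
    intro p ev hp
    have : p.pt = j (Spec.map (CommRingCat.ofHom ev.toRingHom) (IsLocalRing.closedPoint k)) := by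
      rw [AlgVariety.Point.pt, ← hp]
      rfl
    rw [this, Scheme.Hom.apply_mem_image_iff]
    change b ∉ Ideal.comap _ (IsLocalRing.maximalIdeal k) ↔ _
    rw [Ideal.mem_comap, IsLocalRing.maximalIdeal_eq_bot, Ideal.mem_bot]
    rfl
  rw [mem_closure_iff] at hp₀
  obtain ⟨p, hpV, hpS⟩ := hp₀ (AlgVariety.Point.pt ⁻¹' (j ''ᵁ V : A.X.Opens))
    ⟨_, (j ''ᵁ V).isOpen, rfl⟩ ((hmem p₀ ev₀ hev₀).mpr hb)
  have hpU' : p.pt ∈ U := by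
    have h1 : p.pt ∈ (j ''ᵁ V) := hpV
    obtain ⟨x, -, hx⟩ := h1
    rw [← SetLike.mem_coe, ← hrange, ← hx]
    exact ⟨x, rfl⟩
  obtain ⟨ev, hev1, hev2⟩ := hev p hpU'
  refine ⟨ev, ?_, (hmem p ev hev1).mp hpV⟩
  rw [PolyAut.map_map, hev2]
  exact hpS

end Closedness

/-! ### Degrees of conjugations to a Hénon map -/

section DegreeBound

open MvPolynomial WithZero

variable {k : Type*} [Field k]

theorem degVal_coord (g : PolyAut 2 k) (i : Fin 2) :
    degVal ((g : PolyEnd 2 k).coord i) = exp (((g : PolyEnd 2 k).coord i).totalDegree : ℤ) :=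
  degVal_of_ne_zero (coord_ne_zero g i)

theorem one_lt_degVal_coord (g : PolyAut 2 k) (i : Fin 2) :
    1 < degVal ((g : PolyEnd 2 k).coord i) := by
  rw [degVal_coord, ← exp_zero, exp_lt_exp]
  exact_mod_cast totalDegree_coord_pos g i

theorem one_le_degree (g : PolyAut 2 k) : 1 ≤ (g : PolyEnd 2 k).degree :=
  (totalDegree_coord_pos g 0).trans_le (PolyEnd.totalDegree_le_degree _ 0)

theorem degree_eq_of_le {g : PolyEnd 2 k} {i j : Fin 2} (hij : i ≠ j)
    (h : (g.coord i).totalDegree ≤ (g.coord j).totalDegree) :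
    g.degree = (g.coord j).totalDegree := by
  refine le_antisymm ?_ (g.totalDegree_le_degree j)
  rw [PolyEnd.degree_le_iff]
  intro m
  obtain rfl | rfl : m = i ∨ m = j := by omega
  · exact h
  · exact le_rfl

theorem totalDegree_le_of_degVal_le {g : PolyAut 2 k} {i j : Fin 2}
    (h : degVal ((g : PolyEnd 2 k).coord i) ≤ degVal ((g : PolyEnd 2 k).coord j)) :
    ((g : PolyEnd 2 k).coord i).totalDegree ≤ ((g : PolyEnd 2 k).coord j).totalDegree := by
  rw [degVal_coord, degVal_coord, exp_le_exp] at h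
  exact_mod_cast h

theorem degree_lt_of_degVal_sq_le {g g' : PolyAut 2 k} {j i' j' : Fin 2} (hij : i' ≠ j')
    (h' : degVal ((g' : PolyEnd 2 k).coord i') ≤ degVal ((g' : PolyEnd 2 k).coord j'))
    (h : degVal ((g' : PolyEnd 2 k).coord j') ^ 2 ≤ degVal ((g : PolyEnd 2 k).coord j)) :
    (g' : PolyEnd 2 k).degree < (g : PolyEnd 2 k).degree := by
  rw [degree_eq_of_le hij (totalDegree_le_of_degVal_le h')]
  refine lt_of_lt_of_le ?_ (PolyEnd.totalDegree_le_degree _ j)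
  rw [degVal_coord, degVal_coord, ← exp_nsmul, exp_le_exp] at h
  have := totalDegree_coord_pos g' j'
  simp only [nsmul_eq_mul] at h
  have h2 : 2 * ((g' : PolyEnd 2 k).coord j').totalDegree ≤
      ((g : PolyEnd 2 k).coord j).totalDegree := by
    exact_mod_cast h
  omega

/-- In the orbit of an automorphism under left multiplication by powers of a Hénon map there is a
place where the dominating component changes. -/
theorem exists_zpow_mul_dominant_change {l : List (SAut 2 k)} (hne : l ≠ [])
    (hl : ∀ b ∈ l, IsNonaffineTri b) (h : SAut 2 k) :
    ∃ j : ℤ, degVal (((rotProd l ^ j * h : SAut 2 k) : PolyAut 2 k).val.coord 1) ≤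
        degVal (((rotProd l ^ j * h : SAut 2 k) : PolyAut 2 k).val.coord 0) ∧
      degVal (((rotProd l * (rotProd l ^ j * h) : SAut 2 k) : PolyAut 2 k).val.coord 0) <
        degVal (((rotProd l * (rotProd l ^ j * h) : SAut 2 k) : PolyAut 2 k).val.coord 1) := by
  classical
  have hv : ∀ c : k, c ≠ 0 → degVal (algebraMap k (MvPolynomial (Fin 2) k) c) = 1 :=
    fun c hc => degVal_algebraMap hc
  have hex : ∃ n, ∃ j : ℤ, ((rotProd l ^ j * h : SAut 2 k) : PolyAut 2 k).val.degree = n := ⟨_, 0,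
      rfl⟩
  obtain ⟨j, hj⟩ := Nat.find_spec hex
  have hmin : ∀ i : ℤ, ((rotProd l ^ j * h : SAut 2 k) : PolyAut 2 k).val.degree ≤
      ((rotProd l ^ i * h : SAut 2 k) : PolyAut 2 k).val.degree := fun i => by
    rw [hj]; exact Nat.find_min' hex ⟨i, rfl⟩
  rcases le_or_gt (degVal (((rotProd l ^ j * h : SAut 2 k) : PolyAut 2 k).val.coord 1))
    (degVal (((rotProd l ^ j * h : SAut 2 k) : PolyAut 2 k).val.coord 0)) with hle | hlt
  · refine ⟨j, hle, ?_⟩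
    by_contra! hcon
    have h1 := (rotProd_inv_expands (v := degVal) hv hne hl (one_lt_degVal_coord _ 0) hcon).2
    have e : (((rotProd l)⁻¹ : SAut 2 k) : PolyAut 2 k).val.act
        ((rotProd l * (rotProd l ^ j * h) : SAut 2 k) : PolyAut 2 k).val.coord =
        ((rotProd l ^ j * h : SAut 2 k) : PolyAut 2 k).val.coord := by
      have : (rotProd l)⁻¹ * (rotProd l * (rotProd l ^ j * h)) = rotProd l ^ j * h := by group
      conv_rhs => rw [← this]
      rfl
    rw [e] at h1
    have h2 := degree_lt_of_degVal_sq_le (by decide) hcon h1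
    have h3 := hmin (j + 1)
    rw [zpow_add_one, (Commute.zpow_self (rotProd l) j).eq, mul_assoc] at h3
    omega
  · refine ⟨j - 1, ?_, ?_⟩
    · by_contra! hcon
      have h1 := (rotProd_expands (v := degVal) hv hne hl (one_lt_degVal_coord _ 1) hcon.le).2
      have e : (rotProd l : PolyAut 2 k).val.act
          ((rotProd l ^ (j - 1) * h : SAut 2 k) : PolyAut 2 k).val.coord =
          ((rotProd l ^ j * h : SAut 2 k) : PolyAut 2 k).val.coord := by
        have : rotProd l * (rotProd l ^ (j - 1) * h) = rotProd l ^ j * h := by group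
        conv_rhs => rw [← this]
        rfl
      rw [e] at h1
      have h2 := degree_lt_of_degVal_sq_le (by decide) hcon.le h1
      have h3 := hmin (j - 1)
      omega
    · have : rotProd l * (rotProd l ^ (j - 1) * h) = rotProd l ^ j * h := by group
      rw [this]
      exact hlt

/-- A conjugate `F` of a Hénon map `H` is conjugate to `H` by an automorphism whose degree is bounded
in terms of `F`. -/
theorem exists_conj_degree_le_rotProd [IsAlgClosed k] {l : List (SAut 2 k)} (hne : l ≠ [])
    (hl : ∀ b ∈ l, IsNonaffineTri b) {F : SAut 2 k} (hF : IsConj (rotProd l) F) :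
    ∃ g : SAut 2 k, g * rotProd l * g⁻¹ = F ∧
      (g : PolyAut 2 k).val.degree ≤ (F : PolyAut 2 k).val.degree ∧
      ((g⁻¹ : SAut 2 k) : PolyAut 2 k).val.degree ≤
        (((rotProd l)⁻¹ : SAut 2 k) : PolyAut 2 k).val.degree * (F : PolyAut 2 k).val.degree := by
  have hv : ∀ c : k, c ≠ 0 → degVal (algebraMap k (MvPolynomial (Fin 2) k) c) = 1 :=
    fun c hc => degVal_algebraMap hc
  obtain ⟨g, rfl⟩ := isConj_iff.mp hF
  obtain ⟨j, hj, hj'⟩ := exists_zpow_mul_dominant_change hne hl g⁻¹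
  obtain ⟨q, hq⟩ : ∃ q, q = rotProd l ^ j * g⁻¹ := ⟨_, rfl⟩
  rw [← hq] at hj hj'
  have hF' : g * rotProd l * g⁻¹ = q⁻¹ * (rotProd l * q) := by rw [hq]; group
  rw [hF']
  refine ⟨q⁻¹, by group, ?_⟩
  rw [inv_inv]
  set F : SAut 2 k := q⁻¹ * (rotProd l * q) with hFdef
  obtain ⟨i, -, hi⟩ := Finset.exists_mem_eq_sup Finset.univ Finset.univ_nonempty
    fun i => (((q⁻¹ : SAut 2 k) : PolyAut 2 k).val.coord i).totalDegree
  change ((q⁻¹ : SAut 2 k) : PolyAut 2 k).val.degree = _ at hi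
  have hd := one_le_degree ((q⁻¹ : SAut 2 k) : PolyAut 2 k)
  have hdF := one_le_degree (F : PolyAut 2 k)
  have hdH := one_le_degree (((rotProd l)⁻¹ : SAut 2 k) : PolyAut 2 k)
  obtain ⟨r, l₀, l₁, hr, hl01, hlead⟩ := exists_linear_leadingForm ((q⁻¹ : SAut 2 k) : PolyAut 2 k)
      i
  by_cases hl1 : l₁ = 0
  · have hl0 : l₀ ≠ 0 := by tauto
    have h1 := hlead.map_aeval_eq (v := degVal) hv hr (Q := (q : PolyAut 2 k).val.coord)
      (one_lt_degVal_coord _ 0) (Fin.forall_fin_two.mpr ⟨le_rfl, hj⟩)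
      (by rw [hl1, map_zero, zero_mul, add_zero, map_mul, hv _ hl0, one_mul])
    have e : aeval (q : PolyAut 2 k).val.coord (((q⁻¹ : SAut 2 k) : PolyAut 2 k).val.coord i) =
        X i :=
      inv_act_coord (q : PolyAut 2 k) i
    rw [e, degVal_X, degVal_coord, ← exp_nsmul, exp_inj, ← hi, nsmul_eq_mul] at h1
    have h2 : 1 = ((q⁻¹ : SAut 2 k) : PolyAut 2 k).val.degree *
      ((q : PolyAut 2 k).val.coord 0).totalDegree := by exact_mod_cast h1
    have h3 := degree_eq_of_le (by decide) (totalDegree_le_of_degVal_le hj)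
    rw [← h3] at h2
    have h4 := Nat.eq_one_of_mul_eq_one_right h2.symm
    have h5 := Nat.eq_one_of_mul_eq_one_left h2.symm
    constructor
    · omega
    · nlinarith
  · have h1 := hlead.map_aeval_eq (v := degVal) hv hr
      (Q := ((rotProd l * q : SAut 2 k) : PolyAut 2 k).val.coord)
      (one_lt_degVal_coord _ 1) (Fin.forall_fin_two.mpr ⟨hj'.le, le_rfl⟩) (by
        have e : degVal (algebraMap k (MvPolynomial (Fin 2) k) l₁ *
            ((rotProd l * q : SAut 2 k) : PolyAut 2 k).val.coord 1) =
            degVal (((rotProd l * q : SAut 2 k) : PolyAut 2 k).val.coord 1) := by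
          rw [map_mul, hv _ hl1, one_mul]
        rw [← e]
        refine Valuation.map_add_eq_of_lt_right _ ?_
        rw [e, map_mul]
        refine lt_of_le_of_lt (mul_le_of_le_one_left' ?_) hj'
        by_cases h0 : l₀ = 0
        · simp [h0]
        · exact (hv _ h0).le)
    have e : aeval ((rotProd l * q : SAut 2 k) : PolyAut 2 k).val.coord
        (((q⁻¹ : SAut 2 k) : PolyAut 2 k).val.coord i) = (F : PolyAut 2 k).val.coord i := rfl
    rw [e, degVal_coord, degVal_coord, ← exp_nsmul, exp_inj, ← hi, nsmul_eq_mul] at h1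
    have h2 : ((F : PolyAut 2 k).val.coord i).totalDegree =
      ((q⁻¹ : SAut 2 k) : PolyAut 2 k).val.degree *
        (((rotProd l * q : SAut 2 k) : PolyAut 2 k).val.coord 1).totalDegree := by exact_mod_cast h1
    have h3 := degree_eq_of_le (by decide) (totalDegree_le_of_degVal_le hj'.le)
    rw [← h3] at h2
    have h4 := one_le_degree ((rotProd l * q : SAut 2 k) : PolyAut 2 k)
    have h5 := PolyEnd.totalDegree_le_degree (F : PolyAut 2 k).val i
    constructor
    · nlinarith
    · have h6 : (q : PolyAut 2 k).val.degree ≤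
        (((rotProd l)⁻¹ : SAut 2 k) : PolyAut 2 k).val.degree *
          ((rotProd l * q : SAut 2 k) : PolyAut 2 k).val.degree := by
        have : (q : PolyAut 2 k).val = (((rotProd l)⁻¹ : SAut 2 k) : PolyAut 2 k).val *
            ((rotProd l * q : SAut 2 k) : PolyAut 2 k).val := by
          have e : q = (rotProd l)⁻¹ * (rotProd l * q) := by group
          conv_lhs => rw [e]
          rfl
        rw [this]
        exact PolyEnd.degree_mul_le _ _
      refine h6.trans (Nat.mul_le_mul_left _ ?_)
      nlinarith

end DegreeBound

/-! ### Base change and descent -/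

section BaseChange

open MvPolynomial

variable {n : ℕ} {R S T : Type*} [CommRing R] [CommRing S] [CommRing T]

theorem SAut.map_coord (φ : R →+* S) (f : SAut n R) (i : Fin n) :
    (SAut.map φ f : PolyAut n S).val.coord i = MvPolynomial.map φ ((f : PolyAut n R).val.coord i) :=
  rfl

theorem SAut.map_map (φ : R →+* S) (ψ : S →+* T) (f : SAut n R) :
    SAut.map ψ (SAut.map φ f) = SAut.map (ψ.comp φ) f :=
  SAut.ext_end <| by
    have := PolyEnd.map_map φ ψ (f : PolyAut n R).val
    exact this

theorem SAut.map_id (f : SAut n R) : SAut.map (RingHom.id R) f = f :=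
  SAut.ext_end (PolyEnd.ext (funext fun i => by
    rw [SAut.map_coord, MvPolynomial.map_id]))

theorem SAut.coe_map (φ : R →+* S) (f : SAut n R) :
    (SAut.map φ f : PolyAut n S) = PolyAut.map φ (f : PolyAut n R) := rfl

theorem PolyEnd.map_injective {φ : R →+* S} (hφ : Function.Injective φ) :
    Function.Injective (PolyEnd.map (n := n) φ) := fun _ _ h =>
  PolyEnd.ext (funext fun i => MvPolynomial.map_injective φ hφ (congrFun (congrArg PolyEnd.coord h)
      i))

theorem SAut.map_injective {φ : R →+* S} (hφ : Function.Injective φ) :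
    Function.Injective (SAut.map (n := n) φ) := fun _ _ h =>
  SAut.ext_end (PolyEnd.map_injective hφ (congrArg (fun f : SAut n S => (f : PolyAut n S).val) h))

theorem PolyEnd.degree_map_le (φ : R →+* S) (f : PolyEnd n R) :
    (PolyEnd.map φ f).degree ≤ f.degree := by
  rw [PolyEnd.degree_le_iff]
  intro i
  exact (Finset.sup_mono (MvPolynomial.support_map_subset φ _)).trans (f.totalDegree_le_degree i)

theorem PolyEnd.act_map {L : Type*} [CommRing L] [Algebra R S] [Algebra R L] [Algebra S L]
    [IsScalarTower R S L] (f : PolyEnd n R) (Q : Fin n → L) :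
    (PolyEnd.map (algebraMap R S) f).act Q = f.act Q :=
  funext fun i => MvPolynomial.aeval_map_algebraMap S Q (f.coord i)

/-- An automorphism descends along an injective ring homomorphism `φ` if the coefficients of its
components and of the components of its inverse lie in the range of `φ`. -/
theorem SAut.exists_map_eq {φ : R →+* S} (hφ : Function.Injective φ) (f : SAut n S)
    (hf : ∀ i m, coeff m ((f : PolyAut n S).val.coord i) ∈ Set.range φ)
    (hf' : ∀ i m, coeff m (((f⁻¹ : SAut n S) : PolyAut n S).val.coord i) ∈ Set.range φ) :
    ∃ f' : SAut n R, SAut.map φ f' = f := by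
  have lift : ∀ p : MvPolynomial (Fin n) S, (∀ m, coeff m p ∈ Set.range φ) →
      ∃ q, MvPolynomial.map φ q = p := by
    intro p hp
    have : p ∈ Set.range (MvPolynomial.map φ) := by
      rw [MvPolynomial.mem_range_map_iff_coeffs_subset]
      intro c hc
      obtain ⟨m, -, rfl⟩ := MvPolynomial.mem_coeffs_iff.mp hc
      exact hp m
    exact this
  choose p hp using fun i => lift _ (hf i)
  choose q hq using fun i => lift _ (hf' i)
  have ep : PolyEnd.map φ ⟨p⟩ = (f : PolyAut n S).val := PolyEnd.ext (funext hp)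
  have eq : PolyEnd.map φ ⟨q⟩ = ((f⁻¹ : SAut n S) : PolyAut n S).val := PolyEnd.ext (funext hq)
  have h1 : (⟨p⟩ * ⟨q⟩ : PolyEnd n R) = 1 := by
    apply PolyEnd.map_injective hφ
    rw [_root_.map_mul, ep, eq, map_one]
    exact Units.mul_inv (f : PolyAut n S)
  have h2 : (⟨q⟩ * ⟨p⟩ : PolyEnd n R) = 1 := by
    apply PolyEnd.map_injective hφ
    rw [_root_.map_mul, ep, eq, map_one]
    exact Units.inv_mul (f : PolyAut n S)
  refine ⟨⟨⟨⟨p⟩, ⟨q⟩, h1, h2⟩, ?_⟩, SAut.ext_end ep⟩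
  rw [mem_SAut]
  apply MvPolynomial.map_injective φ hφ
  rw [map_one]
  change MvPolynomial.map φ (PolyEnd.jac ⟨p⟩) = 1
  rw [← PolyEnd.jac_map, ep]
  exact f.2

/-- A family of polynomials of bounded degree is a polynomial with coefficients in a product. -/
theorem exists_mvPolynomial_pi {I σ : Type*} [Finite σ] (p : I → MvPolynomial σ R) (d : ℕ)
    (hp : ∀ i, (p i).totalDegree ≤ d) :
    ∃ P : MvPolynomial σ (I → R), ∀ i, MvPolynomial.map (Pi.evalRingHom (fun _ => R) i) P =
      p i := by
  classical
  have := Fintype.ofFinite σ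
  refine ⟨∑ m ∈ Finset.Iic (Finsupp.equivFunOnFinite.symm fun _ : σ => d),
    monomial m fun i => coeff m (p i), fun i => ?_⟩
  ext m
  rw [coeff_map, coeff_sum]
  simp only [coeff_monomial, Finset.sum_ite_eq']
  split_ifs with hm
  · rfl
  · rw [map_zero, eq_comm]
    refine coeff_eq_zero_of_totalDegree_lt (lt_of_le_of_lt (hp i) ?_)
    by_contra! hle
    apply hm
    rw [Finset.mem_Iic]
    intro j
    change m j ≤ d
    by_cases hj : j ∈ m.support
    · exact (Finset.single_le_sum (f := fun i => m i) (fun _ _ => Nat.zero_le _) hj).trans hle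
    · rw [Finsupp.notMem_support_iff.mp hj]
      exact Nat.zero_le _

theorem exists_polyEnd_pi {I : Type*} (g : I → PolyEnd n R) (d : ℕ) (hg : ∀ i, (g i).degree ≤ d) :
    ∃ G : PolyEnd n (I → R), ∀ i, PolyEnd.map (Pi.evalRingHom (fun _ => R) i) G = g i := by
  choose P hP using fun j : Fin n => exists_mvPolynomial_pi (fun i => (g i).coord j) d
    fun i => ((g i).totalDegree_le_degree j).trans (hg i)
  exact ⟨⟨P⟩, fun i => PolyEnd.ext (funext fun j => hP j i)⟩

theorem mvPolynomial_ext_pi {I σ : Type*} {p q : MvPolynomial σ (I → R)}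
    (h : ∀ i, MvPolynomial.map (Pi.evalRingHom (fun _ => R) i) p =
      MvPolynomial.map (Pi.evalRingHom (fun _ => R) i) q) : p = q := by
  ext m i
  have := congrArg (coeff m) (h i)
  rwa [coeff_map, coeff_map] at this

theorem PolyEnd.ext_pi {I : Type*} {f g : PolyEnd n (I → R)}
    (h : ∀ i, PolyEnd.map (Pi.evalRingHom (fun _ => R) i) f =
      PolyEnd.map (Pi.evalRingHom (fun _ => R) i) g) : f = g :=
  PolyEnd.ext (funext fun j => mvPolynomial_ext_pi fun i =>
    congrFun (congrArg PolyEnd.coord (h i)) j)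

/-- A family of automorphisms of bounded degree, with inverses of bounded degree, is an
automorphism over the product ring. -/
theorem SAut.exists_pi {I : Type*} (g : I → SAut n R) (d : ℕ)
    (hg : ∀ i, (g i : PolyAut n R).val.degree ≤ d)
    (hg' : ∀ i, (((g i)⁻¹ : SAut n R) : PolyAut n R).val.degree ≤ d) :
    ∃ G : SAut n (I → R), ∀ i, SAut.map (Pi.evalRingHom (fun _ => R) i) G = g i := by
  obtain ⟨G, hG⟩ := exists_polyEnd_pi _ d hg
  obtain ⟨G', hG'⟩ := exists_polyEnd_pi _ d hg'
  have h1 : G * G' = 1 := PolyEnd.ext_pi fun i => by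
    rw [_root_.map_mul, hG, hG', map_one]
    exact Units.mul_inv (g i : PolyAut n R)
  have h2 : G' * G = 1 := PolyEnd.ext_pi fun i => by
    rw [_root_.map_mul, hG, hG', map_one]
    exact Units.inv_mul (g i : PolyAut n R)
  refine ⟨⟨⟨G, G', h1, h2⟩, mvPolynomial_ext_pi fun i => ?_⟩, fun i => SAut.ext_end (hG i)⟩
  change MvPolynomial.map _ G.jac = _
  rw [← PolyEnd.jac_map, hG, map_one]
  exact (g i).2

end BaseChange

section Descent

open MvPolynomial

/-- A finitely generated algebra over an algebraically closed field has a rational point. -/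
theorem nonempty_algHom_of_finiteType (k A : Type*) [Field k] [IsAlgClosed k] [CommRing A]
    [Nontrivial A] [Algebra k A] [Algebra.FiniteType k A] : Nonempty (A →ₐ[k] k) := by
  obtain ⟨m, hm⟩ := Ideal.exists_maximal A
  let _ := Ideal.Quotient.field m
  have : Module.Finite k (A ⧸ m) := finite_of_finite_type_of_isJacobsonRing k (A ⧸ m)
  exact ⟨(IsAlgClosed.lift : (A ⧸ m) →ₐ[k] k).comp (Ideal.Quotient.mkₐ k m)⟩

/-- Conjugacy descends from an extension ring to an algebraically closed field. -/
theorem isConj_of_isConj_map {n : ℕ} {k K : Type*} [Field k] [IsAlgClosed k] [CommRing K]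
    [Nontrivial K] [Algebra k K] {f f' : SAut n k}
    (h : IsConj (SAut.map (algebraMap k K) f) (SAut.map (algebraMap k K) f')) : IsConj f f' := by
  classical
  obtain ⟨c, hc⟩ := isConj_iff.mp h
  let s : Finset K := Finset.univ.biUnion fun i : Fin n =>
    ((c : PolyAut n K).val.coord i).coeffs ∪ (((c⁻¹ : SAut n K) : PolyAut n K).val.coord i).coeffs
  let Λ : Subalgebra k K := Algebra.adjoin k (s : Set K)
  have hfg : Algebra.FiniteType k Λ := (Subalgebra.fg_iff_finiteType _).mp ⟨s, rfl⟩
  have hsub : ∀ x ∈ s, x ∈ Set.range Λ.val.toRingHom := fun x hx =>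
    ⟨⟨x, Algebra.subset_adjoin hx⟩, rfl⟩
  have hzero : ∀ (p : MvPolynomial (Fin n) K), (∀ x ∈ p.coeffs, x ∈ s) →
      ∀ m, coeff m p ∈ Set.range Λ.val.toRingHom := by
    intro p hp m
    by_cases h0 : coeff m p = 0
    · exact ⟨0, by rw [h0, map_zero]⟩
    · exact hsub _ (hp _ (coeff_mem_coeffs m h0))
  have hinj : Function.Injective Λ.val.toRingHom := Subtype.val_injective
  obtain ⟨c', hc'⟩ := SAut.exists_map_eq hinj c
    (fun i => hzero _ fun x hx => Finset.mem_biUnion.mpr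
      ⟨i, Finset.mem_univ i, Finset.mem_union_left _ hx⟩)
    (fun i => hzero _ fun x hx => Finset.mem_biUnion.mpr
      ⟨i, Finset.mem_univ i, Finset.mem_union_right _ hx⟩)
  have hcomp : Λ.val.toRingHom.comp (algebraMap k Λ) = algebraMap k K := rfl
  have hconj : c' * SAut.map (algebraMap k Λ) f * c'⁻¹ = SAut.map (algebraMap k Λ) f' := by
    apply SAut.map_injective hinj
    rw [_root_.map_mul, _root_.map_mul, map_inv, hc', SAut.map_map, SAut.map_map, hcomp, hc]
  obtain ⟨ε⟩ := nonempty_algHom_of_finiteType k Λ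
  have hε : ε.toRingHom.comp (algebraMap k Λ) = RingHom.id k :=
    RingHom.ext fun r => ε.commutes r
  refine isConj_iff.mpr ⟨SAut.map ε.toRingHom c', ?_⟩
  have := congrArg (SAut.map ε.toRingHom) hconj
  rwa [_root_.map_mul, _root_.map_mul, map_inv, SAut.map_map, SAut.map_map, hε, SAut.map_id,
    SAut.map_id] at this

end Descent

/-! ### Algebraic independence of components -/

section Jacobian

open MvPolynomial WithZero

theorem totalDegree_pderiv_lt {K σ : Type*} [Field K] {u : MvPolynomial σ K} {j : σ}
    (hd : pderiv j u ≠ 0) : (pderiv j u).totalDegree < u.totalDegree := by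
  have hu : u ≠ 0 := by rintro rfl; simp at hd
  have h := degVal_pderiv_le j u
  rw [degVal_of_ne_zero hd, degVal_of_ne_zero hu, ← exp_add, exp_le_exp] at h
  omega

/-- Over an algebraically closed field of characteristic `p`, a polynomial all of whose partial
derivatives vanish is a `p`-th power. -/
theorem exists_pow_eq_of_pderiv_eq_zero {K σ : Type*} [Field K] [IsAlgClosed K] (p : ℕ)
    [Fact p.Prime] [CharP K p] (u : MvPolynomial σ K) (h : ∀ j, pderiv j u = 0) :
    ∃ w, w ^ p = u := by
  classical
  have hp : 0 < p := (Fact.out : p.Prime).pos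
  have hdvd : ∀ m ∈ u.support, ∀ j, p ∣ m j := by
    intro m hm j
    by_cases hj : m j = 0
    · simp [hj]
    have hle : Finsupp.single j 1 ≤ m := by
      rw [Finsupp.single_le_iff]; omega
    have h1 := congrArg (coeff (m - Finsupp.single j 1)) (h j)
    rw [coeff_pderiv, tsub_add_cancel_of_le hle, coeff_zero] at h1
    rcases mul_eq_zero.mp h1 with h2 | h2
    · exact absurd h2 (mem_support_iff.mp hm)
    · rw [← CharP.cast_eq_zero_iff K p]
      have e : (m - Finsupp.single j 1 : σ →₀ ℕ) j + 1 = m j := by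
        simp; omega
      rw [← e]
      push_cast
      exact h2
  choose r hr using fun c : K => IsAlgClosed.exists_pow_nat_eq c hp
  refine ⟨∑ m ∈ u.support, monomial (m.mapRange (· / p) (Nat.zero_div p)) (r (coeff m u)), ?_⟩
  have : CharP (MvPolynomial σ K) p := inferInstance
  rw [sum_pow_char p]
  conv_rhs => rw [u.as_sum]
  refine Finset.sum_congr rfl fun m hm => ?_
  have e : p • m.mapRange (· / p) (Nat.zero_div p) = m := Finsupp.ext fun j => by
    simp [Nat.mul_div_cancel' (hdvd m hm j)]
  rw [monomial_pow, hr, e]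

/-- The components of an endomorphism with nonzero Jacobian are algebraically independent. -/
theorem aeval_coord_ne_zero_of_isAlgClosed {n : ℕ} {K : Type*} [Field K] [IsAlgClosed K]
    {h : PolyEnd n K} (hj : h.jac ≠ 0) {u : MvPolynomial (Fin n) K} (hu : u ≠ 0) :
    aeval h.coord u ≠ 0 := by
  induction hN : u.totalDegree using Nat.strong_induction_on generalizing u with
  | _ N ih =>
    subst hN
    intro h0
    by_cases hdeg : u.totalDegree = 0
    · rw [totalDegree_eq_zero_iff_eq_C] at hdeg
      rw [hdeg, aeval_C, algebraMap_eq, C_eq_zero] at h0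
      rw [h0, C_0] at hdeg
      exact hu hdeg
    have hder : ∀ j, pderiv j u = 0 := by
      have hvec : Matrix.vecMul (fun j => aeval h.coord (pderiv j u)) h.jacMatrix = 0 := by
        funext i
        have h1 := PolyEnd.pderiv_bind h.coord u i
        change pderiv i (aeval h.coord u) = ∑ j, aeval h.coord (pderiv j u) * _ at h1
        rw [h0, map_zero] at h1
        simpa [Matrix.vecMul, dotProduct, PolyEnd.jacMatrix] using h1.symm
      have hz := Matrix.eq_zero_of_vecMul_eq_zero hj hvec
      intro j
      by_contra hd
      exact ih _ (totalDegree_pderiv_lt hd) hd rfl (congrFun hz j)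
    obtain ⟨p, hp⟩ := CharP.exists K
    rcases CharP.char_is_prime_or_zero K p with hp' | rfl
    · have : Fact p.Prime := ⟨hp'⟩
      obtain ⟨w, rfl⟩ := exists_pow_eq_of_pderiv_eq_zero p u hder
      have hw : w ≠ 0 := by rintro rfl; exact hu (zero_pow hp'.ne_zero)
      rw [map_pow] at h0
      refine ih w.totalDegree ?_ hw rfl (pow_eq_zero_iff hp'.ne_zero |>.mp h0)
      have hpow : (w ^ p).totalDegree = p * w.totalDegree := by
        have := map_pow (degVal (k := K) (σ := Fin n)) w p
        rw [degVal_of_ne_zero hw, degVal_of_ne_zero hu, ← exp_nsmul, exp_inj, nsmul_eq_mul] at this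
        exact_mod_cast this
      rw [hpow] at hdeg ⊢
      have := hp'.two_le
      have h3 : 0 < w.totalDegree := Nat.pos_of_ne_zero fun h => hdeg (by rw [h, mul_zero])
      nlinarith
    · have : CharZero K := CharP.charP_to_charZero K
      apply hdeg
      have : ∀ m ∈ u.support, m = 0 := by
        intro m hm
        by_contra hm0
        obtain ⟨j, hj⟩ : ∃ j, m j ≠ 0 := by
          by_contra! hall
          exact hm0 (Finsupp.ext hall)
        have hle : Finsupp.single j 1 ≤ m := by
          rw [Finsupp.single_le_iff]; omega
        have h1 := congrArg (coeff (m - Finsupp.single j 1)) (hder j)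
        rw [coeff_pderiv, tsub_add_cancel_of_le hle, coeff_zero] at h1
        rcases mul_eq_zero.mp h1 with h2 | h2
        · exact (mem_support_iff.mp hm) h2
        · exact absurd h2 (Nat.cast_add_one_ne_zero _)
      refine Nat.le_zero.mp (Finset.sup_le fun m hm => ?_)
      simp [this m hm]

theorem aeval_coord_ne_zero {n : ℕ} {K : Type*} [Field K] {h : PolyEnd n K} (hj : h.jac ≠ 0)
    {u : MvPolynomial (Fin n) K} (hu : u ≠ 0) : aeval h.coord u ≠ 0 := by
  let φ := algebraMap K (AlgebraicClosure K)
  have hφ : Function.Injective (MvPolynomial.map (σ := Fin n) φ) :=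
    MvPolynomial.map_injective φ φ.injective
  have hj' : (PolyEnd.map φ h).jac ≠ 0 := by
    rw [PolyEnd.jac_map]
    exact (map_ne_zero_iff _ hφ).mpr hj
  have := aeval_coord_ne_zero_of_isAlgClosed hj' ((map_ne_zero_iff _ hφ).mpr hu)
  intro h0
  apply this
  have e := MvPolynomial.map_bind₁ φ h.coord u
  change _ = bind₁ (PolyEnd.map φ h).coord _ at e
  change MvPolynomial.map φ (aeval h.coord u) = aeval _ _ at e
  rw [← e, h0, map_zero]

end Jacobian

/-! ### Valuative limits of conjugates of a Hénon map -/

section ValuativeLimit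

open MvPolynomial IsLocalRing

variable {K : Type*} [Field K] (O : ValuationSubring K)

/-- Content of a polynomial over a valuation ring: `p = c q`, where `q` is integral and nonzero
modulo the maximal ideal. -/
theorem exists_eq_C_mul_map {σ : Type*} {p : MvPolynomial σ K} (hp : p ≠ 0) :
    ∃ (c : K) (q : MvPolynomial σ O), c ≠ 0 ∧ p = C c * MvPolynomial.map (algebraMap O K) q ∧
      MvPolynomial.map (residue O) q ≠ 0 := by
  classical
  obtain ⟨m, hm, hmax⟩ := Finset.exists_max_image p.support (fun m => O.valuation (coeff m p))
    (support_nonempty.mpr hp)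
  have hc : coeff m p ≠ 0 := mem_support_iff.mp hm
  have hle : ∀ m', O.valuation (coeff m' p) ≤ O.valuation (coeff m p) := by
    intro m'
    by_cases h : m' ∈ p.support
    · exact hmax m' h
    · rw [notMem_support_iff.mp h, map_zero]
      exact zero_le
  have hint : C (coeff m p)⁻¹ * p ∈ Set.range (MvPolynomial.map (σ := σ) (algebraMap O K)) := by
    rw [mem_range_map_iff_coeffs_subset]
    intro c hc'
    obtain ⟨m', -, rfl⟩ := mem_coeffs_iff.mp hc'
    rw [coeff_C_mul]
    refine ⟨⟨(coeff m p)⁻¹ * coeff m' p, ?_⟩, rfl⟩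
    rw [← O.valuation_le_one_iff, map_mul, map_inv₀]
    exact inv_mul_le_one_of_le₀ (hle m') zero_le
  obtain ⟨q, hq⟩ := hint
  refine ⟨coeff m p, q, hc, ?_, fun h0 => ?_⟩
  · rw [hq, ← mul_assoc, ← C_mul, mul_inv_cancel₀ hc, C_1, one_mul]
  · have h1 := congrArg (coeff m) h0
    rw [coeff_map, coeff_zero] at h1
    have h2 := congrArg (coeff m) hq
    rw [coeff_map, coeff_C_mul, inv_mul_cancel₀ hc] at h2
    have h3 : coeff m q = 1 := Subtype.ext h2
    rw [h3, map_one] at h1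
    exact one_ne_zero h1

theorem valuation_aeval_le_one {σ : Type*} (q : MvPolynomial σ O) {P : σ → K}
    (hP : ∀ i, O.valuation (P i) ≤ 1) :
    O.valuation (aeval P (MvPolynomial.map (algebraMap O K) q)) ≤ 1 := by
  choose P' hP' using fun i => (O.valuation_le_one_iff (P i)).mp (hP i) |> fun h =>
    (⟨⟨P i, h⟩, rfl⟩ : ∃ x : O, algebraMap O K x = P i)
  obtain rfl : (fun i => algebraMap O K (P' i)) = P := funext hP'
  rw [aeval_map_algebraMap]
  change O.valuation (aeval (algebraMap O K ∘ P') q) ≤ 1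
  rw [aeval_algebraMap_apply]
  exact O.valuation_le_one _

variable {k : Type*} [Field k] [Algebra k K] [Algebra k O] [IsScalarTower k O K]

theorem valuation_algebraMap_eq_one (c : k) (hc : c ≠ 0) : O.valuation (algebraMap k K c) = 1 := by
  rw [IsScalarTower.algebraMap_apply k O K]
  have : IsUnit (algebraMap k O c) := (Ne.isUnit hc).map _
  exact (O.valuation_eq_one_iff _).mp this

theorem exists_point_valuation_eq_one [Infinite k] {σ : Type*} {q : MvPolynomial σ O}
    (hq : MvPolynomial.map (residue O) q ≠ 0) :
    ∃ P : σ → k, O.valuation (aeval (fun i => algebraMap k K (P i))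
      (MvPolynomial.map (algebraMap O K) q)) = 1 := by
  by_contra! hcon
  apply hq
  refine funext_set (fun _ => Set.range (algebraMap k (ResidueField O)))
    (fun _ => Set.infinite_range_of_injective (algebraMap k (ResidueField O)).injective) ?_
  intro x hx
  choose P hP using fun i => hx i (Set.mem_univ i)
  obtain rfl : (fun i => algebraMap k (ResidueField O) (P i)) = x := funext hP
  have h1 := hcon P
  have e : aeval (fun i => algebraMap k K (P i)) (MvPolynomial.map (algebraMap O K) q) =
      algebraMap O K (aeval (fun i => algebraMap k O (P i)) q) := by
    rw [aeval_map_algebraMap, ← aeval_algebraMap_apply]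
    congr 2
    exact funext fun i => IsScalarTower.algebraMap_apply k O K (P i)
  rw [e] at h1
  have h2 : ¬ IsUnit (aeval (fun i => algebraMap k O (P i)) q) := fun h =>
    h1 ((O.valuation_eq_one_iff _).mp h)
  rw [map_zero, MvPolynomial.eval_map]
  have h3 : residue O (aeval (fun i => algebraMap k O (P i)) q) = 0 := by
    rwa [residue_eq_zero_iff, mem_maximalIdeal, mem_nonunits_iff]
  rw [← h3, aeval_def, hom_eval₂]
  congr 1

/-- If the inverse of an automorphism over the fraction field of a valuation ring is integral, then
so is the automorphism: otherwise the components of the inverse would satisfy an algebraic relation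
over the residue field. -/
theorem coeff_mem_range_of_inv_integral {n : ℕ} (G : SAut n K) (h' : PolyEnd n O)
    (hh' : PolyEnd.map (algebraMap O K) h' = ((G⁻¹ : SAut n K) : PolyAut n K).val)
    (hne : ∀ i, (G : PolyAut n K).val.coord i ≠ 0) (i : Fin n) (m : Fin n →₀ ℕ) :
    coeff m ((G : PolyAut n K).val.coord i) ∈ Set.range (algebraMap O K) := by
  have hinj : Function.Injective (algebraMap O K) := Subtype.val_injective
  have hjac : (PolyEnd.map (residue O) h').jac ≠ 0 := by
    have : h'.jac = 1 := by
      apply MvPolynomial.map_injective _ hinj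
      rw [map_one, ← PolyEnd.jac_map, hh']
      exact (G⁻¹ : SAut n K).2
    rw [PolyEnd.jac_map, this, map_one]
    exact one_ne_zero
  obtain ⟨d, p, hd, hdp, hp⟩ := exists_eq_C_mul_map O (hne i)
  by_cases hdle : O.valuation d ≤ 1
  · rw [hdp, coeff_C_mul, coeff_map]
    exact ⟨⟨d, (O.valuation_le_one_iff _).mp hdle⟩ * coeff m p, map_mul _ _ _⟩
  exfalso
  push Not at hdle
  have hdinv : O.valuation d⁻¹ < 1 := by
    rw [map_inv₀]
    exact inv_lt_one_of_one_lt₀ hdle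
  let e : O := ⟨d⁻¹, (O.valuation_le_one_iff _).mp hdinv.le⟩
  have he : residue O e = 0 := by
    rw [residue_eq_zero_iff]
    exact (O.valuation_lt_one_iff e).mpr hdinv
  have hrel : aeval h'.coord p = C e * X i := by
    apply MvPolynomial.map_injective _ hinj
    have e1 := MvPolynomial.map_bind₁ (algebraMap O K) h'.coord p
    change MvPolynomial.map _ (aeval h'.coord p) =
      aeval (PolyEnd.map (algebraMap O K) h').coord _ at e1
    rw [e1, hh', map_mul, map_C, map_X]
    have e2 : aeval ((G⁻¹ : SAut n K) : PolyAut n K).val.coord ((G : PolyAut n K).val.coord i) =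
        X i := by
      rw [← PolyEnd.mul_coord_aeval]
      exact congrArg (fun f : PolyEnd n K => f.coord i) (Units.mul_inv (G : PolyAut n K))
    rw [hdp, map_mul, ← algebraMap_eq, AlgHom.commutes, algebraMap_eq] at e2
    rw [← e2, ← mul_assoc, ← C_mul]
    change _ = C (d⁻¹ * d) * _
    rw [inv_mul_cancel₀ hd, C_1, one_mul]
  refine aeval_coord_ne_zero hjac hp ?_
  have e1 := MvPolynomial.map_bind₁ (residue O) h'.coord p
  change MvPolynomial.map _ (aeval h'.coord p) = aeval (PolyEnd.map (residue O) h').coord _ at e1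
  rw [← e1, hrel, map_mul, map_C, he, C_0, zero_mul]

/-- If `h` conjugates a Hénon map `H` to an integral automorphism, then `h` is integral: `h F = H h`
and `h F⁻¹ = H⁻¹ h`, and one of `H`, `H⁻¹` expands a point `h(P)` whose size is the content
of `h`. -/
theorem content_le_one_of_conj_rotProd [Infinite k] {l : List (SAut 2 k)} (hne : l ≠ [])
    (hl : ∀ b ∈ l, IsNonaffineTri b) (F : PolyAut 2 O) (h : SAut 2 K)
    (hF : ((h⁻¹ * SAut.map (algebraMap k K) (rotProd l) * h : SAut 2 K) : PolyAut 2 K) =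
      PolyAut.map (algebraMap O K) F) {c : Fin 2 → K} {q : Fin 2 → MvPolynomial (Fin 2) O}
    (hcq : ∀ i, (h : PolyAut 2 K).val.coord i = C (c i) * MvPolynomial.map (algebraMap O K) (q i))
    (hq : ∀ i, MvPolynomial.map (residue O) (q i) ≠ 0) (j : Fin 2) : O.valuation (c j) ≤ 1 := by
  have hv : ∀ c : k, c ≠ 0 → O.valuation (algebraMap k K c) = 1 := valuation_algebraMap_eq_one O
  have hvk : ∀ c : k, O.valuation (algebraMap k K c) ≤ 1 := fun c => by
    rw [IsScalarTower.algebraMap_apply k O K]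
    exact O.valuation_le_one _
  obtain ⟨H, hH⟩ : ∃ H : SAut 2 K, H = SAut.map (algebraMap k K) (rotProd l) := ⟨_, rfl⟩
  rw [← hH] at hF
  have hHact : ∀ Q : Fin 2 → K, (H : PolyAut 2 K).val.act Q = (rotProd l : PolyAut 2 k).val.act Q :=
    fun Q => by
      rw [hH]
      exact PolyEnd.act_map _ Q
  have hHact' : ∀ Q : Fin 2 → K, ((H⁻¹ : SAut 2 K) : PolyAut 2 K).val.act Q =
      (((rotProd l)⁻¹ : SAut 2 k) : PolyAut 2 k).val.act Q := fun Q => by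
    rw [hH, ← map_inv]
    exact PolyEnd.act_map _ Q
  have hint : ∀ (P : Fin 2 → K), (∀ i, O.valuation (P i) ≤ 1) → ∀ i,
      O.valuation ((h : PolyAut 2 K).val.act P i) ≤ O.valuation (c i) := by
    intro P hP i
    rw [PolyEnd.act_apply, hcq i, map_mul, map_mul, aeval_C]
    exact mul_le_of_le_one_right' (valuation_aeval_le_one O (q i) hP)
  have hFint : ∀ (F : PolyAut 2 O) (P : Fin 2 → K), (∀ i, O.valuation (P i) ≤ 1) → ∀ i,
      O.valuation ((PolyAut.map (algebraMap O K) F).val.act P i) ≤ 1 := fun F P hP i =>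
    valuation_aeval_le_one O _ hP
  obtain ⟨i, hi⟩ : ∃ i, ∀ j, O.valuation (c j) ≤ O.valuation (c i) := by
    obtain ⟨i, -, hi⟩ := Finset.exists_max_image Finset.univ (fun i => O.valuation (c i))
      Finset.univ_nonempty
    exact ⟨i, fun j => hi j (Finset.mem_univ j)⟩
  refine (hi j).trans ?_
  by_contra! hlarge
  obtain ⟨P, hP⟩ := exists_point_valuation_eq_one (k := k) O (hq i)
  have hPint : ∀ i, O.valuation (algebraMap k K (P i)) ≤ 1 := fun i => hvk _
  generalize hP' : (fun i => algebraMap k K (P i)) = P' at hP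
  replace hPint : ∀ i, O.valuation (P' i) ≤ 1 := by rw [← hP']; exact hPint
  clear hP'
  obtain ⟨Q, hQ⟩ : ∃ Q, Q = (h : PolyAut 2 K).val.act P' := ⟨_, rfl⟩
  have hQi : O.valuation (Q i) = O.valuation (c i) := by
    rw [hQ, PolyEnd.act_apply, hcq i, map_mul, map_mul, aeval_C, hP, mul_one]
    rfl
  have hQj : ∀ j, O.valuation (Q j) ≤ O.valuation (c i) := fun j => by
    rw [hQ]
    exact (hint _ hPint j).trans (hi j)
  have hsq : O.valuation (c i) < O.valuation (c i) ^ 2 := by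
    have := pow_lt_pow_right₀ hlarge one_lt_two
    rwa [pow_one] at this
  have e1 : (rotProd l : PolyAut 2 k).val.act Q =
      (h : PolyAut 2 K).val.act ((PolyAut.map (algebraMap O K) F).val.act P') := by
    have : H * h = h * (h⁻¹ * H * h) := by group
    rw [← hHact, hQ, ← hF, ← SAut.act_mul, ← SAut.act_mul, this]
  have e2 : (((rotProd l)⁻¹ : SAut 2 k) : PolyAut 2 k).val.act Q =
      (h : PolyAut 2 K).val.act ((PolyAut.map (algebraMap O K) F⁻¹).val.act P') := by
    have : H⁻¹ * h = h * (h⁻¹ * H * h)⁻¹ := by group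
    rw [← hHact', hQ, map_inv, ← hF, ← Subgroup.coe_inv, ← SAut.act_mul, ← SAut.act_mul, this]
  rcases le_total (O.valuation (Q 0)) (O.valuation (Q 1)) with hle | hle
  · have h1 : O.valuation (Q 1) = O.valuation (c i) := by
      refine le_antisymm (hQj 1) ?_
      rw [← hQi]
      fin_cases i
      · exact hle
      · exact le_rfl
    have h2 := (rotProd_expands (v := O.valuation) hv hne hl (h1 ▸ hlarge) hle).2
    rw [e1, h1] at h2
    exact absurd (h2.trans ((hint _ (hFint F _ hPint) 1).trans (hi 1))) (not_le.mpr hsq)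
  · have h1 : O.valuation (Q 0) = O.valuation (c i) := by
      refine le_antisymm (hQj 0) ?_
      rw [← hQi]
      fin_cases i
      · exact le_rfl
      · exact hle
    have h2 := (rotProd_inv_expands (v := O.valuation) hv hne hl (h1 ▸ hlarge) hle).2
    rw [e2, h1] at h2
    exact absurd (h2.trans ((hint _ (hFint F⁻¹ _ hPint) 0).trans (hi 0))) (not_le.mpr hsq)

/-- The valuative limit of a family of conjugates of a Hénon map is again a conjugate. -/
theorem exists_residue_conj_rotProd [Infinite k] {l : List (SAut 2 k)} (hne : l ≠ [])
    (hl : ∀ b ∈ l, IsNonaffineTri b) (F : PolyAut 2 O) (G : SAut 2 K)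
    (hF : ((G * SAut.map (algebraMap k K) (rotProd l) * G⁻¹ : SAut 2 K) : PolyAut 2 K) =
      PolyAut.map (algebraMap O K) F) :
    ∃ g : SAut 2 (ResidueField O),
      ((g * SAut.map (algebraMap k (ResidueField O)) (rotProd l) * g⁻¹ : SAut 2 (ResidueField O)) :
        PolyAut 2 (ResidueField O)) = PolyAut.map (residue O) F := by
  have hinj : Function.Injective (algebraMap O K) := Subtype.val_injective
  choose c q hc hcq hq using fun i =>
    exists_eq_C_mul_map O (coord_ne_zero ((G⁻¹ : SAut 2 K) : PolyAut 2 K) i)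
  have hcle := content_le_one_of_conj_rotProd O hne hl F G⁻¹ (by rw [inv_inv]; exact hF) hcq hq
  let c' : Fin 2 → O := fun i => ⟨c i, (O.valuation_le_one_iff _).mp (hcle i)⟩
  have hh' : PolyEnd.map (algebraMap O K) ⟨fun i => C (c' i) * q i⟩ =
      ((G⁻¹ : SAut 2 K) : PolyAut 2 K).val :=
    PolyEnd.ext (funext fun i => by
      rw [PolyEnd.map_coord, map_mul, map_C, hcq i]
      rfl)
  obtain ⟨G', hG'⟩ := SAut.exists_map_eq hinj G
    (coeff_mem_range_of_inv_integral O G _ hh' (coord_ne_zero _)) (fun i m => by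
      rw [← hh', PolyEnd.map_coord, coeff_map]
      exact ⟨_, rfl⟩)
  have hconj : ((G' * SAut.map (algebraMap k O) (rotProd l) * G'⁻¹ : SAut 2 O) : PolyAut 2 O) =
      F := by
    apply Units.ext
    apply PolyEnd.map_injective hinj
    have e1 : SAut.map (algebraMap O K) (G' * SAut.map (algebraMap k O) (rotProd l) * G'⁻¹) =
        G * SAut.map (algebraMap k K) (rotProd l) * G⁻¹ := by
      rw [map_mul, map_mul, map_inv, hG', SAut.map_map, ← IsScalarTower.algebraMap_eq]
    exact (congrArg (fun f : SAut 2 K => (f : PolyAut 2 K).val) e1).trans (congrArg Units.val hF)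
  refine ⟨SAut.map (residue O) G', ?_⟩
  have e2 : (algebraMap k (ResidueField O)) = (residue O).comp (algebraMap k O) := rfl
  rw [← hconj, ← SAut.coe_map, map_mul, map_mul, map_inv, SAut.map_map, e2]

end ValuativeLimit

/-! ### Conjugacy classes of non-algebraic automorphisms -/

section HenonClosed

open MvPolynomial IsLocalRing

/-- If a point of `B` is a limit of the points indexed by `I`, the product of the evaluations at the
points of `I` has a quotient field in which the functions not vanishing at the point stay
nonzero. -/
theorem exists_field_of_limit {I k B : Type*} [Field k] [CommRing B] (φ : B →+* (I → k))
    (p : Ideal B) [p.IsPrime] (h : ∀ b ∉ p, φ b ≠ 0) :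
    ∃ (K : Type max u_1 u_2) (_ : Field K) (θ : (I → k) →+* K), ∀ b ∉ p, θ (φ b) ≠ 0 := by
  obtain ⟨M, hM, -, hdisj⟩ := Ideal.exists_le_prime_disjoint (⊥ : Ideal (I → k))
    (p.primeCompl.map φ) (by
      rw [Set.disjoint_left]
      rintro _ h0 ⟨b, hb, rfl⟩
      exact h b hb h0)
  refine ⟨FractionRing ((I → k) ⧸ M), inferInstance,
    (algebraMap ((I → k) ⧸ M) _).comp (Ideal.Quotient.mk M), fun b hb => ?_⟩
  rw [RingHom.comp_apply, map_ne_zero_iff _ (IsFractionRing.injective _ _), ne_eq,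
    Ideal.Quotient.eq_zero_iff_mem]
  exact fun hmem => Set.disjoint_left.mp hdisj hmem ⟨b, hb, rfl⟩

/-- If the values of a family at points close to `ev₀` are special automorphisms, so is the value at
`ev₀`. -/
theorem mem_SAut_of_limit {n : ℕ} {k B : Type*} [Field k] [CommRing B] [Algebra k B]
    (F : PolyAut n B) (ev₀ : B →ₐ[k] k) (hlim : ∀ b, ev₀ b ≠ 0 → ∃ ev : B →ₐ[k] k,
      PolyAut.map ev.toRingHom F ∈ SAut n k ∧ ev b ≠ 0) :
    PolyAut.map ev₀.toRingHom F ∈ SAut n k := by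
  have hjac : ∀ ev : B →ₐ[k] k, PolyAut.map ev.toRingHom F ∈ SAut n k ↔
      ∀ m, ev (coeff m (F.val.jac - 1)) = 0 := by
    intro ev
    rw [mem_SAut]
    have e : (PolyAut.map ev.toRingHom F).val.jac = MvPolynomial.map ev.toRingHom F.val.jac :=
      PolyEnd.jac_map _ _
    rw [e, ← sub_eq_zero, ← map_one (MvPolynomial.map ev.toRingHom), ← map_sub,
        MvPolynomial.ext_iff]
    simp only [coeff_map, coeff_zero]
    rfl
  rw [hjac]
  intro m
  by_contra hne
  obtain ⟨ev, hev, hev'⟩ := hlim _ hne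
  exact hev' ((hjac ev).mp hev m)

/-- Let `ev₀` be a limit of points at which the values of the family `F` are conjugate to `H` by
automorphisms of bounded degree. Then a valuation ring `O` dominates the local ring at `ev₀`, such
that over its quotient field `F` is conjugate to `H`. -/
theorem exists_valuationSubring_of_limit {n : ℕ} {k B : Type u} [Field k] [CommRing B] [Algebra k B]
    (H : SAut n k) (A : ℕ)
    (hdeg : ∀ F' : SAut n k, IsConj H F' → ∃ g : SAut n k, g * H * g⁻¹ = F' ∧
      (g : PolyAut n k).val.degree ≤ A * (F' : PolyAut n k).val.degree ∧
      ((g⁻¹ : SAut n k) : PolyAut n k).val.degree ≤ A * (F' : PolyAut n k).val.degree)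
    (F : PolyAut n B) (ev₀ : B →ₐ[k] k) (hlim : ∀ b, ev₀ b ≠ 0 → ∃ ev : B →ₐ[k] k,
      (∃ F' : SAut n k, IsConj H F' ∧ (F' : PolyAut n k) = PolyAut.map ev.toRingHom F) ∧ ev b ≠ 0) :
    ∃ (K : Type u) (_ : Field K) (_ : Algebra k K) (O : ValuationSubring K) (_ : Algebra k O)
      (_ : IsScalarTower k O K) (β : B →+* O) (G : SAut n K),
      ((G * SAut.map (algebraMap k K) H * G⁻¹ : SAut n K) : PolyAut n K) =
        PolyAut.map (algebraMap O K) (PolyAut.map β F) ∧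
      (residue O).comp β = (algebraMap k (ResidueField O)).comp ev₀.toRingHom := by
  let I := {ev : B →ₐ[k] k // ∃ F' : SAut n k, IsConj H F' ∧
    (F' : PolyAut n k) = PolyAut.map ev.toRingHom F}
  choose F' hF'conj hF' using fun i : I => i.2
  choose g hg hgd hgd' using fun i : I => hdeg _ (hF'conj i)
  have hdeg : ∀ i, (F' i : PolyAut n k).val.degree ≤ F.val.degree := fun i => by
    rw [hF' i]
    exact PolyEnd.degree_map_le _ _
  obtain ⟨G, hG⟩ := SAut.exists_pi g (A * F.val.degree)
    (fun i => (hgd i).trans (Nat.mul_le_mul_left _ (hdeg i)))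
    (fun i => (hgd' i).trans (Nat.mul_le_mul_left _ (hdeg i)))
  let φ : B →+* (I → k) := RingHom.pi fun i : I => i.1.toRingHom
  have hφ : ∀ i : I, (Pi.evalRingHom (fun _ => k) i).comp φ = i.1.toRingHom := fun i => rfl
  have hφk : φ.comp (algebraMap k B) = algebraMap k (I → k) :=
    RingHom.ext fun c => funext fun i => i.1.commutes c
  have hGF : ((G * SAut.map (algebraMap k (I → k)) H * G⁻¹ : SAut n (I → k)) :
      PolyAut n (I → k)) = PolyAut.map φ F := by
    refine Units.ext (PolyEnd.ext_pi fun i => ?_)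
    have e1 : SAut.map (Pi.evalRingHom (fun _ => k) i)
        (G * SAut.map (algebraMap k (I → k)) H * G⁻¹) = F' i := by
      have e0 : (Pi.evalRingHom (fun _ => k) i).comp (algebraMap k (I → k)) = RingHom.id k := rfl
      rw [map_mul, map_mul, map_inv, hG, SAut.map_map, e0, SAut.map_id, hg]
    have e2 : PolyAut.map (Pi.evalRingHom (fun _ => k) i) (PolyAut.map φ F) =
        PolyAut.map i.1.toRingHom F := by
      rw [PolyAut.map_map, hφ]
    exact (congrArg (fun f : SAut n k => (f : PolyAut n k).val) e1).trans
      (congrArg Units.val ((hF' i).trans e2.symm))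
  let p₀ : Ideal B := RingHom.ker ev₀.toRingHom
  have hp₀ : p₀.IsPrime := RingHom.ker_isPrime _
  have hmem : ∀ b, b ∉ p₀ ↔ ev₀ b ≠ 0 := fun b => Iff.rfl
  obtain ⟨K, _, θ, hθ⟩ := exists_field_of_limit φ p₀ fun b hb h0 => by
    obtain ⟨ev, ⟨F'', h1, h2⟩, hne⟩ := hlim b ((hmem b).mp hb)
    exact hne (congrFun h0 (⟨ev, F'', h1, h2⟩ : I))
  let ρ : Localization.AtPrime p₀ →+* K :=
    IsLocalization.lift (M := p₀.primeCompl) (g := θ.comp φ) fun b => (hθ b b.2).isUnit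
  have hρ : ∀ b, ρ (algebraMap B _ b) = θ (φ b) := fun b => IsLocalization.lift_eq _ b
  obtain ⟨O, hO, hloc⟩ := IsLocalRing.exists_factor_valuationRing ρ
  let ρ' : Localization.AtPrime p₀ →+* O := ρ.codRestrict O.toSubring hO
  let βO : B →+* O := ρ'.comp (algebraMap B _)
  let _ : Algebra k K := (θ.comp (algebraMap k (I → k))).toAlgebra
  let _ : Algebra k O := (βO.comp (algebraMap k B)).toAlgebra
  have hβK : (algebraMap O K).comp βO = θ.comp φ := RingHom.ext hρ
  have hST : IsScalarTower k O K := IsScalarTower.of_algebraMap_eq' (by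
    change θ.comp (algebraMap k (I → k)) = (algebraMap O K).comp (βO.comp (algebraMap k B))
    rw [← RingHom.comp_assoc, hβK, RingHom.comp_assoc, hφk])
  have hres : (residue O).comp βO = (algebraMap k (ResidueField O)).comp ev₀.toRingHom := by
    ext b
    have h1 : b - algebraMap k B (ev₀ b) ∈ p₀ := by
      change ev₀ _ = 0
      rw [map_sub, AlgHom.commutes]
      exact sub_self _
    have h2 : residue O (βO (b - algebraMap k B (ev₀ b))) = 0 := by
      rw [residue_eq_zero_iff]
      have h3 : algebraMap B (Localization.AtPrime p₀) (b - algebraMap k B (ev₀ b)) ∈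
          maximalIdeal (Localization.AtPrime p₀) :=
        (IsLocalization.AtPrime.to_map_mem_maximal_iff _ p₀ _).mpr h1
      have : IsLocalHom ρ' := hloc
      exact map_nonunit ρ' _ h3
    rw [map_sub, map_sub, sub_eq_zero] at h2
    exact h2
  refine ⟨K, inferInstance, inferInstance, O, inferInstance, hST, βO, SAut.map θ G, Eq.symm ?_,
      hres⟩
  rw [PolyAut.map_map, hβK, ← PolyAut.map_map, ← hGF, ← SAut.coe_map, map_mul, map_mul, map_inv,
    SAut.map_map]
  rfl

/-- Hénon maps have closed conjugacy classes: the degree bound on conjugators together with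
`exists_residue_conj_rotProd` verifies the hypothesis of `isClosed_of_forall_family`. -/
theorem isClosed_conj_rotProd {k : Type u} [Field k] [IsAlgClosed k] {l : List (SAut 2 k)}
    (hne : l ≠ []) (hl : ∀ b ∈ l, IsNonaffineTri b) :
    IsClosed {F : PolyAut 2 k | ∃ F' : SAut 2 k,
        IsConj (rotProd l) F' ∧ (F' : PolyAut 2 k) = F} := by
  refine isClosed_of_forall_family ?_
  intro B _ _ _ F ev₀ hlim
  have hdH := one_le_degree (((rotProd l)⁻¹ : SAut 2 k) : PolyAut 2 k)
  obtain ⟨K, _, _, O, _, _, β, G, hG, hres⟩ := exists_valuationSubring_of_limit (rotProd l)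
    (((rotProd l)⁻¹ : SAut 2 k) : PolyAut 2 k).val.degree (fun F' hF' => by
      obtain ⟨g, hg, hgd, hgd'⟩ := exists_conj_degree_le_rotProd hne hl hF'
      exact ⟨g, hg, hgd.trans (Nat.le_mul_of_pos_left _ hdH), hgd'⟩) F ev₀ hlim
  obtain ⟨c, hc⟩ := exists_residue_conj_rotProd O hne hl (PolyAut.map β F) G hG
  rw [PolyAut.map_map, hres, ← PolyAut.map_map] at hc
  have hjac : PolyAut.map ev₀.toRingHom F ∈ SAut 2 k := mem_SAut_of_limit F ev₀ fun b hb => by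
    obtain ⟨ev, ⟨F', -, hF'⟩, hev⟩ := hlim b hb
    exact ⟨ev, hF' ▸ F'.2, hev⟩
  refine ⟨⟨_, hjac⟩, isConj_of_isConj_map (K := ResidueField O) (isConj_iff.mpr ⟨c, ?_⟩), rfl⟩
  exact Subtype.ext hc

/-- A set of special automorphisms is closed if its image in `Aut(𝔸ⁿ)` is. -/
theorem isClosed_of_isClosed_image {n : ℕ} {k : Type u} [Field k] {S : Set (SAut n k)}
    (h : IsClosed {F : PolyAut n k | ∃ F' ∈ S, (F' : PolyAut n k) = F}) : IsClosed S := by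
  refine isClosed_induced_iff.mpr ⟨_, h, ?_⟩
  ext f
  constructor
  · rintro ⟨f', hf', e⟩
    rwa [← Subtype.ext e]
  · exact fun hf => ⟨f, hf, rfl⟩

theorem isClosed_conjugatesOf_of_not_isAlgebraicAut {k : Type u} [Field k] [IsAlgClosed k]
    {f : SAut 2 k} (hf : ¬ IsAlgebraicAut (f : PolyAut 2 k)) : IsClosed (conjugatesOf f) := by
  obtain ⟨l, hne, hl, hconj⟩ := exists_rotProd_of_not_isAlgebraicAut hf
  refine isClosed_of_isClosed_image ?_
  convert isClosed_conj_rotProd hne hl using 3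
  rw [isConj_iff_conjugatesOf_eq.mp hconj]
  rfl

end HenonClosed

/-! ### Degenerations of triangular maps -/

section Degeneration

open MvPolynomial

theorem map_polynomial_aeval {σ R S : Type*} [CommRing R] [CommRing S] (φ : R →+* S)
    (x : MvPolynomial σ R) (p : Polynomial R) :
    MvPolynomial.map φ (Polynomial.aeval x p) =
      Polynomial.aeval (MvPolynomial.map φ x) (p.map φ) := by
  rw [Polynomial.aeval_def, Polynomial.aeval_def, Polynomial.hom_eval₂, Polynomial.eval₂_map]
  congr 1
  ext r : 1
  simp [algebraMap_eq]

theorem map_tri {R S : Type*} [CommRing R] [CommRing S] (φ : R →+* S) (α : Rˣ) (p : Polynomial R)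
    (c : R) : SAut.map φ (tri α p c) = tri (Units.map φ α) (p.map φ) (φ c) := by
  refine SAut.ext_end (PolyEnd.ext_two ?_ ?_)
  · rw [SAut.map_coord, tri_val, tri_val, triEnd_coord_zero, triEnd_coord_zero, map_add, map_mul,
      map_polynomial_aeval, map_C, map_X, map_X]
    rfl
  · rw [SAut.map_coord, tri_val, tri_val, triEnd_coord_one, triEnd_coord_one, map_add, map_mul,
      map_C, map_X, map_C, ← map_inv]
    rfl

variable {k : Type*} [Field k]

theorem isDiagonalisable_tri_zero (α : kˣ) :
    IsDiagonalisable (tri α 0 0 : PolyAut 2 k) := by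
  refine ⟨1, ![(α : k), ((α⁻¹ : kˣ) : k)], Fin.forall_fin_two.mpr ⟨?_, ?_⟩⟩
  · rw [one_mul, inv_one, mul_one, tri_val, triEnd_coord_zero]
    simp
  · rw [one_mul, inv_one, mul_one, tri_val, triEnd_coord_one]
    simp

theorem IsDiagonalisable.of_isConj {n : ℕ} {R : Type*} [CommRing R] {f g : PolyAut n R}
    (hf : IsDiagonalisable f) (h : IsConj f g) : IsDiagonalisable g := by
  obtain ⟨c, rfl⟩ := isConj_iff.mp h
  obtain ⟨d, a, hd⟩ := hf
  refine ⟨d * c⁻¹, a, ?_⟩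
  have : d * c⁻¹ * (c * f * c⁻¹) * (d * c⁻¹)⁻¹ = d * f * d⁻¹ := by group
  rwa [this]

/-- Conjugation of a triangular map by a diagonal one. -/
theorem isConj_tri_diag (α τ : kˣ) (p : Polynomial k) (c : k) :
    IsConj (tri α p c)
      (tri α (Polynomial.C (τ : k) * p.comp (Polynomial.C (τ : k) * Polynomial.X))
        (((τ⁻¹ : kˣ) : k) * c)) := by
  refine isConj_iff.mpr ⟨tri τ 0 0, ?_⟩
  rw [mul_inv_eq_iff_eq_mul, tri_mul, tri_mul]
  congr 1
  · rw [mul_comm]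
  · simp only [Polynomial.zero_comp, add_zero, mul_zero, zero_add, Polynomial.mul_comp,
      Polynomial.C_comp, Polynomial.comp_assoc, Polynomial.X_comp, map_zero]
    rw [← mul_assoc (Polynomial.C _) (Polynomial.C _), ← Polynomial.C_mul, Units.mul_inv,
      Polynomial.C_1, one_mul, Polynomial.comp_X]
  · simp

/-- A triangular map without translation part is a member of a family with diagonal limit. -/
theorem exists_family_tri_zero (α : kˣ) (p : Polynomial k) :
    ∃ F : SAut 2 (Polynomial k), (∀ t : k, t ≠ 0 → IsConj (tri α p 0) (SAut.value F t)) ∧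
      IsDiagonalisable (SAut.value F 0 : PolyAut 2 k) := by
  obtain ⟨F, hF⟩ : ∃ F, F = tri (Units.map (Polynomial.C : k →+* Polynomial k).toMonoidHom α)
      (Polynomial.C Polynomial.X *
        (p.map Polynomial.C).comp (Polynomial.C Polynomial.X * Polynomial.X)) 0 := ⟨_, rfl⟩
  have hval : ∀ t : k, SAut.value F t =
      tri α (Polynomial.C t * p.comp (Polynomial.C t * Polynomial.X)) 0 := by
    intro t
    rw [hF, SAut.value, map_tri]
    congr 1
    · ext
      simp
    · have : (Polynomial.evalRingHom t).comp Polynomial.C = RingHom.id k := by ext; simp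
      simp [Polynomial.map_comp, Polynomial.map_map, this]
    · simp
  refine ⟨F, fun t ht => ?_, ?_⟩
  · rw [hval t]
    simpa using isConj_tri_diag α (Units.mk0 t ht) p 0
  · rw [hval 0]
    simpa using isDiagonalisable_tri_zero α

/-- Up to conjugation, a triangular map has no translation part, or is `(x + p(y), y + 1)`. -/
theorem IsTri.exists_isConj_normalized {b : SAut 2 k} (hb : IsTri b) :
    (∃ α p, IsConj b (tri α p 0)) ∨ ∃ p, IsConj b (tri 1 p 1) := by
  obtain ⟨α, p, c, rfl⟩ := hb
  by_cases hα : α = 1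
  · subst hα
    by_cases hc : c = 0
    · exact Or.inl ⟨1, p, by rw [hc]⟩
    · right
      have := isConj_tri_diag 1 (Units.mk0 c hc) p c
      rw [Units.val_inv_eq_inv_val, Units.val_mk0, inv_mul_cancel₀ hc] at this
      exact ⟨_, this⟩
  · left
    have hα' : 1 - ((α⁻¹ : kˣ) : k) ≠ 0 := by
      rw [sub_ne_zero]
      intro h
      exact hα (inv_eq_one.mp (Units.ext h.symm))
    obtain ⟨y, hy⟩ : ∃ y : k, y * (1 - ((α⁻¹ : kˣ) : k)) = c := ⟨c / _, div_mul_cancel₀ _ hα'⟩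
    refine ⟨α, p.comp (Polynomial.X + Polynomial.C y), isConj_iff.mpr ⟨tri 1 0 (-y), ?_⟩⟩
    rw [mul_inv_eq_iff_eq_mul, tri_mul, tri_mul]
    congr 1
    · rw [mul_comm]
    · simp [Polynomial.comp_assoc]
    · simp only [inv_one, Units.val_one]
      linear_combination -hy

/-- In characteristic zero, every polynomial is a difference `q(y + 1) - q(y)`. -/
theorem exists_comp_add_one_sub_eq [CharZero k] (p : Polynomial k) :
    ∃ q : Polynomial k, q.comp (Polynomial.X + 1) - q = p := by
  have key : ∀ n : ℕ, ∀ p : Polynomial k, p.natDegree < n →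
      ∃ q : Polynomial k, q.comp (Polynomial.X + 1) - q = p := by
    intro n
    induction n with
    | zero => intro p hp; omega
    | succ n ih =>
      intro p hp
      -- subtract the difference of a monomial with the right leading term
      obtain ⟨r, hr⟩ : ∃ r : Polynomial k, r = (Polynomial.X + 1) ^ (n + 1) - Polynomial.X ^ (n +
          1) :=
        ⟨_, rfl⟩
      have hrdeg : r.natDegree ≤ n ∧ r.coeff n = n + 1 := by
        have hc : ∀ j, r.coeff j = ((n + 1).choose j : k) - if j = n + 1 then 1 else 0 := fun j =>
            by
          rw [hr, Polynomial.coeff_sub, Polynomial.coeff_X_add_one_pow, Polynomial.coeff_X_pow]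
        constructor
        · rw [Polynomial.natDegree_le_iff_coeff_eq_zero]
          intro N hN
          rw [hc]
          rcases eq_or_ne N (n + 1) with rfl | hN'
          · simp
          · rw [Nat.choose_eq_zero_of_lt (by omega), if_neg hN']
            simp
        · rw [hc, if_neg (by omega), Nat.choose_succ_self_right]
          push_cast
          ring
      have hn : (n + 1 : k) ≠ 0 := by exact_mod_cast n.succ_ne_zero
      set a : k := p.coeff n / (n + 1) with ha
      have hdeg : p - Polynomial.C a * r = 0 ∨ (p - Polynomial.C a * r).natDegree < n := by
        rcases Nat.eq_zero_or_pos n with rfl | hn0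
        · left
          refine Polynomial.ext fun j => ?_
          rcases Nat.eq_zero_or_pos j with rfl | hj
          · rw [Polynomial.coeff_sub, Polynomial.coeff_C_mul, hrdeg.2, ha, div_mul_cancel₀ _ hn,
              sub_self, Polynomial.coeff_zero]
          · rw [Polynomial.coeff_sub, Polynomial.coeff_C_mul,
              Polynomial.coeff_eq_zero_of_natDegree_lt (p := p) (by omega),
              Polynomial.coeff_eq_zero_of_natDegree_lt (p := r) (by omega)]
            simp
        · right
          rw [Nat.lt_iff_le_pred hn0, Polynomial.natDegree_le_iff_coeff_eq_zero]
          intro j hj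
          rw [Polynomial.coeff_sub, Polynomial.coeff_C_mul]
          obtain rfl | hj' : j = n ∨ n < j := by omega
          · rw [hrdeg.2, ha, div_mul_cancel₀ _ hn, sub_self]
          · rw [Polynomial.coeff_eq_zero_of_natDegree_lt (p := p) (by omega),
              Polynomial.coeff_eq_zero_of_natDegree_lt (p := r) (by omega)]
            simp
      have hq : ∃ q : Polynomial k, q.comp (Polynomial.X + 1) - q = p - Polynomial.C a * r := by
        rcases hdeg with h | h
        · exact ⟨0, by rw [h]; simp⟩
        · exact ih _ h
      obtain ⟨q, hq⟩ := hq
      refine ⟨q + Polynomial.C a * Polynomial.X ^ (n + 1), ?_⟩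
      have : p = (p - Polynomial.C a * r) + Polynomial.C a * r := by ring
      rw [this, ← hq, hr]
      simp
      ring
  exact key _ p (Nat.lt_succ_self _)

theorem exists_family_translation_charZero [CharZero k] (p : Polynomial k) :
    ∃ F : SAut 2 (Polynomial k), (∀ t : k, t ≠ 0 → IsConj (tri 1 p 1) (SAut.value F t)) ∧
      IsDiagonalisable (SAut.value F 0 : PolyAut 2 k) := by
  obtain ⟨q, hq⟩ := exists_comp_add_one_sub_eq (-p)
  have hval : ∀ t : k, SAut.value (tri 1 0 Polynomial.X) t = tri 1 0 t := fun t => by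
    rw [SAut.value, map_tri]
    simp
  refine ⟨tri 1 0 Polynomial.X, fun t ht => ?_, ?_⟩
  · have h1 : IsConj (tri 1 p 1) (tri 1 0 (1 : k)) := by
      refine isConj_iff.mpr ⟨tri 1 q 0, ?_⟩
      rw [mul_inv_eq_iff_eq_mul, tri_mul, tri_mul]
      congr 1
      · simp only [inv_one, Units.val_one, Polynomial.C_1, one_mul, Polynomial.zero_comp, add_zero]
        linear_combination hq
      · simp
    refine h1.trans ?_
    have h2 := isConj_tri_diag 1 (Units.mk0 t ht)⁻¹ 0 1
    rw [hval]
    simpa using h2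
  · rw [hval]
    exact isDiagonalisable_tri_zero 1

end Degeneration

/-! ### Degeneration of the translation in positive characteristic -/

section Shear

open MvPolynomial

variable {R : Type*} [CommRing R]

/-- The additive polynomial `w = yᵖ + tᴺx`. -/
noncomputable def shearVar (p N : ℕ) (t : R) : MvPolynomial (Fin 2) R := X 1 ^ p + C (t ^ N) * X 0

/-- The endomorphism `(x - tᵃq(w)ᵖ, y + s + tᴱq(w))`, where `w = yᵖ + tᴺx`. -/
noncomputable def shearEnd (p a N E : ℕ) (t s : R) (q : Polynomial R) : PolyEnd 2 R :=
  ⟨![X 0 - C (t ^ a) * Polynomial.aeval (shearVar p N t) q ^ p,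
    X 1 + C s + C (t ^ E) * Polynomial.aeval (shearVar p N t) q]⟩

theorem shearEnd_coord_zero (p a N E : ℕ) (t s : R) (q : Polynomial R) :
    (shearEnd p a N E t s q).coord 0 =
      X 0 - C (t ^ a) * Polynomial.aeval (shearVar p N t) q ^ p := rfl

theorem shearEnd_coord_one (p a N E : ℕ) (t s : R) (q : Polynomial R) :
    (shearEnd p a N E t s q).coord 1 =
      X 1 + C s + C (t ^ E) * Polynomial.aeval (shearVar p N t) q := rfl

variable {p a N E : ℕ}

/-- The shear translates `w` by `sᵖ`. -/
theorem aeval_shearEnd_shearVar [Fact p.Prime] [CharP R p] (h : N + a = p * E)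
    (t s : R) (q : Polynomial R) :
    aeval (shearEnd p a N E t s q).coord (shearVar p N t) = shearVar p N t + C (s ^ p) := by
  have : CharP (MvPolynomial (Fin 2) R) p := inferInstance
  have e : (C (t ^ E) : MvPolynomial (Fin 2) R) ^ p = C (t ^ N) * C (t ^ a) := by
    rw [← C_pow, ← C_mul, ← pow_mul, ← pow_add, h, mul_comm]
  conv_lhs => rw [shearVar]
  rw [map_add, map_pow, map_mul, aeval_X, aeval_X, ← algebraMap_eq, AlgHom.commutes, algebraMap_eq,
    shearEnd_coord_zero, shearEnd_coord_one, add_pow_char, add_pow_char, mul_pow, e, C_pow s,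
        shearVar]
  ring

theorem shearEnd_mul [Fact p.Prime] [CharP R p] (h : N + a = p * E)
    (t s s' : R) (q q' : Polynomial R) :
    shearEnd p a N E t s q * shearEnd p a N E t s' q' =
      shearEnd p a N E t (s + s') (q' + q.comp (Polynomial.X + Polynomial.C (s' ^ p))) := by
  have : CharP (MvPolynomial (Fin 2) R) p := inferInstance
  have e : aeval (shearEnd p a N E t s' q').coord (Polynomial.aeval (shearVar p N t) q) =
      Polynomial.aeval (shearVar p N t) (q.comp (Polynomial.X + Polynomial.C (s' ^ p))) := by
    rw [← Polynomial.aeval_algHom_apply, aeval_shearEnd_shearVar h, Polynomial.aeval_comp]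
    simp [algebraMap_eq]
  refine PolyEnd.ext_two ?_ ?_
  · rw [PolyEnd.mul_coord_aeval, shearEnd_coord_zero, shearEnd_coord_zero]
    simp only [map_sub, map_mul, map_pow, e, aeval_X, aeval_C, algebraMap_eq, map_add, add_pow_char,
      shearEnd_coord_zero]
    ring
  · rw [PolyEnd.mul_coord_aeval, shearEnd_coord_one, shearEnd_coord_one]
    simp only [map_mul, map_pow, e, aeval_X, aeval_C, algebraMap_eq, map_add, shearEnd_coord_one]
    ring

theorem shearEnd_zero [Fact p.Prime] (t : R) : shearEnd p a N E t 0 0 = 1 := by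
  have hp : p ≠ 0 := (Fact.out : p.Prime).ne_zero
  refine PolyEnd.ext_two ?_ ?_
  · rw [shearEnd_coord_zero, map_zero, zero_pow hp, mul_zero, sub_zero, PolyEnd.one_coord]
  · rw [shearEnd_coord_one, map_zero, map_zero, mul_zero, add_zero, add_zero,
      PolyEnd.one_coord]

theorem jac_shearEnd [CharP R p] (t s : R) (q : Polynomial R) :
    (shearEnd p a N E t s q).jac = 1 := by
  have : CharP (MvPolynomial (Fin 2) R) p := inferInstance
  rw [PolyEnd.jac_two, shearEnd_coord_zero, shearEnd_coord_one]
  simp [Derivation.leibniz, pderiv_X, Derivation.leibniz_pow, Derivation.map_aeval, shearVar]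

/-- The automorphism `(x - tᵃq(w)ᵖ, y + s + tᴱq(w))` in characteristic `p`, where
`w = yᵖ + tᴺx` and `N + a = pE`. -/
noncomputable def shear [Fact p.Prime] [CharP R p] (h : N + a = p * E)
    (t s : R) (q : Polynomial R) : SAut 2 R :=
  ⟨⟨shearEnd p a N E t s q,
    shearEnd p a N E t (-s) (-q.comp (Polynomial.X + Polynomial.C ((-s) ^ p))), by
      rw [shearEnd_mul h, add_neg_cancel, neg_add_cancel, shearEnd_zero], by
      have e : (-s) ^ p + s ^ p = 0 := by
        rw [← add_pow_char, neg_add_cancel, zero_pow (Fact.out : p.Prime).ne_zero]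
      have e' : (Polynomial.X + Polynomial.C (s ^ p) + Polynomial.C ((-s) ^ p) : Polynomial R) =
          Polynomial.X := by
        rw [add_assoc, ← Polynomial.C_add, add_comm (s ^ p), e, Polynomial.C_0, add_zero]
      rw [shearEnd_mul h, neg_add_cancel, Polynomial.neg_comp, Polynomial.comp_assoc,
        Polynomial.add_comp, Polynomial.X_comp, Polynomial.C_comp, e', Polynomial.comp_X,
        add_neg_cancel, shearEnd_zero]⟩, jac_shearEnd t s q⟩

theorem shear_val [Fact p.Prime] [CharP R p] (h : N + a = p * E) (t s : R) (q : Polynomial R) :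
    (shear h t s q : PolyAut 2 R).val = shearEnd p a N E t s q := rfl

theorem map_shear [Fact p.Prime] [CharP R p] {S : Type*} [CommRing S] [CharP S p] (φ : R →+* S)
    (h : N + a = p * E) (t s : R)
    (q : Polynomial R) : SAut.map φ (shear h t s q) = shear h (φ t) (φ s) (q.map φ) := by
  have e : MvPolynomial.map φ (shearVar p N t) = shearVar p N (φ t) := by
    simp [shearVar]
  refine SAut.ext_end (PolyEnd.ext_two ?_ ?_)
  · rw [SAut.map_coord, shear_val, shear_val, shearEnd_coord_zero, shearEnd_coord_zero]
    simp only [map_sub, map_mul, map_pow, map_polynomial_aeval, e, map_C, map_X]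
  · rw [SAut.map_coord, shear_val, shear_val, shearEnd_coord_one, shearEnd_coord_one]
    simp only [map_add, map_mul, map_pow, map_polynomial_aeval, e, map_C, map_X]

variable {k : Type*} [Field k] [Fact p.Prime] [CharP k p]

/-- For `t ≠ 0` the shear is conjugate to `(x + P(y), y + 1)`: the coordinates
`Y = t⁻ᵖw`, `X = -t^{p - N}(y - tY)` transform one into the other. -/
theorem isConj_tri_shear {D : ℕ} (h : N + a = p * E) (hN : N = E + p * D + p) (τ : kˣ)
    (P q : Polynomial k)
    (hq : q.comp (Polynomial.C ((τ : k) ^ p) * Polynomial.X) =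
      -(Polynomial.C ((τ : k) ^ (p * D)) * P)) :
    IsConj (tri 1 P 1) (shear h (τ : k) (τ : k) q) := by
  obtain ⟨m, hm⟩ : ∃ m : kˣ, m = τ ^ (E + p * D) := ⟨_, rfl⟩
  obtain ⟨w', hw'⟩ : ∃ w' : kˣ, w' = τ ^ p := ⟨_, rfl⟩
  -- the coordinate change `(X, Y)`
  obtain ⟨Γ, hΓ⟩ : ∃ Γ : SAut 2 k,
      Γ = tri 1 (Polynomial.C ((τ * m⁻¹ : kˣ) : k) * Polynomial.X) 0 *
        (tri m⁻¹ 0 0 * ((rot k)⁻¹ *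
          tri 1 (Polynomial.C ((m⁻¹ * w'⁻¹ : kˣ) : k) * Polynomial.X ^ p) 0)) := ⟨_, rfl⟩
  have hmm : (C ((m⁻¹ : kˣ) : k) * C (m : k) : MvPolynomial (Fin 2) k) = 1 := by
    rw [← C_mul, Units.inv_mul, C_1]
  have hww : (C ((w'⁻¹ : kˣ) : k) * C (w' : k) : MvPolynomial (Fin 2) k) = 1 := by
    rw [← C_mul, Units.inv_mul, C_1]
  have hΓ1 : ∀ Q : Fin 2 → MvPolynomial (Fin 2) k, (Γ : PolyAut 2 k).val.act Q 1 =
      C ((w'⁻¹ : kˣ) : k) * (Q 1 ^ p + C (m : k) * C (w' : k) * Q 0) := by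
    intro Q
    simp only [hΓ, SAut.act_mul, act_tri_one, act_tri_zero, act_rot_inv_one]
    simp only [algebraMap_eq, inv_one, inv_inv, Units.val_one, map_one, one_mul, map_zero, add_zero,
      map_mul, Polynomial.aeval_C, map_pow, Polynomial.aeval_X, Units.val_mul]
    linear_combination (C ((w'⁻¹ : kˣ) : k) * Q 1 ^ p) * hmm - (C (m : k) * Q 0) * hww
  have hΓ0 : ∀ Q : Fin 2 → MvPolynomial (Fin 2) k, (Γ : PolyAut 2 k).val.act Q 0 =
      -C ((m⁻¹ : kˣ) : k) * (Q 1 - C (τ : k) * (Γ : PolyAut 2 k).val.act Q 1) := by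
    intro Q
    simp only [hΓ, SAut.act_mul, act_tri_one, act_tri_zero, act_rot_inv_one, act_rot_inv_zero]
    simp only [algebraMap_eq, inv_one, inv_inv, Units.val_one, map_one, one_mul, map_zero, add_zero,
      map_mul, Polynomial.aeval_C, map_pow, Polynomial.aeval_X, Units.val_mul]
    ring
  have e2 : (τ : k) ^ p = w' := by rw [hw']; push_cast; rfl
  have hw : ∀ Q : Fin 2 → MvPolynomial (Fin 2) k,
      C (w' : k) * (Γ : PolyAut 2 k).val.act Q 1 = aeval Q (shearVar p N (τ : k)) := by
    intro Q
    have e1 : (τ : k) ^ (E + p * D) = m := by rw [hm]; push_cast; rfl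
    rw [hΓ1, shearVar, hN, pow_add _ (E + p * D), C_mul, e1, e2]
    simp only [map_add, map_mul, map_pow, aeval_X, aeval_C, algebraMap_eq]
    linear_combination (Q 1 ^ p + C (m : k) * C (w' : k) * Q 0 : MvPolynomial (Fin 2) k) * hww
  have hwX := hw fun j => X j
  rw [aeval_X_left_apply] at hwX
  refine IsConj.symm (isConj_iff.mpr ⟨Γ, ?_⟩)
  rw [mul_inv_eq_iff_eq_mul]
  have hqw : Polynomial.aeval (shearVar p N (τ : k)) q =
      -(C ((τ : k) ^ (p * D)) * Polynomial.aeval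
        ((Γ : PolyAut 2 k).val.act (fun j => (X j : MvPolynomial (Fin 2) k)) 1) P) := by
    have := congrArg (Polynomial.aeval
      ((Γ : PolyAut 2 k).val.act (fun j => (X j : MvPolynomial (Fin 2) k)) 1)) hq
    rw [Polynomial.aeval_comp, map_mul, Polynomial.aeval_C, Polynomial.aeval_X,
        algebraMap_eq] at this
    rw [e2, hwX] at this
    rw [this, map_neg, map_mul, Polynomial.aeval_C, algebraMap_eq]
  have hs0 : (shear h (τ : k) (τ : k) q : PolyAut 2 k).val.act
      (fun j => (X j : MvPolynomial (Fin 2) k)) = (shearEnd p a N E (τ : k) (τ : k) q).coord := by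
    funext i
    rw [PolyEnd.act_apply, aeval_X_left_apply]
    rfl
  have hY : (Γ : PolyAut 2 k).val.act (shearEnd p a N E (τ : k) (τ : k) q).coord 1 =
      (Γ : PolyAut 2 k).val.act (fun j => (X j : MvPolynomial (Fin 2) k)) 1 + 1 := by
    have h1 := aeval_shearEnd_shearVar h (τ : k) (τ : k) q
    rw [← hw, ← hwX, e2] at h1
    linear_combination C ((w'⁻¹ : kˣ) : k) * h1 -
      ((Γ : PolyAut 2 k).val.act (shearEnd p a N E (τ : k) (τ : k) q).coord 1 -
        (Γ : PolyAut 2 k).val.act (fun j => (X j : MvPolynomial (Fin 2) k)) 1 - 1) * hww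
  refine SAut.ext_act_two ?_ ?_
  · rw [SAut.act_mul, SAut.act_mul, hs0, act_tri_zero, hΓ0, hΓ0, hY, shearEnd_coord_one, hqw]
    have e3 : (C ((m⁻¹ : kˣ) : k) * (C ((τ : k) ^ E) * C ((τ : k) ^ (p * D))) :
        MvPolynomial (Fin 2) k) = 1 := by
      rw [← C_mul, ← pow_add, ← hmm, hm]
      push_cast
      rfl
    simp only [algebraMap_eq, Units.val_one, map_one, one_mul]
    linear_combination (Polynomial.aeval
        ((Γ : PolyAut 2 k).val.act (fun j => (X j : MvPolynomial (Fin 2) k)) 1) P) * e3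
  · rw [SAut.act_mul, SAut.act_mul, hs0, hY, act_tri_one]
    simp [algebraMap_eq]

theorem exists_family_translation_charP {k : Type*} [Field k] (p : ℕ) [Fact p.Prime] [CharP k p]
    (P : Polynomial k) :
    ∃ F : SAut 2 (Polynomial k), (∀ t : k, t ≠ 0 → IsConj (tri 1 P 1) (SAut.value F t)) ∧
      IsDiagonalisable (SAut.value F 0 : PolyAut 2 k) := by
  have hp : p.Prime := Fact.out
  obtain ⟨r, hr⟩ : ∃ r, p = r + 2 := ⟨p - 2, by have := hp.two_le; omega⟩
  obtain ⟨D, hD⟩ : ∃ D, D = P.natDegree := ⟨_, rfl⟩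
  obtain ⟨E, hE⟩ : ∃ E, E = p + p * D + 1 := ⟨_, rfl⟩
  have h : (E + p * D + p) + (r * E + 1) = p * E := by
    have : p * E = r * E + 2 * E := by rw [hr]; ring
    omega
  let q : Polynomial (Polynomial k) := -∑ j ∈ Finset.range (D + 1),
    Polynomial.C (Polynomial.C (P.coeff j) * Polynomial.X ^ (p * (D - j))) * Polynomial.X ^ j
  have hval : ∀ t : k, SAut.value (shear h Polynomial.X Polynomial.X q) t =
      shear h t t (q.map (Polynomial.evalRingHom t)) := fun t => by
    rw [SAut.value, map_shear]
    simp
  refine ⟨shear h Polynomial.X Polynomial.X q, fun t ht => ?_, ?_⟩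
  · rw [hval]
    refine isConj_tri_shear h rfl (Units.mk0 t ht) P _ ?_
    conv_rhs => rw [P.as_sum_range_C_mul_X_pow, ← hD]
    simp only [q, Polynomial.map_neg, Polynomial.map_sum, Polynomial.map_mul, Polynomial.map_C,
      Polynomial.map_pow, Polynomial.map_X, Polynomial.neg_comp, Polynomial.sum_comp,
      Polynomial.mul_comp, Polynomial.C_comp, Polynomial.X_pow_comp, Finset.mul_sum, Units.val_mk0]
    congr 1
    refine Finset.sum_congr rfl fun j hj => ?_
    have hj' : p * (D - j) + p * j = p * D := by
      rw [← mul_add, Nat.sub_add_cancel (Nat.lt_succ_iff.mp (Finset.mem_range.mp hj))]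
    rw [← hj', pow_add]
    simp
    ring
  · have : shear h (0 : k) 0 (q.map (Polynomial.evalRingHom 0)) = tri 1 0 0 := by
      rw [tri_one]
      refine SAut.ext_end (PolyEnd.ext_two ?_ ?_)
      · rw [shear_val, shearEnd_coord_zero, zero_pow (Nat.succ_ne_zero _)]
        simp only [map_zero, zero_mul, sub_zero]
        rfl
      · rw [shear_val, shearEnd_coord_one, zero_pow (by omega)]
        simp only [map_zero, zero_mul, add_zero]
        rfl
    rw [hval, this]
    exact isDiagonalisable_tri_zero 1

end Shear

/-! ### Conjugacy classes that are not closed -/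

section NotClosed

/-- An algebraic automorphism degenerates, within its conjugacy class, to a diagonalisable one. -/
theorem exists_degeneration {k : Type*} [Field k] [IsAlgClosed k] {f : SAut 2 k}
    (hf : IsAlgebraicAut (f : PolyAut 2 k)) :
    ∃ F : SAut 2 (Polynomial k), (∀ t : k, t ≠ 0 → IsConj f (SAut.value F t)) ∧
      IsDiagonalisable (SAut.value F 0 : PolyAut 2 k) := by
  obtain ⟨b, hb, hfb⟩ := exists_isTri_of_isAlgebraicAut hf
  suffices ∃ F : SAut 2 (Polynomial k), (∀ t : k, t ≠ 0 → IsConj b (SAut.value F t)) ∧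
      IsDiagonalisable (SAut.value F 0 : PolyAut 2 k) by
    obtain ⟨F, hF, hF0⟩ := this
    exact ⟨F, fun t ht => hfb.trans (hF t ht), hF0⟩
  rcases hb.exists_isConj_normalized with ⟨α, p, h⟩ | ⟨P, h⟩
  · obtain ⟨F, hF, hF0⟩ := exists_family_tri_zero α p
    exact ⟨F, fun t ht => h.trans (hF t ht), hF0⟩
  · obtain ⟨F, hF, hF0⟩ : ∃ F : SAut 2 (Polynomial k),
        (∀ t : k, t ≠ 0 → IsConj (tri 1 P 1) (SAut.value F t)) ∧
        IsDiagonalisable (SAut.value F 0 : PolyAut 2 k) := by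
      obtain ⟨p, hp⟩ := CharP.exists k
      rcases CharP.char_is_prime_or_zero k p with hp' | rfl
      · have : Fact p.Prime := ⟨hp'⟩
        exact exists_family_translation_charP p P
      · have : CharZero k := CharP.charP_to_charZero k
        exact exists_family_translation_charZero P
    exact ⟨F, fun t ht => h.trans (hF t ht), hF0⟩

/-- The affine line as a variety. -/
noncomputable def affineLine (k : Type u) [Field k] : AlgVariety k where
  X := Spec (CommRingCat.of (Polynomial k))
  str := Spec.map (CommRingCat.ofHom Polynomial.C)
  reduced := inferInstance
  separated := inferInstance
  locallyOfFiniteType := by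
    rw [HasRingHomProperty.Spec_iff (P := @LocallyOfFiniteType)]
    change (algebraMap k (Polynomial k)).FiniteType
    rw [RingHom.finiteType_algebraMap]
    infer_instance
  quasiCompact := inferInstance

/-- The point `t` of the affine line. -/
noncomputable def affineLinePoint {k : Type u} [Field k] (t : k) : (affineLine k).Point where
  hom := Spec.map (CommRingCat.ofHom (Polynomial.evalRingHom t))
  hom_str := by
    change Spec.map _ ≫ Spec.map _ = _
    rw [← Spec.map_comp, ← CommRingCat.ofHom_comp]
    have : (Polynomial.evalRingHom t).comp Polynomial.C = RingHom.id k := by ext; simp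
    rw [this]
    exact Spec.map_id _

/-- Polynomials as global functions on the affine line. -/
noncomputable def affineLineFun (k : Type u) [Field k] :
    Polynomial k →+* Γ((affineLine k).X, ⊤) :=
  (Scheme.ΓSpecIso (CommRingCat.of (Polynomial k))).inv.hom

theorem affineLinePoint_eval {k : Type u} [Field k] (t : k) :
    (affineLinePoint t).eval.comp (affineLineFun k) = Polynomial.evalRingHom t := by
  have h : (Scheme.ΓSpecIso (CommRingCat.of (Polynomial k))).inv ≫
      ((affineLinePoint t).hom.appTop ≫ (Scheme.ΓSpecIso (CommRingCat.of k)).hom) =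
      CommRingCat.ofHom (Polynomial.evalRingHom t) := by
    change _ ≫ (Scheme.Hom.appTop (Spec.map _) ≫ _) = _
    rw [Scheme.ΓSpecIso_naturality, Iso.inv_hom_id_assoc]
  exact congrArg CommRingCat.Hom.hom h

theorem affineLinePoint_mem_iff {k : Type u} [Field k] (t : k) (b : Polynomial k) :
    (affineLinePoint t).pt ∈ (PrimeSpectrum.basicOpen b : Set (PrimeSpectrum (Polynomial k))) ↔
      b.eval t ≠ 0 := by
  change b ∉ Ideal.comap (Polynomial.evalRingHom t) (IsLocalRing.maximalIdeal k) ↔ _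
  rw [Ideal.mem_comap, IsLocalRing.maximalIdeal_eq_bot, Ideal.mem_bot]
  rfl

/-- The value at `0` of a family over the affine line lies in every closed set containing the other
values. -/
theorem value_zero_mem_of_isClosed {n : ℕ} {k : Type u} [Field k] [Infinite k]
    {S : Set (SAut n k)} (hS : IsClosed S) (F : SAut n (Polynomial k))
    (hF : ∀ t : k, t ≠ 0 → SAut.value F t ∈ S) : SAut.value F 0 ∈ S := by
  obtain ⟨C, hC, rfl⟩ := isClosed_induced_iff.mp hS
  rw [isClosed_polyAut_iff] at hC
  have h := hC (affineLine k) (PolyAut.map (affineLineFun k) (F : PolyAut n (Polynomial k)))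
  have hval : ∀ t : k, PolyAut.map (affineLinePoint t).eval
      (PolyAut.map (affineLineFun k) (F : PolyAut n (Polynomial k))) =
      (SAut.value F t : PolyAut n k) := fun t => by
    refine (PolyAut.map_map (affineLineFun k) (affineLinePoint t).eval _).trans ?_
    exact congrArg (fun φ => PolyAut.map φ (F : PolyAut n (Polynomial k))) (affineLinePoint_eval t)
  have h0 : affineLinePoint (0 : k) ∈ closure {p : (affineLine k).Point | PolyAut.map p.eval
      (PolyAut.map (affineLineFun k) (F : PolyAut n (Polynomial k))) ∈ C} := by
    rw [mem_closure_iff]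
    rintro _ ⟨U, hU, rfl⟩ hmem
    obtain ⟨_, ⟨b, rfl⟩, hb0, hbU⟩ :=
      (PrimeSpectrum.isTopologicalBasis_basic_opens (R := Polynomial k)).exists_subset_of_mem_open
        hmem hU
    have hb : Polynomial.X * b ≠ 0 := by
      refine mul_ne_zero Polynomial.X_ne_zero ?_
      rintro rfl
      exact (affineLinePoint_mem_iff 0 0).mp hb0 Polynomial.eval_zero
    obtain ⟨t, ht⟩ : ∃ t, (Polynomial.X * b).eval t ≠ 0 := by
      by_contra! h
      exact hb (Polynomial.funext fun t => by rw [h, Polynomial.eval_zero])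
    rw [Polynomial.eval_mul, Polynomial.eval_X] at ht
    refine ⟨affineLinePoint t, hbU ((affineLinePoint_mem_iff t b).mpr (right_ne_zero_of_mul ht)),
        ?_⟩
    change _ ∈ C
    rw [hval]
    exact hF t (left_ne_zero_of_mul ht)
  have h1 := h.closure_subset h0
  have h2 := hval 0
  change (SAut.value F 0 : PolyAut n k) ∈ C
  rw [← h2]
  exact h1

theorem not_isClosed_conjugatesOf {k : Type u} [Field k] [IsAlgClosed k] {f : SAut 2 k}
    (hf : IsAlgebraicAut (f : PolyAut 2 k)) (hd : ¬ IsDiagonalisable (f : PolyAut 2 k)) :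
    ¬ IsClosed (conjugatesOf f) := by
  intro h
  obtain ⟨F, hF, hF0⟩ := exists_degeneration hf
  have : Infinite k := IsAlgClosed.instInfinite
  have h0 : IsConj f (SAut.value F 0) := value_zero_mem_of_isClosed h F hF
  exact hd (hF0.of_isConj (IsConj.coe_SAut h0.symm))

end NotClosed

/-! ### Degrees of conjugations to a diagonal map -/

section DiagonalDegreeBound

open MvPolynomial WithZero

variable {k : Type*} [Field k]

theorem degree_inv_le_one [IsAlgClosed k] {g : PolyAut 2 k} (hg : g.val.degree ≤ 1) :
    (g⁻¹ : PolyAut 2 k).val.degree ≤ 1 := by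
  have hv : ∀ c : k, c ≠ 0 → degVal (algebraMap k (MvPolynomial (Fin 2) k) c) = 1 :=
    fun c hc => degVal_algebraMap hc
  rw [PolyEnd.degree_le_iff]
  intro i
  obtain ⟨r, l₀, l₁, hr, hl, hlead⟩ := exists_linear_leadingForm (g⁻¹ : PolyAut 2 k) i
  have hle : ∀ j, degVal (g.val.coord j) ≤ exp (1 : ℤ) := fun j => by
    rw [degVal_coord, exp_le_exp]
    exact_mod_cast (g.val.totalDegree_le_degree j).trans hg
  have hu : ∀ c : k, C l₀ * g.val.coord 0 + C l₁ * g.val.coord 1 ≠ C c := by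
    intro c hc
    have hu0 : (C l₀ * X 0 + C l₁ * X 1 - C c : MvPolynomial (Fin 2) k) ≠ 0 := by
      intro h0
      have c0 := congrArg (coeff (Finsupp.single 0 1)) h0
      have c1 := congrArg (coeff (Finsupp.single 1 1)) h0
      have h01 : (fun₀ | (0 : Fin 2) => 1) ≠ (0 : Fin 2 →₀ ℕ) := by simp
      have h11 : (fun₀ | (1 : Fin 2) => 1) ≠ (0 : Fin 2 →₀ ℕ) := by simp
      simp [coeff_C_mul, MvPolynomial.coeff_X, coeff_C, Finsupp.single_left_inj, h01.symm,
          h11.symm] at c0 c1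
      tauto
    refine aeval_coord_ne_zero (PolyEnd.jac_ne_zero g) hu0 ?_
    rw [map_sub, map_add, map_mul, map_mul, aeval_X, aeval_X, aeval_C, aeval_C, aeval_C,
      algebraMap_eq, hc, sub_self]
  have hval : degVal (algebraMap k (MvPolynomial (Fin 2) k) l₀ * g.val.coord 0 +
      algebraMap k (MvPolynomial (Fin 2) k) l₁ * g.val.coord 1) = exp (1 : ℤ) := by
    rw [algebraMap_eq]
    have hne : C l₀ * g.val.coord 0 + C l₁ * g.val.coord 1 ≠ 0 := by
      have := hu 0
      rwa [C_0] at this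
    refine le_antisymm ?_ ?_
    · have hC : ∀ c : k, degVal (C c : MvPolynomial (Fin 2) k) ≤ 1 := fun c => by
        by_cases hc : c = 0
        · simp [hc]
        · exact (hv c hc).le
      refine (Valuation.map_add_le _ ?_ ?_)
      · rw [map_mul]
        exact (mul_le_of_le_one_left' (hC _)).trans (hle 0)
      · rw [map_mul]
        exact (mul_le_of_le_one_left' (hC _)).trans (hle 1)
    · rw [degVal_of_ne_zero hne, exp_le_exp]
      by_contra! hlt
      have h0 : (C l₀ * g.val.coord 0 + C l₁ * g.val.coord 1).totalDegree = 0 := by omega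
      exact hu _ (totalDegree_eq_zero_iff_eq_C.mp h0)
  have h1 := hlead.map_aeval_eq (v := degVal) hv hr (by rw [← exp_zero, exp_lt_exp]; exact one_pos)
    hle hval
  rw [inv_act_coord, degVal_X, ← exp_nsmul, exp_inj, nsmul_eq_mul, mul_one] at h1
  exact_mod_cast h1.ge

/-- Conjugation to the diagonal map `(ax, a⁻¹y)` by `h` has bounded degree if no elementary map
commuting with the diagonal map lowers the degree of `h`: otherwise, reduce the degree of `h`
nevertheless by an elementary map `e`; the degree of `e (ax, a⁻¹y) h` stays that of `h`. -/
theorem degree_le_of_conj_diag [IsAlgClosed k] (a : kˣ) {F h : SAut 2 k}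
    (hF : h * F * h⁻¹ = tri a 0 0)
    (hle : degVal ((h : PolyAut 2 k).val.coord 1) ≤ degVal ((h : PolyAut 2 k).val.coord 0))
    (hmin : ∀ (c : k) (s : ℕ), (a : k) = ((a⁻¹ : kˣ) : k) ^ s →
      degVal ((h : PolyAut 2 k).val.coord 0) ≤
        degVal ((h : PolyAut 2 k).val.coord 0 - C c * (h : PolyAut 2 k).val.coord 1 ^ s)) :
    (h : PolyAut 2 k).val.degree ≤ (F : PolyAut 2 k).val.degree ∧
      ((h⁻¹ : SAut 2 k) : PolyAut 2 k).val.degree ≤ (F : PolyAut 2 k).val.degree := by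
  have hv : ∀ c : k, c ≠ 0 → degVal (algebraMap k (MvPolynomial (Fin 2) k) c) = 1 :=
    fun c hc => degVal_algebraMap hc
  have hdF := one_le_degree (F : PolyAut 2 k)
  have hdh : (h : PolyAut 2 k).val.degree = ((h : PolyAut 2 k).val.coord 0).totalDegree :=
    degree_eq_of_le (by decide) (totalDegree_le_of_degVal_le hle)
  by_cases hd1 : (h : PolyAut 2 k).val.degree ≤ 1
  · have := degree_inv_le_one hd1
    exact ⟨hd1.trans hdF, this.trans hdF⟩
  rw [hdh] at hd1
  push Not at hd1
  set x := (h : PolyAut 2 k).val.coord 0 with hx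
  set y := (h : PolyAut 2 k).val.coord 1 with hy
  have hvy : 1 < degVal y := one_lt_degVal_coord _ 1
  have hvx : 1 < degVal x := one_lt_degVal_coord _ 0
  have hxd : degVal x = exp (x.totalDegree : ℤ) := degVal_coord _ 0
  have hyd : degVal y = exp (y.totalDegree : ℤ) := degVal_coord _ 1
  -- a swapped reduction is also one in the other order when the degrees agree
  have swap : ∀ {z w : MvPolynomial (Fin 2) k} {c : k}, c ≠ 0 → degVal z = degVal w →
      degVal (w - C c * z ^ 1) < degVal w → degVal (z - C c⁻¹ * w ^ 1) < degVal z := by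
    intro z w c hc e hlt
    have hcc : (C c⁻¹ * C c : MvPolynomial (Fin 2) k) = 1 := by
      rw [← C_mul, inv_mul_cancel₀ hc, C_1]
    have : z - C c⁻¹ * w ^ 1 = -(C c⁻¹ * (w - C c * z ^ 1)) := by
      linear_combination -z * hcc
    rw [this, Valuation.map_neg, map_mul, ← algebraMap_eq, hv _ (inv_ne_zero hc), one_mul, e,
      algebraMap_eq]
    exact hlt
  have hred : ∀ g : PolyAut 2 k, (1 < (g.val.coord 0).totalDegree ∨ 1 <
      (g.val.coord 1).totalDegree) →
      (∃ (c : k) (s : ℕ), degVal (g.val.coord 0 - C c * g.val.coord 1 ^ s) <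
        degVal (g.val.coord 0)) ∨ degVal (g.val.coord 0) < degVal (g.val.coord 1) := by
    intro g hg
    obtain ⟨c, s, hc, hs, ⟨-, h2⟩ | ⟨h1, h2⟩⟩ := exists_degree_reduction g hg
    · exact Or.inl ⟨c, s, by rw [degVal_coord g 0]; exact degVal_lt_of_totalDegree_lt h2⟩
    · have p0 := totalDegree_coord_pos g 0
      obtain rfl | hs2 : s = 1 ∨ 2 ≤ s := by omega
      · refine Or.inl ⟨c⁻¹, 1, swap hc ?_ ?_⟩
        · rw [degVal_coord, degVal_coord, h1, one_mul]
        · rw [degVal_coord g 1]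
          exact degVal_lt_of_totalDegree_lt h2
      · right
        rw [degVal_coord, degVal_coord, exp_lt_exp, h1]
        push_cast
        have : (2 : ℤ) ≤ s := by exact_mod_cast hs2
        have : (0 : ℤ) < (g.val.coord 0).totalDegree := by exact_mod_cast p0
        nlinarith
  -- a polynomial `q` for which `x - q(y)` has the smallest degree
  obtain ⟨q, hq⟩ : ∃ q : Polynomial k, ∀ q' : Polynomial k,
      (x - Polynomial.aeval y q).totalDegree ≤ (x - Polynomial.aeval y q').totalDegree :=
    ⟨Function.argmin (fun q : Polynomial k => (x - Polynomial.aeval y q).totalDegree),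
      fun q' => Function.argmin_le (fun q : Polynomial k =>
          (x - Polynomial.aeval y q).totalDegree) q'⟩
  obtain ⟨h', hh'⟩ : ∃ h' : SAut 2 k, h' = tri 1 (-q) 0 * h := ⟨_, rfl⟩
  have hx' : (h' : PolyAut 2 k).val.coord 0 = x - Polynomial.aeval y q := by
    rw [hh']
    change PolyEnd.act _ (h : PolyAut 2 k).val.coord 0 = _
    rw [act_tri_zero, Units.val_one, map_one, one_mul, map_neg, sub_eq_add_neg]
  have hy' : (h' : PolyAut 2 k).val.coord 1 = y := by
    rw [hh']
    change PolyEnd.act _ (h : PolyAut 2 k).val.coord 1 = _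
    rw [act_tri_one, inv_one, Units.val_one, map_one, one_mul, map_zero, add_zero]
  set x' := (h' : PolyAut 2 k).val.coord 0 with hx'def
  have hvx' : degVal x' = exp (x'.totalDegree : ℤ) := degVal_coord _ 0
  have hqv : ∀ q' : Polynomial k, degVal x' ≤ degVal (x - Polynomial.aeval y q') := by
    intro q'
    by_contra! hlt
    rw [hvx'] at hlt
    have := totalDegree_le_sub_of_degVal_lt (totalDegree_coord_pos _ 0) hlt
    have h2 := hq q'
    rw [← hx'] at h2
    exact absurd this (not_lt.mpr h2)
  have hmono : ∀ (c : k) (s : ℕ), Polynomial.aeval y (Polynomial.C c * Polynomial.X ^ s) =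
      C c * y ^ s := fun c s => by
    rw [map_mul, map_pow, Polynomial.aeval_X, Polynomial.aeval_C, algebraMap_eq]
  have hirr : ¬ ∃ (c : k) (s : ℕ), degVal (x' - C c * y ^ s) < degVal x' := by
    rintro ⟨c, s, hcs⟩
    refine absurd hcs (not_lt.mpr ?_)
    have := hqv (q + Polynomial.C c * Polynomial.X ^ s)
    rwa [map_add, hmono, ← sub_sub, ← hx'] at this
  have hlt : degVal x' < degVal x := by
    rcases hred (h : PolyAut 2 k) (Or.inl hd1) with ⟨c, s, hcs⟩ | h1
    · refine lt_of_le_of_lt (hqv (Polynomial.C c * Polynomial.X ^ s)) ?_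
      rw [hmono]
      exact hcs
    · exact absurd h1 (not_lt.mpr hle)
  have hqx : degVal (Polynomial.aeval y q) = degVal x := by
    have : Polynomial.aeval y q = x - x' := by rw [hx']; ring
    rw [this, Valuation.map_sub_eq_of_lt_left _ hlt]
  have hq0 : q ≠ 0 := by
    rintro rfl
    rw [map_zero, map_zero] at hqx
    exact absurd hqx.symm (zero_lt_one.trans hvx).ne'
  have hys : degVal y ^ q.natDegree = degVal x := by
    rw [← hqx, Valuation.map_polynomial_aeval hv hvy hq0]
  have hs0 : q.natDegree ≠ 0 := by
    intro h0
    rw [h0, pow_zero] at hys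
    exact hvx.ne hys
  have hsmall : ∀ p : Polynomial k, p.natDegree < q.natDegree →
      degVal (Polynomial.aeval y p) < degVal x := by
    intro p hp
    by_cases hp0 : p = 0
    · rw [hp0, map_zero, map_zero]
      exact zero_lt_one.trans hvx
    · rw [Valuation.map_polynomial_aeval hv hvy hp0, ← hys]
      exact pow_lt_pow_right₀ hvy hp
  -- the leading monomial of `q` does not commute with the diagonal map
  have hres : (a : k) ≠ ((a⁻¹ : kˣ) : k) ^ q.natDegree := by
    intro hres
    refine absurd (hmin q.leadingCoeff q.natDegree hres) (not_le.mpr ?_)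
    have e : x - C q.leadingCoeff * y ^ q.natDegree = x' + Polynomial.aeval y q.eraseLead := by
      rw [hx', ← hmono]
      conv_lhs => rw [Polynomial.C_mul_X_pow_eq_monomial]
      have := congrArg (Polynomial.aeval y) q.eraseLead_add_monomial_natDegree_leadingCoeff
      rw [map_add] at this
      linear_combination -this
    rw [e]
    refine Valuation.map_add_lt _ hlt ?_
    rcases q.eraseLead_natDegree_lt_or_eraseLead_eq_zero with h1 | h1
    · exact hsmall _ h1
    · rw [h1, map_zero, map_zero]
      exact zero_lt_one.trans hvx
  obtain ⟨r, hr⟩ : ∃ r : Polynomial k, r = Polynomial.C (a : k) * q -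
      q.comp (Polynomial.C ((a⁻¹ : kˣ) : k) * Polynomial.X) := ⟨_, rfl⟩
  have hrs : r.coeff q.natDegree ≠ 0 := by
    rw [hr, Polynomial.coeff_sub, Polynomial.coeff_C_mul, Polynomial.comp_C_mul_X_coeff, mul_comm,
      ← mul_sub]
    exact mul_ne_zero (by simpa using hq0) (sub_ne_zero.mpr hres)
  have hrd : r.natDegree = q.natDegree := by
    refine le_antisymm ?_ (Polynomial.le_natDegree_of_ne_zero hrs)
    rw [hr]
    refine (Polynomial.natDegree_sub_le _ _).trans (max_le (Polynomial.natDegree_C_mul_le _ _) ?_)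
    refine Polynomial.natDegree_comp_le.trans ?_
    calc q.natDegree * _ ≤ q.natDegree * 1 :=
          Nat.mul_le_mul_left _ ((Polynomial.natDegree_C_mul_le _ _).trans
              Polynomial.natDegree_X_le)
      _ = _ := mul_one _
  have hr0 : r ≠ 0 := fun h0 => hrs (by rw [h0, Polynomial.coeff_zero])
  have hrx : degVal (Polynomial.aeval y r) = degVal x := by
    rw [Valuation.map_polynomial_aeval hv hvy hr0, hrd, hys]
  -- the image of `h` under the diagonal map followed by the elementary map
  obtain ⟨R, hR⟩ : ∃ R : SAut 2 k, R = tri 1 (-q) 0 * (tri a 0 0 * h) := ⟨_, rfl⟩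
  have hRF : R = h' * F := by
    rw [hR, hh', ← hF]
    group
  have hR1 : (R : PolyAut 2 k).val.coord 1 = C ((a⁻¹ : kˣ) : k) * y := by
    rw [hR]
    change PolyEnd.act _ (PolyEnd.act _ (h : PolyAut 2 k).val.coord) 1 = _
    rw [act_tri_one, act_tri_one]
    simp [algebraMap_eq, hy]
  have hR0 : (R : PolyAut 2 k).val.coord 0 = C (a : k) * x' + Polynomial.aeval y r := by
    rw [hR]
    change PolyEnd.act _ (PolyEnd.act _ (h : PolyAut 2 k).val.coord) 0 = _
    rw [act_tri_zero, act_tri_zero, act_tri_one, ← hx, ← hy, hx', hr, map_sub,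
        Polynomial.aeval_comp]
    simp only [map_mul, Polynomial.aeval_C, Polynomial.aeval_X, algebraMap_eq, map_neg, map_zero,
      add_zero, Units.val_one, map_one, one_mul]
    ring
  have hvR0 : degVal ((R : PolyAut 2 k).val.coord 0) = degVal x := by
    rw [hR0, Valuation.map_add_eq_of_lt_right, hrx]
    rw [hrx, map_mul, ← algebraMap_eq, hv _ a.ne_zero, one_mul]
    exact hlt
  have hvR1 : degVal ((R : PolyAut 2 k).val.coord 1) = degVal y := by
    rw [hR1, map_mul, ← algebraMap_eq, hv _ (a⁻¹).ne_zero, one_mul]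
  have hsx : q.natDegree ≤ x.totalDegree := by
    rw [hyd, hxd, ← exp_nsmul, exp_inj, nsmul_eq_mul] at hys
    have h1 : q.natDegree * y.totalDegree = x.totalDegree := by exact_mod_cast hys
    rw [← h1]
    exact Nat.le_mul_of_pos_right _ (totalDegree_coord_pos (h : PolyAut 2 k) 1)
  have hhinv : ((h⁻¹ : SAut 2 k) : PolyAut 2 k).val.degree ≤
      ((h'⁻¹ : SAut 2 k) : PolyAut 2 k).val.degree * x.totalDegree := by
    have e : h⁻¹ = h'⁻¹ * tri 1 (-q) 0 := by rw [hh']; group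
    rw [e]
    refine (PolyEnd.degree_mul_le _ _).trans (Nat.mul_le_mul_left _ ?_)
    refine (degree_tri_le _ _ _).trans (max_le hd1.le ?_)
    rwa [Polynomial.natDegree_neg]
  rw [hdh]
  by_cases haff : x'.totalDegree ≤ 1 ∧ y.totalDegree ≤ 1
  · have h1 : (h' : PolyAut 2 k).val.degree ≤ 1 := by
      rw [PolyEnd.degree_le_iff, Fin.forall_fin_two, hy']
      exact haff
    have h2 := degree_inv_le_one h1
    have h3 : x.totalDegree ≤ (F : PolyAut 2 k).val.degree := by
      have e1 : x.totalDegree = ((R : PolyAut 2 k).val.coord 0).totalDegree := by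
        rw [hxd, degVal_coord, exp_inj] at hvR0
        exact_mod_cast hvR0.symm
      rw [e1]
      refine (PolyEnd.totalDegree_le_degree _ 0).trans ?_
      rw [hRF]
      refine (PolyEnd.degree_mul_le _ _).trans ?_
      calc _ ≤ 1 * (F : PolyAut 2 k).val.degree := Nat.mul_le_mul_right _ h1
        _ = _ := one_mul _
    refine ⟨h3, hhinv.trans ?_⟩
    calc _ ≤ 1 * x.totalDegree := Nat.mul_le_mul_right _ h2
      _ ≤ _ := by rwa [one_mul]
  · have hx'y : degVal x' < degVal y := by
      rcases hred (h' : PolyAut 2 k) (by rw [hy', ← hx'def]; omega) with h1 | h1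
      · rw [hy'] at h1
        exact absurd h1 hirr
      · rwa [hy'] at h1
    obtain ⟨i, -, hi⟩ := Finset.exists_mem_eq_sup Finset.univ Finset.univ_nonempty
      fun i => (((h'⁻¹ : SAut 2 k) : PolyAut 2 k).val.coord i).totalDegree
    change ((h'⁻¹ : SAut 2 k) : PolyAut 2 k).val.degree = _ at hi
    obtain ⟨ρ, l₀, l₁, hρ, hl01, hlead⟩ :=
      exists_linear_leadingForm ((h'⁻¹ : SAut 2 k) : PolyAut 2 k) i
    have hl1 : l₁ = 0 := by
      by_contra hl1
      have h1 := hlead.map_aeval_eq (v := degVal) hv hρ (Q := (h' : PolyAut 2 k).val.coord)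
        (M := degVal y) hvy (Fin.forall_fin_two.mpr ⟨hx'y.le, by rw [hy']⟩) (by
          have e : degVal (algebraMap k (MvPolynomial (Fin 2) k) l₁ *
              (h' : PolyAut 2 k).val.coord 1) = degVal y := by
            rw [map_mul, hv _ hl1, one_mul, hy']
          rw [← e]
          refine Valuation.map_add_eq_of_lt_right _ ?_
          rw [e, map_mul]
          refine lt_of_le_of_lt (mul_le_of_le_one_left' ?_) hx'y
          by_cases h0 : l₀ = 0
          · simp [h0]
          · exact (hv _ h0).le)
      have e : aeval (h' : PolyAut 2 k).val.coord (((h'⁻¹ : SAut 2 k) : PolyAut 2 k).val.coord i) =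
        X i := inv_act_coord (h' : PolyAut 2 k) i
      rw [e, degVal_X, hyd, ← exp_nsmul, exp_inj, nsmul_eq_mul] at h1
      have h2 : 1 = (((h'⁻¹ : SAut 2 k) : PolyAut 2 k).val.coord i).totalDegree * y.totalDegree :=
          by
        exact_mod_cast h1
      have h3 := Nat.eq_one_of_mul_eq_one_left h2.symm
      rw [hvx', hyd, exp_lt_exp, h3] at hx'y
      have h4 : 0 < x'.totalDegree := totalDegree_coord_pos _ 0
      omega
    have hl0 : l₀ ≠ 0 := by tauto
    have h1 := hlead.map_aeval_eq (v := degVal) hv hρ (Q := (R : PolyAut 2 k).val.coord)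
      (M := degVal x) hvx (Fin.forall_fin_two.mpr ⟨hvR0.le, hvR1.le.trans hle⟩)
      (by rw [hl1, map_zero, zero_mul, add_zero, map_mul, hv _ hl0, one_mul, hvR0])
    have e : aeval (R : PolyAut 2 k).val.coord (((h'⁻¹ : SAut 2 k) : PolyAut 2 k).val.coord i) =
        (F : PolyAut 2 k).val.coord i := by
      have : F = h'⁻¹ * R := by rw [hRF]; group
      conv_rhs => rw [this]
      rfl
    rw [e, degVal_coord, hxd, ← exp_nsmul, exp_inj, ← hi, nsmul_eq_mul] at h1
    have h2 : ((F : PolyAut 2 k).val.coord i).totalDegree =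
        ((h'⁻¹ : SAut 2 k) : PolyAut 2 k).val.degree * x.totalDegree := by exact_mod_cast h1
    have h3 := PolyEnd.totalDegree_le_degree (F : PolyAut 2 k).val i
    have h4 := one_le_degree ((h'⁻¹ : SAut 2 k) : PolyAut 2 k)
    refine ⟨?_, by omega⟩
    refine le_trans ?_ (h2.symm.le.trans h3)
    exact Nat.le_mul_of_pos_left _ h4

theorem isConj_tri_zero_inv (a : kˣ) : IsConj (tri a 0 0) (tri a⁻¹ 0 0) := by
  refine isConj_iff.mpr ⟨rot k, ?_⟩
  rw [mul_inv_eq_iff_eq_mul]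
  refine SAut.ext_act_two ?_ ?_ <;>
  · rw [SAut.act_mul, SAut.act_mul]
    simp [act_rot_zero, act_rot_one, act_tri_zero, act_tri_one]

/-- A conjugate `F` of a diagonal map is conjugate to it by an automorphism whose degree is bounded
in terms of `F`. -/
theorem exists_conj_degree_le_diag [IsAlgClosed k] (a : kˣ) {F : SAut 2 k}
    (hF : IsConj (tri a 0 0) F) :
    ∃ g : SAut 2 k, g * tri a 0 0 * g⁻¹ = F ∧
      (g : PolyAut 2 k).val.degree ≤ (F : PolyAut 2 k).val.degree ∧
      ((g⁻¹ : SAut 2 k) : PolyAut 2 k).val.degree ≤ (F : PolyAut 2 k).val.degree := by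
  -- a conjugation of minimal degree to the diagonal map or to its inverse
  let N : SAut 2 k → ℕ := fun h => ((h : PolyAut 2 k).val.coord 0).totalDegree +
    ((h : PolyAut 2 k).val.coord 1).totalDegree
  have hex : ∃ n, ∃ (h : SAut 2 k) (b : kˣ),
      (b = a ∨ b = a⁻¹) ∧ h * F * h⁻¹ = tri b 0 0 ∧ N h = n := by
    obtain ⟨c, hc⟩ := isConj_iff.mp hF.symm
    exact ⟨_, c, a, Or.inl rfl, hc, rfl⟩
  classical
  have hrot : ∀ (h : SAut 2 k) (b : kˣ), h * F * h⁻¹ = tri b 0 0 →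
      (rot k * h) * F * (rot k * h)⁻¹ = tri b⁻¹ 0 0 := by
    intro h b hb
    have e1 : (rot k * h) * F * (rot k * h)⁻¹ = rot k * (h * F * h⁻¹) * (rot k)⁻¹ := by group
    rw [e1, hb, mul_inv_eq_iff_eq_mul]
    refine SAut.ext_act_two ?_ ?_ <;>
    · rw [SAut.act_mul, SAut.act_mul]
      simp [act_rot_zero, act_rot_one, act_tri_zero, act_tri_one]
  have hrot0 : ∀ h : SAut 2 k, ((rot k * h : SAut 2 k) : PolyAut 2 k).val.coord 0 =
      (h : PolyAut 2 k).val.coord 1 := fun h => act_rot_zero (h : PolyAut 2 k).val.coord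
  have hrot1 : ∀ h : SAut 2 k, ((rot k * h : SAut 2 k) : PolyAut 2 k).val.coord 1 =
      -(h : PolyAut 2 k).val.coord 0 := fun h => act_rot_one (h : PolyAut 2 k).val.coord
  have hmin : ∀ (h : SAut 2 k) (b : kˣ), (b = a ∨ b = a⁻¹) → h * F * h⁻¹ = tri b 0 0 →
      Nat.find hex ≤ N h := fun h b hb hc => Nat.find_min' hex ⟨h, b, hb, hc, rfl⟩
  obtain ⟨h, b, hb, hc, hN, hle⟩ : ∃ (h : SAut 2 k) (b : kˣ), (b = a ∨ b = a⁻¹) ∧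
      h * F * h⁻¹ = tri b 0 0 ∧ N h = Nat.find hex ∧
      ((h : PolyAut 2 k).val.coord 1).totalDegree ≤ ((h : PolyAut 2 k).val.coord 0).totalDegree :=
          by
    obtain ⟨h, b, hb, hc, hN⟩ := Nat.find_spec hex
    rcases le_total ((h : PolyAut 2 k).val.coord 1).totalDegree
      ((h : PolyAut 2 k).val.coord 0).totalDegree with hle | hle
    · exact ⟨h, b, hb, hc, hN, hle⟩
    · refine ⟨rot k * h, b⁻¹, ?_, hrot h b hc, ?_, ?_⟩
      · rcases hb with rfl | rfl
        · exact Or.inr rfl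
        · exact Or.inl (inv_inv a)
      · rw [← hN]
        simp only [N]
        rw [hrot0, hrot1, totalDegree_neg, add_comm]
      · rwa [hrot0, hrot1, totalDegree_neg]
  have hbound := degree_le_of_conj_diag b hc (by
      rw [degVal_coord, degVal_coord, exp_le_exp]
      exact_mod_cast hle) fun c s hs => by
    by_contra! hlt
    rw [degVal_coord] at hlt
    have hlt' := totalDegree_le_sub_of_degVal_lt (totalDegree_coord_pos _ 0) hlt
    obtain ⟨e, he⟩ : ∃ e : SAut 2 k, e = tri 1 (-(Polynomial.C c * Polynomial.X ^ s)) 0 := ⟨_, rfl⟩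
    have hcomm : e * tri b 0 0 = tri b 0 0 * e := by
      rw [he, tri_mul, tri_mul]
      congr 1
      · rw [mul_comm]
      · have hX : (Polynomial.C ((b⁻¹ : kˣ) : k) * Polynomial.X) ^ s =
            Polynomial.C (b : k) * Polynomial.X ^ s := by
          rw [mul_pow, ← Polynomial.C_pow, ← hs]
        simp only [Units.val_one, Polynomial.C_1, mul_zero, zero_add, Polynomial.neg_comp,
          Polynomial.mul_comp, Polynomial.C_comp, Polynomial.X_pow_comp, Polynomial.C_0, add_zero,
              hX,
          Polynomial.zero_comp]
        ring
      · simp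
    have h1 := hmin (e * h) b hb (by
      have : e * h * F * (e * h)⁻¹ = e * (h * F * h⁻¹) * e⁻¹ := by group
      rw [this, hc, hcomm, mul_inv_cancel_right])
    have h0 : ((e * h : SAut 2 k) : PolyAut 2 k).val.coord 0 =
        (h : PolyAut 2 k).val.coord 0 - C c * (h : PolyAut 2 k).val.coord 1 ^ s := by
      rw [he]
      change PolyEnd.act _ (h : PolyAut 2 k).val.coord 0 = _
      rw [act_tri_zero]
      simp [algebraMap_eq, sub_eq_add_neg]
    have h2 : ((e * h : SAut 2 k) : PolyAut 2 k).val.coord 1 = (h : PolyAut 2 k).val.coord 1 := by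
      rw [he]
      change PolyEnd.act _ (h : PolyAut 2 k).val.coord 1 = _
      rw [act_tri_one]
      simp
    rw [← hN] at h1
    simp only [N] at h1
    rw [h0, h2] at h1
    omega
  rcases hb with rfl | rfl
  · refine ⟨h⁻¹, ?_, hbound.2, by rw [inv_inv]; exact hbound.1⟩
    rw [← hc]
    group
  · have hc' := hrot h a⁻¹ hc
    rw [inv_inv] at hc'
    refine ⟨(rot k * h)⁻¹, ?_, ?_, ?_⟩
    · rw [← hc']
      group
    · rw [mul_inv_rev]
      refine le_trans (PolyEnd.degree_mul_le _ _) ?_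
      refine le_trans (Nat.mul_le_mul_left _ ?_) ((mul_one _).le.trans hbound.2)
      rw [PolyEnd.degree_le_iff, Fin.forall_fin_two, rot_inv_coord_zero, rot_inv_coord_one,
        totalDegree_neg]
      exact ⟨totalDegree_X_le _, totalDegree_X_le _⟩
    · rw [inv_inv, PolyEnd.degree_le_iff, Fin.forall_fin_two, hrot0, hrot1, totalDegree_neg]
      have := (PolyEnd.degree_le_iff _ _).mp hbound.1
      exact ⟨this 1, this 0⟩

end DiagonalDegreeBound

/-! ### Fixed points in families -/

section EtaleFixedPoint

open MvPolynomial

/-- A nondegenerate zero of a system of `n` equations in `n` unknowns persists in a neighbourhood: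
the scheme of nondegenerate zeros is étale over the base, so that its image is open. -/
theorem exists_zero_of_nondegenerate {n : ℕ} {k B : Type*} [Field k] [IsAlgClosed k] [CommRing B]
    [Algebra k B] [Algebra.FiniteType k B] (f : Fin n → MvPolynomial (Fin n) B)
    (δ : MvPolynomial (Fin n) B) (ev₀ : B →ₐ[k] k) (Q₀ : Fin n → k)
    (hf : ∀ i, eval₂Hom ev₀.toRingHom Q₀ (f i) = 0)
    (hdet : eval₂Hom ev₀.toRingHom Q₀ (Matrix.of fun i j => pderiv j (f i)).det ≠ 0)
    (hδ : eval₂Hom ev₀.toRingHom Q₀ δ ≠ 0) :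
    ∃ b, ev₀ b ≠ 0 ∧ ∀ ev : B →ₐ[k] k, ev b ≠ 0 →
      ∃ Q : Fin n → k, (∀ i, eval₂Hom ev.toRingHom Q (f i) = 0) ∧
        eval₂Hom ev.toRingHom Q δ ≠ 0 := by
  let P := Algebra.PreSubmersivePresentation.naive (v := f) id Function.injective_id
  let S := MvPolynomial (Fin n) B ⧸ Ideal.span (Set.range f)
  have hPjac : P.jacobian = Ideal.Quotient.mk _ (Matrix.of fun i j => pderiv j (f i)).det := by
    rw [Algebra.PreSubmersivePresentation.jacobian_eq_jacobiMatrix_det, ← Matrix.det_transpose]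
    have : P.jacobiMatrix.transpose = Matrix.of fun i j => pderiv j (f i) := by
      ext1 i j
      exact Algebra.PreSubmersivePresentation.jacobiMatrix_naive _ _ _ _ j i
    rw [this]
    rfl
  let d : S := P.jacobian * Ideal.Quotient.mk _ δ
  let T := Localization.Away d
  have hunit : IsUnit (algebraMap S T P.jacobian) ∧
      IsUnit (algebraMap S T (Ideal.Quotient.mk _ δ)) := by
    have := IsLocalization.Away.algebraMap_isUnit (S := T) d
    rw [map_mul] at this
    exact IsUnit.mul_iff.mp this
  have : Algebra.IsStandardSmooth B T := by
    let P' := (Algebra.PreSubmersivePresentation.localizationAway T d).comp P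
    refine Algebra.SubmersivePresentation.isStandardSmooth
      { P' with jacobian_isUnit := ?_ }
    change IsUnit P'.jacobian
    rw [Algebra.PreSubmersivePresentation.comp_jacobian_eq_jacobian_smul_jacobian,
      Algebra.PreSubmersivePresentation.localizationAway_jacobian, Algebra.smul_def]
    exact hunit.1.mul (IsLocalization.Away.algebraMap_isUnit d)
  have hopen : IsOpenMap (PrimeSpectrum.comap (algebraMap B T)) :=
    PrimeSpectrum.isOpenMap_comap_of_hasGoingDown_of_finitePresentation
  -- the given zero as a point of `T`
  let e₀ : S →+* k := Ideal.Quotient.lift _ (eval₂Hom ev₀.toRingHom Q₀) fun a ha => by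
    have : Ideal.span (Set.range f) ≤ RingHom.ker (eval₂Hom ev₀.toRingHom Q₀) := by
      rw [Ideal.span_le]
      rintro _ ⟨i, rfl⟩
      exact hf i
    exact this ha
  have he₀ : IsUnit (e₀ d) := by
    rw [map_mul, hPjac]
    exact (mul_ne_zero hdet hδ).isUnit
  let e : T →+* k := IsLocalization.Away.lift d he₀
  have heB : e.comp (algebraMap B T) = ev₀.toRingHom := by
    ext b
    rw [RingHom.comp_apply, IsScalarTower.algebraMap_apply B S T]
    refine (IsLocalization.Away.lift_eq d he₀ _).trans ?_
    exact eval₂Hom_C _ _ b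
  let pt : PrimeSpectrum T := ⟨RingHom.ker e, RingHom.ker_isPrime e⟩
  have hpt : PrimeSpectrum.comap (algebraMap B T) pt =
      ⟨RingHom.ker ev₀.toRingHom, RingHom.ker_isPrime _⟩ := by
    ext1
    change Ideal.comap _ (RingHom.ker e) = _
    rw [RingHom.comap_ker, heB]
  obtain ⟨_, ⟨b, rfl⟩, hb0, hbU⟩ :=
    (PrimeSpectrum.isTopologicalBasis_basic_opens (R := B)).exists_subset_of_mem_open
      (Set.mem_range_self pt) hopen.isOpen_range
  rw [hpt] at hb0
  refine ⟨b, hb0, fun ev hev => ?_⟩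
  obtain ⟨q, hq⟩ := hbU (a := ⟨RingHom.ker ev.toRingHom, RingHom.ker_isPrime _⟩) hev
  have hq' : Ideal.comap (algebraMap B T) q.asIdeal = RingHom.ker ev.toRingHom :=
    congrArg PrimeSpectrum.asIdeal hq
  have : Algebra.FiniteType k T := Algebra.FiniteType.trans (S := B) inferInstance inferInstance
  have : Nontrivial (T ⧸ q.asIdeal) := Ideal.Quotient.nontrivial_iff.mpr q.2.ne_top
  obtain ⟨ψ⟩ := nonempty_algHom_of_finiteType k (T ⧸ q.asIdeal)
  let χ : T →ₐ[k] k := ψ.comp (Ideal.Quotient.mkₐ k q.asIdeal)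
  have hχB : χ.toRingHom.comp (algebraMap B T) = ev.toRingHom := by
    ext b
    have h1 : b - algebraMap k B (ev b) ∈ Ideal.comap (algebraMap B T) q.asIdeal := by
      rw [hq', RingHom.mem_ker]
      change ev _ = 0
      rw [map_sub, AlgHom.commutes]
      exact sub_self _
    have h2 : χ (algebraMap B T (b - algebraMap k B (ev b))) = 0 := by
      change ψ (Ideal.Quotient.mk _ _) = 0
      rw [Ideal.Quotient.eq_zero_iff_mem.mpr (Ideal.mem_comap.mp h1), map_zero]
    rw [map_sub, map_sub, sub_eq_zero, ← IsScalarTower.algebraMap_apply, AlgHom.commutes] at h2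
    exact h2
  let π : MvPolynomial (Fin n) B →+* T := (algebraMap S T).comp (Ideal.Quotient.mk _)
  have hχ : eval₂Hom ev.toRingHom (fun i => χ (π (X i))) = χ.toRingHom.comp π := by
    refine MvPolynomial.ringHom_ext (fun b => ?_) fun i => ?_
    · rw [eval₂Hom_C, ← hχB, RingHom.comp_apply, RingHom.comp_apply,
        IsScalarTower.algebraMap_apply B S T]
      rfl
    · rw [eval₂Hom_X']
      rfl
  refine ⟨fun i => χ (π (X i)), fun i => ?_, ?_⟩
  · rw [hχ, RingHom.comp_apply]
    have : π (f i) = 0 := by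
      change algebraMap S T (Ideal.Quotient.mk _ (f i)) = 0
      rw [Ideal.Quotient.eq_zero_iff_mem.mpr (Ideal.subset_span (Set.mem_range_self i)), map_zero]
    rw [this, map_zero]
  · rw [hχ, RingHom.comp_apply]
    exact (hunit.2.map χ.toRingHom).ne_zero

end EtaleFixedPoint

section FixedPoints

open MvPolynomial

/-- The Jacobian matrix of `f` at the point `Q`. -/
noncomputable def PolyEnd.jacAt {n : ℕ} {R : Type*} [CommRing R] (f : PolyEnd n R) (Q : Fin n → R) :
    Matrix (Fin n) (Fin n) R :=
  f.jacMatrix.map (eval Q)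

theorem PolyEnd.jacAt_mul {n : ℕ} {R : Type*} [CommRing R] (f g : PolyEnd n R) (Q : Fin n → R) :
    (f * g).jacAt Q = f.jacAt (g.act Q) * g.jacAt Q := by
  ext i j
  simp only [jacAt, jacMatrix, Matrix.map_apply, Matrix.of_apply, Matrix.mul_apply, mul_coord,
    pderiv_bind, map_sum, map_mul]
  refine Finset.sum_congr rfl fun m _ => ?_
  congr 1
  have := aeval_bind₁ (R := R) Q g.coord (pderiv m (f.coord i))
  exact this

theorem PolyEnd.jacAt_one {n : ℕ} {R : Type*} [CommRing R] (Q : Fin n → R) :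
    (1 : PolyEnd n R).jacAt Q = 1 := by
  ext i j
  simp [jacAt, jacMatrix, one_coord, pderiv_X, Matrix.one_apply, Pi.single_apply, apply_ite]
  split_ifs with h <;> simp [h]

/-- At corresponding fixed points, conjugate automorphisms have conjugate Jacobian matrices. -/
theorem exists_jacAt_conj {n : ℕ} {R : Type*} [CommRing R] (c f : PolyAut n R) {Q : Fin n → R}
    (hQ : f.val.act Q = Q) :
    ∃ M : (Matrix (Fin n) (Fin n) R)ˣ,
      (c * f * c⁻¹).val.jacAt (c.val.act Q) = M.val * f.val.jacAt Q * M⁻¹.val := by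
  have hc : (c⁻¹).val.act (c.val.act Q) = Q := by
    rw [← PolyEnd.act_mul, Units.inv_mul, PolyEnd.act_one]
  have h : (c * f * c⁻¹).val.jacAt (c.val.act Q) =
      c.val.jacAt Q * f.val.jacAt Q * (c⁻¹).val.jacAt (c.val.act Q) := by
    rw [Units.val_mul, Units.val_mul, PolyEnd.jacAt_mul, PolyEnd.jacAt_mul, hc, hQ]
  refine ⟨⟨c.val.jacAt Q, (c⁻¹).val.jacAt (c.val.act Q), ?_, ?_⟩, h⟩
  · have := PolyEnd.jacAt_mul c.val (c⁻¹).val (c.val.act Q)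
    rwa [hc, Units.mul_inv, PolyEnd.jacAt_one, eq_comm] at this
  · rw [← PolyEnd.jacAt_mul, Units.inv_mul, PolyEnd.jacAt_one]

theorem jacAt_tri_zero {R : Type*} [CommRing R] (a : Rˣ) (Q : Fin 2 → R) :
    (tri a 0 0 : PolyAut 2 R).val.jacAt Q = !![(a : R), 0; 0, ((a⁻¹ : Rˣ) : R)] := by
  ext i j
  simp only [PolyEnd.jacAt, PolyEnd.jacMatrix, Matrix.map_apply, Matrix.of_apply, tri_val]
  fin_cases i <;> fin_cases j <;>
  simp [triEnd_coord_zero, triEnd_coord_one, pderiv_X]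

/-- At every fixed point of a conjugate of `(ax, a⁻¹y)` the Jacobian matrix has trace `a + a⁻¹`. -/
theorem trace_jacAt_of_isConj {R : Type*} [CommRing R] {a : Rˣ} {F : SAut 2 R}
    (hF : IsConj (tri a 0 0) F) {Q : Fin 2 → R} (hQ : (F : PolyAut 2 R).val.act Q = Q) :
    ((F : PolyAut 2 R).val.jacAt Q).trace = a + ((a⁻¹ : Rˣ) : R) := by
  obtain ⟨c, hc⟩ := isConj_iff.mp (IsConj.coe_SAut hF.symm)
  obtain ⟨M, hM⟩ := exists_jacAt_conj c (F : PolyAut 2 R) hQ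
  rw [hc, jacAt_tri_zero] at hM
  have := Matrix.trace_units_conj M ((F : PolyAut 2 R).val.jacAt Q)
  rw [← this, ← hM, Matrix.trace_fin_two]
  simp

theorem exists_fixedPoint_of_isConj {R : Type*} [CommRing R] {a : Rˣ} {F : PolyAut 2 R}
    (hF : IsConj (tri a 0 0 : PolyAut 2 R) F) : ∃ Q : Fin 2 → R, F.val.act Q = Q ∧
      (F.val.jacAt Q).trace = a + ((a⁻¹ : Rˣ) : R) ∧
      (F.val.jacAt Q - 1).det = (a - 1) * (((a⁻¹ : Rˣ) : R) - 1) := by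
  obtain ⟨c, rfl⟩ := isConj_iff.mp hF
  have h0 : (tri a 0 0 : PolyAut 2 R).val.act (0 : Fin 2 → R) = 0 := by
    funext i
    fin_cases i
    · exact (act_tri_zero _ _ _ _).trans (by simp)
    · exact (act_tri_one _ _ _ _).trans (by simp)
  obtain ⟨M, hM⟩ := exists_jacAt_conj c _ h0
  refine ⟨c.val.act 0, ?_, ?_, ?_⟩
  · rw [Units.val_mul, Units.val_mul, PolyEnd.act_mul, PolyEnd.act_mul, ← PolyEnd.act_mul _ c.val,
      Units.inv_mul, PolyEnd.act_one, h0]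
  · rw [hM, Matrix.trace_units_conj, jacAt_tri_zero, Matrix.trace_fin_two]
    simp
  · have : M.val * (tri a 0 0 : PolyAut 2 R).val.jacAt 0 * M⁻¹.val - 1 =
        M.val * ((tri a 0 0 : PolyAut 2 R).val.jacAt 0 - 1) * M⁻¹.val := by
      rw [mul_sub, sub_mul, mul_one, Units.mul_inv]
    rw [hM, this, Matrix.det_units_conj, jacAt_tri_zero, Matrix.det_fin_two]
    simp

/-- The eigenvalues at a nondegenerate fixed point do not change in the limit. -/
theorem add_inv_eq_of_limit {k B : Type*} [Field k] [IsAlgClosed k] [CommRing B] [Algebra k B]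
    [Algebra.FiniteType k B] {a α : kˣ} (F : PolyAut 2 B) (ev₀ : B →ₐ[k] k)
    (hlim : ∀ b, ev₀ b ≠ 0 → ∃ ev : B →ₐ[k] k, (∃ F' : SAut 2 k, IsConj (tri a 0 0) F' ∧
      (F' : PolyAut 2 k) = PolyAut.map ev.toRingHom F) ∧ ev b ≠ 0)
    (hα : α ≠ 1) (h0 : IsConj (tri α 0 0 : PolyAut 2 k) (PolyAut.map ev₀.toRingHom F)) :
    (α : k) + ((α⁻¹ : kˣ) : k) = a + ((a⁻¹ : kˣ) : k) := by
  by_contra hne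
  obtain ⟨Q₀, hQ₀, htr, hdet⟩ := exists_fixedPoint_of_isConj h0
  have heval : ∀ (ev : B →ₐ[k] k) (Q : Fin 2 → k) (p : MvPolynomial (Fin 2) B),
      eval₂Hom ev.toRingHom Q p = eval Q (MvPolynomial.map ev.toRingHom p) := fun ev Q p =>
    eval₂_eq_eval_map _ _ _
  have hfix : ∀ (ev : B →ₐ[k] k) (Q : Fin 2 → k) (i : Fin 2),
      eval₂Hom ev.toRingHom Q (F.val.coord i - X i) =
        (PolyAut.map ev.toRingHom F).val.act Q i - Q i := by
    intro ev Q i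
    rw [heval, map_sub, map_sub, map_X, eval_X]
    rfl
  have htrace : ∀ (ev : B →ₐ[k] k) (Q : Fin 2 → k),
      eval₂Hom ev.toRingHom Q (pderiv 0 (F.val.coord 0) + pderiv 1 (F.val.coord 1) -
        C (algebraMap k B (a + ((a⁻¹ : kˣ) : k)))) =
      ((PolyAut.map ev.toRingHom F).val.jacAt Q).trace - (a + ((a⁻¹ : kˣ) : k)) := by
    intro ev Q
    rw [Matrix.trace_fin_two, map_sub, map_add, eval₂Hom_C, heval, heval, ← pderiv_map,
        ← pderiv_map]
    congr 1
    exact ev.commutes _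
  obtain ⟨b, hb, hb'⟩ := exists_zero_of_nondegenerate (fun i => F.val.coord i - X i)
    (pderiv 0 (F.val.coord 0) + pderiv 1 (F.val.coord 1) -
        C (algebraMap k B (a + ((a⁻¹ : kˣ) : k)))) ev₀ Q₀
    (fun i => by rw [hfix, hQ₀, sub_self])
    (by
      rw [RingHom.map_det]
      have : (eval₂Hom ev₀.toRingHom Q₀).mapMatrix
          (Matrix.of fun i j => pderiv j (F.val.coord i - X i)) =
          (PolyAut.map ev₀.toRingHom F).val.jacAt Q₀ - 1 := by
        ext i j
        rw [RingHom.mapMatrix_apply, Matrix.map_apply, Matrix.of_apply, map_sub, map_sub, heval,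
          ← pderiv_map, Matrix.sub_apply, pderiv_X, Matrix.one_apply, Pi.single_apply, heval]
        congr 1
        simp only [apply_ite, map_zero, map_one]
        split_ifs <;> rfl
      rw [this, hdet]
      have h1 : (α : k) ≠ 1 := fun h => hα (Units.ext h)
      refine mul_ne_zero (sub_ne_zero.mpr h1) (sub_ne_zero.mpr fun h => hα ?_)
      exact inv_eq_one.mp (Units.ext h))
    (by rw [htrace, htr]; exact sub_ne_zero.mpr hne)
  obtain ⟨ev, ⟨F', hF', hF'F⟩, hev⟩ := hlim b hb
  obtain ⟨Q, hQ, hQ'⟩ := hb' ev hev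
  refine hQ' ?_
  rw [htrace, ← hF'F, trace_jacAt_of_isConj hF', sub_self]
  funext i
  have := hQ i
  rwa [hfix, sub_eq_zero, ← hF'F] at this

end FixedPoints

/-! ### Diagonalisable special automorphisms -/

section Diagonalisable

open MvPolynomial

/-- A special automorphism that is diagonalisable in `Aut(𝔸²)` is conjugate to a diagonal map in
`SAut(𝔸²)`: rescale the conjugating automorphism by a diagonal one. -/
theorem exists_isConj_tri_zero_of_isDiagonalisable {k : Type*} [Field k] {f : SAut 2 k}
    (hf : IsDiagonalisable (f : PolyAut 2 k)) : ∃ a : kˣ, IsConj (tri a 0 0) f := by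
  obtain ⟨g, a, ha⟩ := hf
  have hgunit : IsUnit g.val.jac := by
    have h1 := PolyEnd.jac_mul (g⁻¹).val g.val
    rw [Units.inv_mul, PolyEnd.jac_one] at h1
    exact IsUnit.of_mul_eq_one _ ((mul_comm _ _).trans h1.symm)
  obtain ⟨c, hc, hgc⟩ := MvPolynomial.isUnit_iff_eq_C_of_isReduced.mp hgunit
  lift c to kˣ using hc
  obtain ⟨D, hD⟩ : ∃ D, D = g * f * g⁻¹ := ⟨_, rfl⟩
  rw [← hD] at ha
  have hDjac : D.val.jac = C (a 0 * a 1) := by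
    rw [PolyEnd.jac_two, ha, ha]
    simp [pderiv_X]
  have h01 : a 0 * a 1 = 1 := by
    have e : D * g = g * f := by rw [hD]; group
    have h1 := PolyEnd.jac_mul D.val g.val
    have h2 := PolyEnd.jac_mul g.val (f : PolyAut 2 k).val
    rw [hDjac, hgc, bind₁_C_right, ← Units.val_mul, e, Units.val_mul, h2, hgc, bind₁_C_right,
      show (f : PolyAut 2 k).val.jac = 1 from f.2, mul_one, ← C_mul] at h1
    have h3 := C_injective _ _ h1
    exact (mul_right_cancel₀ c.ne_zero ((one_mul _).trans h3)).symm
  -- the diagonal map `(c⁻¹x, y)`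
  obtain ⟨E, hE0, hE1⟩ : ∃ E : PolyAut 2 k,
      E.val.coord 0 = C (c : k)⁻¹ * X 0 ∧ E.val.coord 1 = X 1 := by
    have h1 : (C (c : k)⁻¹ * C (c : k) : MvPolynomial (Fin 2) k) = 1 := by
      rw [← C_mul, inv_mul_cancel₀ c.ne_zero, C_1]
    refine ⟨⟨⟨![C (c : k)⁻¹ * X 0, X 1]⟩, ⟨![C (c : k) * X 0, X 1]⟩, ?_, ?_⟩, rfl, rfl⟩
    · refine PolyEnd.ext_two ?_ ?_
      · rw [PolyEnd.mul_coord, PolyEnd.one_coord]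
        simp [← mul_assoc]
        exact h1
      · rw [PolyEnd.mul_coord, PolyEnd.one_coord]
        simp
    · refine PolyEnd.ext_two ?_ ?_
      · rw [PolyEnd.mul_coord, PolyEnd.one_coord]
        simp
        linear_combination X 0 * h1
      · rw [PolyEnd.mul_coord, PolyEnd.one_coord]
        simp
  have hEjac : E.val.jac = C (c : k)⁻¹ := by
    rw [PolyEnd.jac_two, hE0, hE1]
    simp [pderiv_X]
  have hED : E * D = D * E := by
    refine Units.ext (PolyEnd.ext_two ?_ ?_)
    · rw [Units.val_mul, Units.val_mul, PolyEnd.mul_coord, PolyEnd.mul_coord, ha, hE0]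
      simp [ha, hE0]
      ring
    · rw [Units.val_mul, Units.val_mul, PolyEnd.mul_coord, PolyEnd.mul_coord, ha, hE1]
      simp [ha, hE1]
  have hEg : E * g ∈ SAut 2 k := by
    rw [mem_SAut, Units.val_mul, PolyEnd.jac_mul, hEjac, hgc, bind₁_C_right, ← C_mul,
      inv_mul_cancel₀ c.ne_zero, C_1]
  refine ⟨⟨a 0, a 1, h01, by rw [mul_comm, h01]⟩, IsConj.symm (isConj_iff.mpr ⟨⟨E * g, hEg⟩, ?_⟩)⟩
  have e : E * g * f * (E * g)⁻¹ = D := by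
    rw [mul_inv_rev, ← mul_assoc]
    have : E * g * f * g⁻¹ = E * D := by rw [hD]; group
    rw [this, hED, mul_inv_cancel_right]
  refine SAut.ext_end ?_
  change (E * g * f * (E * g)⁻¹).val = _
  rw [e]
  refine PolyEnd.ext_two ?_ ?_
  · rw [ha, tri_val, triEnd_coord_zero]
    simp
  · rw [ha, tri_val, triEnd_coord_one]
    simp

end Diagonalisable

/-! ### Locally diagonalisable actions on polynomials -/

section LocallyDiagonalisable

variable {k V W : Type*} [Field k] [AddCommGroup V] [Module k V] [AddCommGroup W] [Module k W]

/-- The endomorphism `T` is locally diagonalisable: every vector is killed by a polynomial in `T`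
which is a product of distinct linear factors, that is, every vector is a sum of eigenvectors. -/
def IsLocallyDiag (T : Module.End k V) : Prop :=
  ∀ v, ∃ s : Finset k, Polynomial.aeval T (∏ μ ∈ s, (Polynomial.X - Polynomial.C μ)) v = 0

variable {T : Module.End k V} {T' : Module.End k W}

theorem map_aeval_end (φ : V →ₗ[k] W) (h : ∀ v, φ (T v) = T' (φ v)) (p : Polynomial k) (v : V) :
    φ (Polynomial.aeval T p v) = Polynomial.aeval T' p (φ v) := by
  induction p using Polynomial.induction_on generalizing v with
  | C a => simp [Module.algebraMap_end_apply]
  | add p q hp hq => simp [hp, hq]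
  | monomial n a ih =>
    rw [pow_succ, ← mul_assoc, map_mul (Polynomial.aeval T) _ Polynomial.X,
      map_mul (Polynomial.aeval T') _ Polynomial.X, Module.End.mul_apply, Module.End.mul_apply, ih,
      Polynomial.aeval_X, Polynomial.aeval_X, h]

theorem IsLocallyDiag.of_surjective (hT : IsLocallyDiag T) (φ : V →ₗ[k] W)
    (h : ∀ v, φ (T v) = T' (φ v)) (hφ : Function.Surjective φ) : IsLocallyDiag T' := by
  intro w
  obtain ⟨v, rfl⟩ := hφ w
  obtain ⟨s, hs⟩ := hT v
  exact ⟨s, by rw [← map_aeval_end φ h, hs, map_zero]⟩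

theorem IsLocallyDiag.of_injective (hT : IsLocallyDiag T') (φ : V →ₗ[k] W)
    (h : ∀ v, φ (T v) = T' (φ v)) (hφ : Function.Injective φ) : IsLocallyDiag T := by
  intro v
  obtain ⟨s, hs⟩ := hT (φ v)
  exact ⟨s, hφ (by rw [map_aeval_end φ h, hs, map_zero])⟩

theorem aeval_prod_eq_zero_of_subset [DecidableEq k] {s t : Finset k} (hst : s ⊆ t) {v : V}
    (h : Polynomial.aeval T (∏ μ ∈ s, (Polynomial.X - Polynomial.C μ)) v = 0) :
    Polynomial.aeval T (∏ μ ∈ t, (Polynomial.X - Polynomial.C μ)) v = 0 := by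
  rw [← Finset.prod_sdiff hst, map_mul, Module.End.mul_apply, h, map_zero]

/-- There are no Jordan blocks of size two. -/
theorem IsLocallyDiag.eq_zero (hT : IsLocallyDiag T) {μ : k} {v w : V} (hv : T v = μ • v + w)
    (hw : T w = μ • w) : w = 0 := by
  classical
  obtain ⟨s, hs⟩ := hT v
  replace hs := aeval_prod_eq_zero_of_subset (Finset.subset_insert μ s) hs
  rw [← Finset.insert_erase (Finset.mem_insert_self μ s),
    Finset.prod_insert (Finset.notMem_erase _ _), mul_comm, map_mul, Module.End.mul_apply] at hs
  have h1 : Polynomial.aeval T (Polynomial.X - Polynomial.C μ) v = w := by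
    simp [hv, Module.algebraMap_end_apply]
  rw [h1] at hs
  by_contra hw0
  rw [Module.End.aeval_apply_of_hasEigenvector (μ := μ) ⟨Module.End.mem_eigenspace_iff.mpr hw, hw0⟩,
    smul_eq_zero, or_iff_left hw0, Polynomial.eval_prod, Finset.prod_eq_zero_iff] at hs
  obtain ⟨ν, hν, h0⟩ := hs
  rw [Polynomial.eval_sub, Polynomial.eval_X, Polynomial.eval_C, sub_eq_zero] at h0
  exact Finset.ne_of_mem_erase hν h0.symm

end LocallyDiagonalisable

section Pullback

open MvPolynomial

variable {n : ℕ} (k : Type*) [Field k] {R : Type*} [CommRing R] [Algebra k R]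

/-- The action `P ↦ P ∘ f` of an endomorphism `f` on polynomials, as a `k`-linear map. -/
noncomputable def PolyEnd.pullback (f : PolyEnd n R) : Module.End k (MvPolynomial (Fin n) R) :=
  ((bind₁ f.coord).restrictScalars k).toLinearMap

theorem PolyEnd.pullback_apply (f : PolyEnd n R) (P : MvPolynomial (Fin n) R) :
    f.pullback k P = bind₁ f.coord P := rfl

theorem PolyEnd.pullback_mul (f g : PolyEnd n R) (P : MvPolynomial (Fin n) R) :
    (f * g).pullback k P = g.pullback k (f.pullback k P) :=
  (bind₁_bind₁ f.coord g.coord P).symm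

theorem PolyEnd.pullback_map {S : Type*} [CommRing S] [Algebra k S] (φ : R →+* S) (f : PolyEnd n R)
    (P : MvPolynomial (Fin n) R) :
    MvPolynomial.map φ (f.pullback k P) = (PolyEnd.map φ f).pullback k (MvPolynomial.map φ P) :=
  MvPolynomial.map_bind₁ φ f.coord P

variable {k}

theorem IsLocallyDiag.pullback_of_isConj {f g : PolyAut n R}
    (hf : IsLocallyDiag (f.val.pullback k)) (h : IsConj f g) :
    IsLocallyDiag (g.val.pullback k) := by
  obtain ⟨c, rfl⟩ := isConj_iff.mp h
  refine hf.of_surjective ((c⁻¹).val.pullback k) (fun P => ?_) fun P => ⟨c.val.pullback k P, ?_⟩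
  · rw [← PolyEnd.pullback_mul, ← PolyEnd.pullback_mul, ← Units.val_mul, ← Units.val_mul]
    congr 3
    group
  · rw [← PolyEnd.pullback_mul, Units.mul_inv]
    exact congrFun (congrArg DFunLike.coe bind₁_X_left) P

theorem isLocallyDiag_pullback_tri_zero (a : kˣ) :
    IsLocallyDiag ((SAut.map (algebraMap k R) (tri a 0 0) : PolyAut 2 R).val.pullback k) := by
  classical
  intro P
  induction P using MvPolynomial.induction_on' with
  | monomial m r =>
    refine ⟨{(a : k) ^ m 0 * ((a⁻¹ : kˣ) : k) ^ m 1}, ?_⟩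
    have hprod : ∀ g : Fin 2 → MvPolynomial (Fin 2) R,
        ∏ i ∈ m.support, g i ^ m i = g 0 ^ m 0 * g 1 ^ m 1 := fun g => by
      rw [← Fin.prod_univ_two (fun i => g i ^ m i)]
      exact Finset.prod_subset (Finset.subset_univ _) fun i _ hi => by
        rw [Finsupp.notMem_support_iff.mp hi, pow_zero]
    rw [Finset.prod_singleton, map_sub, Polynomial.aeval_X, Polynomial.aeval_C, LinearMap.sub_apply,
      Module.algebraMap_end_apply, sub_eq_zero, PolyEnd.pullback_apply, bind₁_monomial,
      map_tri, tri_val, hprod, triEnd_coord_zero, triEnd_coord_one, monomial_eq, Finsupp.prod,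
          hprod,
      Algebra.smul_def, MvPolynomial.algebraMap_apply, ← map_inv]
    simp [mul_pow, -inv_pow]
    ring
  | add p q hp hq =>
    obtain ⟨s, hs⟩ := hp
    obtain ⟨t, ht⟩ := hq
    refine ⟨s ∪ t, ?_⟩
    rw [map_add, aeval_prod_eq_zero_of_subset Finset.subset_union_left hs,
      aeval_prod_eq_zero_of_subset Finset.subset_union_right ht, add_zero]

end Pullback

section DiagonalLimit

open MvPolynomial IsLocalRing

variable {k : Type*} [Field k]

/-- A locally diagonalisable triangular map is conjugate to a diagonal one. -/
theorem IsTri.exists_isConj_tri_zero {b : SAut 2 k} (hb : IsTri b)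
    (hd : IsLocallyDiag ((b : PolyAut 2 k).val.pullback k)) : ∃ α : kˣ, IsConj b (tri α 0 0) := by
  rcases hb.exists_isConj_normalized with ⟨α, p, h⟩ | ⟨p, h⟩
  · -- remove all terms of `p` except those that commute with the diagonal part
    obtain ⟨q, hq⟩ : ∃ q : Polynomial k, ∀ j, q.coeff j =
        p.coeff j / ((α : k) - ((α⁻¹ : kˣ) : k) ^ j) := by
      refine ⟨∑ j ∈ p.support, Polynomial.monomial j (p.coeff j / ((α : k) - ((α⁻¹ : kˣ) : k) ^ j)),
        fun j => ?_⟩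
      simp only [Polynomial.finsetSum_coeff, Polynomial.coeff_monomial, Finset.sum_ite_eq']
      split_ifs with h0
      · rfl
      · rw [Polynomial.notMem_support_iff.mp h0, zero_div]
    obtain ⟨p', hp'⟩ : ∃ p' : Polynomial k, p' = p - Polynomial.C (α : k) * q +
        q.comp (Polynomial.C ((α⁻¹ : kˣ) : k) * Polynomial.X) := ⟨_, rfl⟩
    have hres : p'.comp (Polynomial.C ((α⁻¹ : kˣ) : k) * Polynomial.X) =
        Polynomial.C (α : k) * p' := by
      ext j
      rw [Polynomial.comp_C_mul_X_coeff, Polynomial.coeff_C_mul, hp', Polynomial.coeff_add,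
        Polynomial.coeff_sub, Polynomial.coeff_C_mul, Polynomial.comp_C_mul_X_coeff, hq]
      by_cases h0 : (α : k) - ((α⁻¹ : kˣ) : k) ^ j = 0
      · rw [sub_eq_zero.mp h0, mul_comm]
      · have e : p.coeff j = p.coeff j / ((α : k) - ((α⁻¹ : kˣ) : k) ^ j) *
            ((α : k) - ((α⁻¹ : kˣ) : k) ^ j) := (div_mul_cancel₀ _ h0).symm
        linear_combination (((α⁻¹ : kˣ) : k) ^ j - α) * e
    have hconj : IsConj (tri α p 0) (tri α p' 0) := by
      refine isConj_iff.mpr ⟨tri 1 q 0, ?_⟩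
      rw [mul_inv_eq_iff_eq_mul, tri_mul, tri_mul]
      congr 1
      · rw [mul_comm]
      · simp [hp']
        ring
      · simp
    have hd' := hd.pullback_of_isConj (IsConj.coe_SAut (h.trans hconj))
    have hx : (tri α p' 0 : PolyAut 2 k).val.pullback k (X 0) =
        (α : k) • X 0 + Polynomial.aeval (X 1) p' := by
      rw [PolyEnd.pullback_apply, bind₁_X_right, tri_val, triEnd_coord_zero, smul_eq_C_mul]
    have hy : (tri α p' 0 : PolyAut 2 k).val.pullback k (Polynomial.aeval (X 1) p') =
        (α : k) • Polynomial.aeval (X 1 : MvPolynomial (Fin 2) k) p' := by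
      have h1 := congrArg (Polynomial.aeval (X 1 : MvPolynomial (Fin 2) k)) hres
      rw [PolyEnd.pullback_apply, bind₁_polynomial_aeval, tri_val, triEnd_coord_one, smul_eq_C_mul]
      rw [Polynomial.aeval_comp] at h1
      simpa [algebraMap_eq] using h1
    have h0 := hd'.eq_zero hx hy
    have hp0 : p' = 0 := by
      by_contra hne
      have h1 := Valuation.map_polynomial_aeval (v := degVal) (fun c hc => degVal_algebraMap hc)
        (y := (X 1 : MvPolynomial (Fin 2) k))
        (by rw [degVal_X, ← WithZero.exp_zero, WithZero.exp_lt_exp]; exact one_pos) hne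
      rw [h0, map_zero, degVal_X] at h1
      exact pow_ne_zero _ WithZero.exp_ne_zero h1.symm
    exact ⟨α, hp0 ▸ h.trans hconj⟩
  · exfalso
    have hd' := hd.pullback_of_isConj (IsConj.coe_SAut h)
    refine one_ne_zero (hd'.eq_zero (μ := 1) (v := (X 1 : MvPolynomial (Fin 2) k)) (w := 1) ?_ ?_)
    · rw [PolyEnd.pullback_apply, bind₁_X_right, tri_val, triEnd_coord_one]
      simp
    · rw [PolyEnd.pullback_apply, map_one, one_smul]

theorem IsAlgebraicAut.map {n : ℕ} {R S : Type*} [CommRing R] [CommRing S] (φ : R →+* S)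
    {f : PolyAut n R} (hf : IsAlgebraicAut f) : IsAlgebraicAut (PolyAut.map φ f) := by
  obtain ⟨d, hd⟩ := hf
  refine ⟨d, ?_⟩
  rintro _ ⟨m, rfl⟩
  refine le_trans ?_ (hd ⟨m, rfl⟩)
  change (PolyAut.map φ f ^ m).val.degree ≤ _
  rw [← map_pow]
  exact PolyEnd.degree_map_le _ _

theorem IsAlgebraicAut.of_map {n : ℕ} {R S : Type*} [CommRing R] [CommRing S] {φ : R →+* S}
    (hφ : Function.Injective φ) {f : PolyAut n R} (hf : IsAlgebraicAut (PolyAut.map φ f)) :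
    IsAlgebraicAut f := by
  obtain ⟨d, hd⟩ := hf
  refine ⟨d, ?_⟩
  rintro _ ⟨m, rfl⟩
  refine le_trans ?_ (hd ⟨m, rfl⟩)
  change _ ≤ (PolyAut.map φ f ^ m).val.degree
  rw [← map_pow, PolyEnd.degree_le_iff]
  intro i
  refine le_trans ?_ (PolyEnd.totalDegree_le_degree _ i)
  exact (Finset.sup_mono (support_map_of_injective _ hφ).ge)

theorem isAlgebraicAut_of_residue {K : Type*} [Field K] (O : ValuationSubring K) [Algebra k O]
    {n : ℕ} {F : PolyAut n O} {F₀ : PolyAut n k}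
    (hF : IsAlgebraicAut (PolyAut.map (algebraMap O K) F))
    (hres : PolyAut.map (residue O) F = PolyAut.map (algebraMap k (ResidueField O)) F₀) :
    IsAlgebraicAut F₀ := by
  refine IsAlgebraicAut.of_map (algebraMap k (ResidueField O)).injective ?_
  rw [← hres]
  exact IsAlgebraicAut.map _ (IsAlgebraicAut.of_map (φ := algebraMap O K) Subtype.val_injective hF)

variable {K : Type*} [Field K] [Algebra k K] (O : ValuationSubring K) [Algebra k O]
  [IsScalarTower k O K]

theorem isLocallyDiag_pullback_of_residue {n : ℕ} {F : PolyAut n O} {F₀ : PolyAut n k}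
    (hF : IsLocallyDiag ((PolyAut.map (algebraMap O K) F).val.pullback k))
    (hres : PolyAut.map (residue O) F = PolyAut.map (algebraMap k (ResidueField O)) F₀) :
    IsLocallyDiag (F₀.val.pullback k) := by
  have hOK : Function.Injective (algebraMap O K) := Subtype.val_injective
  have h2 : IsLocallyDiag (F.val.pullback k) :=
    hF.of_injective (MvPolynomial.mapAlgHom (IsScalarTower.toAlgHom k O K)).toLinearMap
      (fun P => PolyEnd.pullback_map k (algebraMap O K) _ P)
      (MvPolynomial.map_injective _ hOK)
  have h3 : IsLocallyDiag ((PolyAut.map (residue O) F).val.pullback k) :=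
    h2.of_surjective (MvPolynomial.mapAlgHom
        (IsScalarTower.toAlgHom k O (ResidueField O))).toLinearMap
      (fun P => PolyEnd.pullback_map k (residue O) _ P)
      (MvPolynomial.map_surjective _ residue_surjective)
  rw [hres] at h3
  exact h3.of_injective (MvPolynomial.mapAlgHom (Algebra.ofId k (ResidueField O))).toLinearMap
    (fun P => PolyEnd.pullback_map k (algebraMap k (ResidueField O)) _ P)
    (MvPolynomial.map_injective _ (algebraMap k (ResidueField O)).injective)

/-- The reduction of a primitive multiple of an eigenvector is an eigenvector: if conjugates of
`(ax, a⁻¹y)` tend to the identity, then `a = 1`. -/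
theorem eq_one_of_residue_eq_one {a : kˣ} (F : PolyAut 2 O) (G : SAut 2 K)
    (hG : ((G * SAut.map (algebraMap k K) (tri a 0 0) * G⁻¹ : SAut 2 K) : PolyAut 2 K) =
      PolyAut.map (algebraMap O K) F)
    (hF : PolyAut.map (residue O) F = 1) : a = 1 := by
  obtain ⟨c, P, hc, hcP, hP⟩ := exists_eq_C_mul_map O
    (coord_ne_zero ((G⁻¹ : SAut 2 K) : PolyAut 2 K) 0)
  have h1 : bind₁ (PolyAut.map (algebraMap O K) F).val.coord
      (((G⁻¹ : SAut 2 K) : PolyAut 2 K).val.coord 0) =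
      C (algebraMap k K a) * ((G⁻¹ : SAut 2 K) : PolyAut 2 K).val.coord 0 := by
    rw [← hG]
    have e : G⁻¹ * (G * SAut.map (algebraMap k K) (tri a 0 0) * G⁻¹) =
      SAut.map (algebraMap k K) (tri a 0 0) * G⁻¹ := by group
    refine (congrArg (fun f : SAut 2 K => (f : PolyAut 2 K).val.coord 0) e).trans ?_
    change PolyEnd.act _ (((G⁻¹ : SAut 2 K) : PolyAut 2 K).val.coord) 0 = _
    rw [map_tri, act_tri_zero, Polynomial.map_zero, map_zero, add_zero]
    rfl
  have h2 : bind₁ F.val.coord P = C (algebraMap k O a) * P := by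
    apply MvPolynomial.map_injective (algebraMap O K) Subtype.val_injective
    have hCc : (C c : MvPolynomial (Fin 2) K) ≠ 0 := by simpa using hc
    apply mul_left_cancel₀ hCc
    rw [hcP, map_mul, bind₁_C_right] at h1
    rw [MvPolynomial.map_bind₁]
    refine h1.trans ?_
    rw [map_mul, map_C, ← IsScalarTower.algebraMap_apply]
    ring
  have h3 := congrArg (MvPolynomial.map (residue O)) h2
  have h4 : (fun i => MvPolynomial.map (residue O) (F.val.coord i)) = X :=
    congrArg (fun f : PolyAut 2 (ResidueField O) => f.val.coord) hF
  rw [MvPolynomial.map_bind₁, h4, bind₁_X_left, AlgHom.id_apply, map_mul, map_C] at h3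
  have h5 : C (algebraMap k (ResidueField O) a) = (1 : MvPolynomial (Fin 2) (ResidueField O)) :=
    mul_right_cancel₀ hP (h3.symm.trans (one_mul _).symm)
  rw [← C_1] at h5
  refine Units.ext ((algebraMap k (ResidueField O)).injective ?_)
  rw [C_injective _ _ h5, Units.val_one, map_one]

end DiagonalLimit

/-! ### Conjugacy classes of diagonalisable automorphisms -/

section DiagonalClosed

/-- Diagonal maps `(ax, a⁻¹y)` have closed conjugacy classes: a limit is conjugate to some
`(αx, α⁻¹y)`, and `α` is determined by `a` up to inversion. -/
theorem isClosed_conj_tri_zero {k : Type u} [Field k] [IsAlgClosed k] (a : kˣ) :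
    IsClosed {F : PolyAut 2 k | ∃ F' : SAut 2 k,
        IsConj (tri a 0 0) F' ∧ (F' : PolyAut 2 k) = F} := by
  refine isClosed_of_forall_family ?_
  intro B _ _ _ F ev₀ hlim
  obtain ⟨K, _, _, O, _, _, β, G, hG, hres⟩ := exists_valuationSubring_of_limit (tri a 0 0) 1
    (fun F' hF' => by simpa using exists_conj_degree_le_diag a hF') F ev₀ hlim
  have hF0 : PolyAut.map ev₀.toRingHom F ∈ SAut 2 k := mem_SAut_of_limit F ev₀ fun b hb => by
    obtain ⟨ev, ⟨F', -, hF'⟩, hev⟩ := hlim b hb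
    exact ⟨ev, hF' ▸ F'.2, hev⟩
  have hresF : PolyAut.map (IsLocalRing.residue O) (PolyAut.map β F) =
      PolyAut.map (algebraMap k (IsLocalRing.ResidueField O)) (PolyAut.map ev₀.toRingHom F) := by
    rw [PolyAut.map_map, hres, ← PolyAut.map_map]
  have hconjK : IsConj (SAut.map (algebraMap k K) (tri a 0 0) : PolyAut 2 K)
      (PolyAut.map (algebraMap O K) (PolyAut.map β F)) := by
    rw [← hG]
    exact IsConj.coe_SAut (isConj_iff.mpr ⟨G, rfl⟩)
  have halg : IsAlgebraicAut (PolyAut.map ev₀.toRingHom F) :=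
    isAlgebraicAut_of_residue O
      ((IsAlgebraicAut.map _ (isTri_tri a 0 0).isAlgebraicAut).of_isConj hconjK) hresF
  have hdiag : IsLocallyDiag ((PolyAut.map ev₀.toRingHom F).val.pullback k) :=
    isLocallyDiag_pullback_of_residue O
      ((isLocallyDiag_pullback_tri_zero (R := K) a).pullback_of_isConj hconjK) hresF
  obtain ⟨F₀, hF₀⟩ : ∃ F₀ : SAut 2 k, (F₀ : PolyAut 2 k) = PolyAut.map ev₀.toRingHom F :=
    ⟨⟨_, hF0⟩, rfl⟩
  rw [← hF₀] at halg hdiag hresF ⊢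
  obtain ⟨b, hb, hFb⟩ := exists_isTri_of_isAlgebraicAut halg
  obtain ⟨α, hbα⟩ := hb.exists_isConj_tri_zero (hdiag.pullback_of_isConj (IsConj.coe_SAut hFb))
  have hα := (hFb.trans hbα).symm
  refine ⟨F₀, ?_, rfl⟩
  suffices α = a ∨ α = a⁻¹ by
    rcases this with rfl | rfl
    · exact hα
    · exact (isConj_tri_zero_inv a).trans hα
  by_cases hα1 : α = 1
  · left
    rw [hα1, tri_one] at hα
    rw [isConj_one_right.mp hα, OneMemClass.coe_one, map_one] at hresF
    rw [hα1, eq_one_of_residue_eq_one O _ G hG hresF]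
  · have h := add_inv_eq_of_limit F ev₀ hlim hα1 (hF₀ ▸ IsConj.coe_SAut hα)
    have h1 : ((α : k) - a) * ((α : k) - ((a⁻¹ : kˣ) : k)) = 0 := by
      have e1 : (α : k) * ((α⁻¹ : kˣ) : k) = 1 := Units.mul_inv α
      have e2 : (a : k) * ((a⁻¹ : kˣ) : k) = 1 := Units.mul_inv a
      linear_combination (α : k) * h - e1 + e2
    rcases mul_eq_zero.mp h1 with h2 | h2
    · exact Or.inl (Units.ext (sub_eq_zero.mp h2))
    · exact Or.inr (Units.ext (sub_eq_zero.mp h2))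

theorem isClosed_conjugatesOf_of_isDiagonalisable {k : Type u} [Field k] [IsAlgClosed k]
    {f : SAut 2 k} (hf : IsDiagonalisable (f : PolyAut 2 k)) : IsClosed (conjugatesOf f) := by
  obtain ⟨a, ha⟩ := exists_isConj_tri_zero_of_isDiagonalisable hf
  refine isClosed_of_isClosed_image ?_
  convert isClosed_conj_tri_zero a using 3
  rw [← isConj_iff_conjugatesOf_eq.mp ha]
  rfl

end DiagonalClosed

end AffineAut

theorem theorem2 {k : Type u} [Field k] [IsAlgClosed k] (f : AffineAut.SAut 2 k) :
    (AffineAut.IsDiagonalisable (f : AffineAut.PolyAut 2 k) → IsClosed (conjugatesOf f)) ∧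
    (AffineAut.IsAlgebraicAut (f : AffineAut.PolyAut 2 k) →
      ¬ AffineAut.IsDiagonalisable (f : AffineAut.PolyAut 2 k) →
        ¬ IsClosed (conjugatesOf f) ∧
        ∃ F : AffineAut.SAut 2 (Polynomial k),
          (∀ t : k, t ≠ 0 → IsConj f (AffineAut.SAut.value F t)) ∧
          AffineAut.IsDiagonalisable (AffineAut.SAut.value F 0 : AffineAut.PolyAut 2 k)) ∧
    (¬ AffineAut.IsAlgebraicAut (f : AffineAut.PolyAut 2 k) → IsClosed (conjugatesOf f)) := by
  exact ⟨AffineAut.isClosed_conjugatesOf_of_isDiagonalisable,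
    fun h hd => ⟨AffineAut.not_isClosed_conjugatesOf h hd, AffineAut.exists_degeneration h⟩,
    AffineAut.isClosed_conjugatesOf_of_not_isAlgebraicAut⟩
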